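/- Let $\mathbb{K}$ be a field and let $G$ be a finite simple graph on a vertex set $V$, viewed as the simplicial complex $\Gamma$ whose faces are $\emptyset$, the vertices and the edges. For $F\subseteq V$ let $D_F=\{1,2\}^F$, and for $i\in D_V$ let $i_F\in D_F$ be its restriction. The toric ideal $I_G$ of the binary hierarchical model of $G$ is the kernel of $$\mathbb{K}[p_i : i\in D_V]\to\mathbb{K}[a^F_j : F \text{ a facet of } \Gamma,\ j\in D_F],\qquad p_i\mapsto\prod_{F}a^F_{i_F}.$$ Let $A_G:\mathbb{Z}^{D_V}\to\bigoplus_F\mathbb{Z}^{D_F}$ be the corresponding matrix, $e_i\mapsto\bigoplus_F e^F_{i_F}$. A Markov basis is a finite set $M\subset\ker A_G$ such that for each $u\in\mathbb{N}^{D_V}$ the fiber $\{v\in\mathbb{N}^{D_V}: A_Gv=A_Gu\}$ is connected by steps in $\pm M$. The element $f=f^+-f^-$ corresponds to the binomial $p^{f^+}-p^{f^-}$ and has its degree. The Markov width $\mu(G)$ is the largest degree of a minimal generator of $I_G$ ($0$ if $I_G=0$). The class of connected series-parallel graphs is the smallest class of simple graphs with two distinct distinguished vertices, top and bottom, that contains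 $K_2$ and is closed under series construction (identify $t_1$ with $b_2$; the new bottom is $b_1$, the new top is $t_2$) and parallel construction (identify $t_1$ with $t_2$ and $b_1$ with $b_2$, merging parallel edges; these are the new top and bottom). (a) Let $G$ be a connected series-parallel graph with top $t$ and bottom $b$. Then $\mu(G)\le 4$, and $\mu(G)=4$ if $G$ contains a cycle. Let $\gamma:\mathbb{Z}^{D_V}\to\mathbb{Z}^{D_{\{b,t\}}}$ be the projection $e_i\mapsto e_{i_{\{b,t\}}}$ and let $h$ be a generator of the kernel of the matrix of the subgraph induced on $\{b,t\}$ (this kernel is cyclic, and zero if $bt$ is an edge). Then there is a Markov basis each of whose elements is either 1. a move $f$ of degree four that is constant on $\{b,t\}$, that is, $\gamma(f)=0$; or 2. a move $f$ of degree two that is slow-varying on $\{b,t\}$, that is, $\gamma(f)\in\{0,h,-h\}$. (b) If a finite graph $G$ has no $K_4$ minor, then $I_G$ is generated by binomials of degrees two and four (that is, by a possibly empty set of binomials each of which has degree two or four). -/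

import Mathlib

/-! ### Hierarchical models

A simplicial complex on `V` is a lower set `Γ : LowerSet (Finset V)` of finite subsets of `V`
(the empty face is allowed), and `d v` is the number of states of the variable `v`. -/

namespace HierModel

/-- The joint states `D_V = ∏ v, [d v]`. -/
abbrev States {V : Type*} (d : V → ℕ) : Type _ := (v : V) → Fin (d v)

/-- The facets (inclusion-maximal faces) of a simplicial complex. -/
noncomputable def facets {V : Type*} [Finite V] (Γ : LowerSet (Finset V)) :
    Finset (Finset V) :=
  (Set.toFinite {F : Finset V | Maximal (· ∈ Γ) F}).toFinset

/-- The indices `(F, j)`, with `F` a facet and `j ∈ D_F`, of the parameters `a^F_j`. -/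
abbrev Params {V : Type*} [Finite V] (Γ : LowerSet (Finset V)) (d : V → ℕ) : Type _ :=
  Σ F : facets Γ, States (fun v : F.1 => d v)

/-- The parametrization `p_i ↦ ∏_F a^F_{i_F}` of the hierarchical model. -/
noncomputable def parametrization (K : Type*) [Field K] {V : Type*} [Finite V]
    (Γ : LowerSet (Finset V)) (d : V → ℕ) :
    MvPolynomial (States d) K →ₐ[K] MvPolynomial (Params Γ d) K :=
  MvPolynomial.aeval fun i => ∏ F : facets Γ, MvPolynomial.X ⟨F, F.1.restrict i⟩

/-- The toric ideal `I_{Γ,d}` of the hierarchical model. -/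
noncomputable def toricIdeal (K : Type*) [Field K] {V : Type*} [Finite V]
    (Γ : LowerSet (Finset V)) (d : V → ℕ) : Ideal (MvPolynomial (States d) K) :=
  RingHom.ker (parametrization K Γ d)

/-- The projection `γ_S : ℤ^{D_V} → ℤ^{D_S}`, `e_i ↦ e_{i_S}`. -/
noncomputable def margin {V : Type*} (d : V → ℕ) (S : Finset V) :
    (States d →₀ ℤ) →ₗ[ℤ] (States (fun v : S => d v) →₀ ℤ) :=
  Finsupp.lmapDomain ℤ ℤ S.restrict

/-- The matrix `A_{Γ,d}`, as a linear map: `e_i ↦ ⊕_F e^F_{i_F}`. -/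
noncomputable def designMap {V : Type*} [Finite V] (Γ : LowerSet (Finset V)) (d : V → ℕ) :
    (States d →₀ ℤ) →ₗ[ℤ] ((F : facets Γ) → (States (fun v : F.1 => d v) →₀ ℤ)) :=
  LinearMap.pi fun F => margin d F.1

/-- The induced subcomplex `Γ_S = {F ∈ Γ : F ⊆ S}`, as a complex with vertex set `S`. -/
def inducedComplex {V : Type*} (Γ : LowerSet (Finset V)) (S : Finset V) :
    LowerSet (Finset S) where
  carrier := {F | F.map (Function.Embedding.subtype _) ∈ Γ}
  lower' := fun _ _ h hF => Γ.lower (Finset.map_subset_map.2 h) hF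

/-- A graph as a simplicial complex: the faces are `∅`, the vertices and the edges. -/
def graphComplex {V : Type*} (G : SimpleGraph V) : LowerSet (Finset V) where
  carrier := {F | F.card ≤ 2 ∧ G.IsClique (F : Set V)}
  lower' := fun _ _ h hF =>
    ⟨(Finset.card_le_card h).trans hF.1, hF.2.subset (Finset.coe_subset.2 h)⟩

end HierModel

/-! ### Markov bases -/

namespace MarkovBasis

/-- The inclusion `ℕ^σ → ℤ^σ`. -/
noncomputable def toInt {σ : Type*} (u : σ →₀ ℕ) : σ →₀ ℤ :=
  u.mapRange Nat.cast Nat.cast_zero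

/-- The exponent `f⁺` of a move `f`. -/
noncomputable def posExp {σ : Type*} (f : σ →₀ ℤ) : σ →₀ ℕ :=
  f.mapRange Int.toNat rfl

/-- The exponent `f⁻` of a move `f`. -/
noncomputable def negExp {σ : Type*} (f : σ →₀ ℤ) : σ →₀ ℕ := posExp (-f)

/-- The binomial `p^{f⁺} - p^{f⁻}` of the move `f` is homogeneous of degree `n`. -/
def HasDegree {σ : Type*} (f : σ →₀ ℤ) (n : ℕ) : Prop :=
  (posExp f).degree = n ∧ (negExp f).degree = n

/-- The graph on the fiber of `b` in which `u`, `v` are adjacent if `u - v` or `v - u` is a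
move in `M` (and `u ≠ v`). -/
def fiberGraph {σ W : Type*} [AddCommGroup W] (A : (σ →₀ ℤ) →ₗ[ℤ] W)
    (M : Set (σ →₀ ℤ)) (b : W) : SimpleGraph {u : σ →₀ ℕ // A (toInt u) = b} :=
  SimpleGraph.fromRel fun u v => toInt u.1 - toInt v.1 ∈ M

/-- A finite set of moves in `ker A` is a Markov basis of `A` if it connects each nonempty
fiber. -/
def IsMarkovBasis {σ W : Type*} [AddCommGroup W] (A : (σ →₀ ℤ) →ₗ[ℤ] W)
    (M : Set (σ →₀ ℤ)) : Prop :=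
  M.Finite ∧ (∀ f ∈ M, f ∈ LinearMap.ker A) ∧
    ∀ u : σ →₀ ℕ, (fiberGraph A M (A (toInt u))).Connected

end MarkovBasis

/-- `S` is an inclusion-minimal set of homogeneous generators of `I`. -/
def IsMinimalHomogeneousGenerators {σ K : Type*} [Field K] (I : Ideal (MvPolynomial σ K))
    (S : Set (MvPolynomial σ K)) : Prop :=
  (∀ f ∈ S, ∃ n, f.IsHomogeneous n) ∧ Ideal.span S = I ∧ ∀ T, T ⊂ S → Ideal.span T ≠ I

/-- `μ(I)`: the largest degree of a minimal generator of `I` (`0` for the zero ideal). -/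
noncomputable def maxGeneratorDegree {σ K : Type*} [Field K]
    (I : Ideal (MvPolynomial σ K)) : ℕ∞ :=
  sSup {n | ∃ S, IsMinimalHomogeneousGenerators I S ∧ ∃ f ∈ S, n = (f.totalDegree : ℕ∞)}

/-- `I` is generated by binomials (differences of two monomials) whose degrees lie in `D`. -/
def IsGeneratedByBinomialsOfDegrees {σ K : Type*} [Field K] (I : Ideal (MvPolynomial σ K))
    (D : Set ℕ) : Prop :=
  ∃ S : Set (MvPolynomial σ K), Ideal.span S = I ∧
    ∀ f ∈ S, ∃ n ∈ D, ∃ u v : σ →₀ ℕ, u ≠ v ∧ u.degree = n ∧ v.degree = n ∧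
      f = MvPolynomial.monomial u 1 - MvPolynomial.monomial v 1

/-- The Markov width of a graph: `μ` of the toric ideal of its binary hierarchical model. -/
noncomputable def markovWidth (K : Type*) [Field K] {V : Type*} [Finite V]
    (G : SimpleGraph V) : ℕ∞ :=
  maxGeneratorDegree (HierModel.toricIdeal K (HierModel.graphComplex G) fun _ => 2)

/-- The move `f` is constant on `S`: its two terms have the same projection to `S`. -/
def IsConstantOn {V : Type*} {d : V → ℕ} (S : Finset V) (f : HierModel.States d →₀ ℤ) : Prop :=
  HierModel.margin d S f = 0

/-- The move `f` is slow-varying on `S` with respect to `h`: it projects to `0`, `h` or `-h`. -/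
def IsSlowVaryingOn {V : Type*} {d : V → ℕ} (S : Finset V)
    (h : HierModel.States (fun v : S => d v) →₀ ℤ) (f : HierModel.States d →₀ ℤ) : Prop :=
  HierModel.margin d S f = 0 ∨ HierModel.margin d S f = h ∨ HierModel.margin d S f = -h

/-- `h` generates the integer kernel of the matrix of the subcomplex of `Γ` induced on `S`
(so `h = 0` if `S` is a face of `Γ`). -/
def GeneratesKernelOn {V : Type*} [Finite V] (Γ : LowerSet (Finset V)) (d : V → ℕ)
    (S : Finset V) (h : HierModel.States (fun v : S => d v) →₀ ℤ) : Prop :=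
  LinearMap.ker (HierModel.designMap (HierModel.inducedComplex Γ S) fun v : S => d v) =
    Submodule.span ℤ {h}

/-! ### Graphs -/

universe u

/-- `IsSeriesParallel G t b`: `G`, with top `t` and bottom `b`, is a connected series-parallel
graph. In the two constructions `G` is the union of copies of `G₁` and `G₂` (embedded by `f₁` and
`f₂`) which share exactly the identified vertices; parallel edges are merged. -/
inductive IsSeriesParallel : {V : Type u} → SimpleGraph V → V → V → Prop
  | edge {V : Type u} (G : SimpleGraph V) (t b : V) (hV : ∀ v, v = t ∨ v = b)
      (hG : G.Adj t b) : IsSeriesParallel G t b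
  | series {V₁ V₂ V : Type u} (G₁ : SimpleGraph V₁) (G₂ : SimpleGraph V₂) (t₁ b₁ : V₁)
      (t₂ b₂ : V₂) (f₁ : V₁ ↪ V) (f₂ : V₂ ↪ V)
      (h₁ : IsSeriesParallel G₁ t₁ b₁) (h₂ : IsSeriesParallel G₂ t₂ b₂)
      (hcover : Set.range f₁ ∪ Set.range f₂ = Set.univ)
      (hglue : ∀ x y, f₁ x = f₂ y ↔ x = t₁ ∧ y = b₂) :
      IsSeriesParallel (G₁.map f₁ ⊔ G₂.map f₂) (f₂ t₂) (f₁ b₁)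
  | parallel {V₁ V₂ V : Type u} (G₁ : SimpleGraph V₁) (G₂ : SimpleGraph V₂) (t₁ b₁ : V₁)
      (t₂ b₂ : V₂) (f₁ : V₁ ↪ V) (f₂ : V₂ ↪ V)
      (h₁ : IsSeriesParallel G₁ t₁ b₁) (h₂ : IsSeriesParallel G₂ t₂ b₂)
      (hcover : Set.range f₁ ∪ Set.range f₂ = Set.univ)
      (hglue : ∀ x y, f₁ x = f₂ y ↔ (x = t₁ ∧ y = t₂) ∨ (x = b₁ ∧ y = b₂)) :
      IsSeriesParallel (G₁.map f₁ ⊔ G₂.map f₂) (f₁ t₁) (f₁ b₁)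

/-- `H` is a minor of `G`: there are disjoint connected branch sets in `G`, one for each vertex
of `H`, with an edge of `G` between the branch sets of adjacent vertices of `H`. -/
def IsMinorOf {W V : Type*} (H : SimpleGraph W) (G : SimpleGraph V) : Prop :=
  ∃ B : W → Set V, (∀ w, (G.induce (B w)).Connected) ∧
    (∀ w w', w ≠ w' → Disjoint (B w) (B w')) ∧
    ∀ w w', H.Adj w w' → ∃ x ∈ B w, ∃ y ∈ B w', G.Adj x y

/-! ### Row permutations -/

section RowPermutations

variable {ι α : Type*}

/-! A monomial of degree n is a table of n rows with entries in {0,1}, up to a permutation of the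
rows, and a fiber fixes the joint margins of the columns x, y with x = y or xy an edge. For two
binary columns with given sums the joint margin has one degree of freedom, the `level`: the number
of rows with ones in both.

The induction hypothesis `WellConnected` on a graph with terminals b, t has two halves. Tables of
one fiber with the same level on {b, t} are connected by moves of at most four rows that keep this
level; and below any higher level attained in the fiber, the current level and the next one are
joined by a move of two rows. Together they give `WellConnected.realize`: an exchange of entries of
two given rows in the terminal columns extends to a two-row move of the whole table, after a change
off these columns, as long as the new level stays between attained ones. When two parts are glued,
both extensions use the same two rows (`IsGluing.realize`), and tables that agree on all terminals
are connected (`IsGluing.conn_of_key_margin`). Only the terminal columns have to be studied.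

For a parallel construction these are the same two columns. For a series construction there are
three, b, x, t, and two tables are compared by the differences a, c of the levels on bx and xt and
the difference w of the numbers of rows with three ones. While a or c is nonzero, a two-row exchange
in one column reduces |a| + |c|; once both vanish, the difference is a multiple of the quartic that
trades the even cells of {0,1}³ for the odd ones (`series_conn`, `series_conn_parity`).

The induction covers all spanning subgraphs of series-parallel graphs at no extra cost. A graph on
at least two vertices without a K₄ minor is such a subgraph: it has a vertex with at most two
neighbours (`isMinorOf_of_min_degree`), which can be eliminated and later attached along an edge.
Moves of degree two are slow-varying for free, since their margin on {b, t} is too small to be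
another multiple of the generator (`exists_kernel_generator`).

For the lower bound, a connected graph with a cycle contracts to a triangle
(`exists_triangle_contraction`). The quartic of the triangle pulls back to a binomial one of whose
monomials has only proper divisors that are alone in their fibers, so every generating set has an
element of degree at least four (`MonomialMap.exists_totalDegree_ge`, `four_le_totalDegree`). -/

theorem exists_perm_of_card_fiber_eq [Fintype ι] [DecidableEq α] (f g : ι → α)
    (h : ∀ a, Fintype.card {i // f i = a} = Fintype.card {i // g i = a}) :
    ∃ σ : Equiv.Perm ι, ∀ i, f i = g (σ i) := by
  have e : ∀ a, {i // f i = a} ≃ {i // g i = a} := fun a => Fintype.equivOfCardEq (h a)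
  refine ⟨(Equiv.sigmaFiberEquiv f).symm.trans
    ((Equiv.sigmaCongrRight e).trans (Equiv.sigmaFiberEquiv g)), fun i => ?_⟩
  exact ((e (f i) ⟨i, rfl⟩).2).symm

theorem exists_perm_of_count_eq [Fintype ι] [DecidableEq α] (f g : ι → α)
    (h : ∀ a, ∑ i, (if f i = a then (1 : ℤ) else 0) = ∑ i, if g i = a then (1 : ℤ) else 0) :
    ∃ σ : Equiv.Perm ι, ∀ i, f i = g (σ i) := by
  refine exists_perm_of_card_fiber_eq f g fun a => ?_
  have := h a
  rw [Finset.sum_boole, Finset.sum_boole] at this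
  rw [Fintype.card_subtype, Fintype.card_subtype]
  exact_mod_cast this

/-- Rows outside `J` contribute equally to the counts of every value, so the counts over `J` agree
as well, and a matching of `J` extends by the identity. This keeps the support of a move under
control when its rows are rearranged. -/
theorem exists_perm_fixing_off [Fintype ι] [DecidableEq ι] (f g : ι → α) (J : Finset ι)
    (h : ∃ σ : Equiv.Perm ι, ∀ i, f i = g (σ i)) (hJ : ∀ i ∉ J, f i = g i) :
    ∃ σ : Equiv.Perm ι, (∀ i, f i = g (σ i)) ∧ ∀ i ∉ J, σ i = i := by
  classical
  obtain ⟨σ, hσ⟩ := h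
  have hsum : ∀ a, ∑ i : J, (if f i = a then (1 : ℤ) else 0)
      = ∑ i : J, if g i = a then (1 : ℤ) else 0 := by
    intro a
    have h1 : ∑ i, (if f i = a then (1 : ℤ) else 0) = ∑ i, if g i = a then (1 : ℤ) else 0 := by
      rw [← Equiv.sum_comp σ (fun i => if g i = a then (1 : ℤ) else 0)]
      exact Finset.sum_congr rfl fun i _ => by rw [hσ i]
    have h2 : ∑ i ∈ Jᶜ, (if f i = a then (1 : ℤ) else 0)
        = ∑ i ∈ Jᶜ, if g i = a then (1 : ℤ) else 0 :=
      Finset.sum_congr rfl fun i hi => by rw [hJ i (by simpa using hi)]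
    rw [← Finset.sum_add_sum_compl J, ← Finset.sum_add_sum_compl J, h2] at h1
    have h3 := add_right_cancel h1
    rw [← Finset.sum_coe_sort J, ← Finset.sum_coe_sort J] at h3
    exact h3
  obtain ⟨τ, hτ⟩ := exists_perm_of_count_eq (fun i : J => f i) (fun i : J => g i) hsum
  refine ⟨Equiv.Perm.ofSubtype τ, fun i => ?_, fun i hi => ?_⟩
  · by_cases hi : i ∈ J
    · rw [Equiv.Perm.ofSubtype_apply_of_mem τ hi]; exact hτ ⟨i, hi⟩
    · rw [Equiv.Perm.ofSubtype_apply_of_not_mem τ hi]; exact hJ i hi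
  · exact Equiv.Perm.ofSubtype_apply_of_not_mem τ hi

/-- A matching stays a matching after a transposition of two indices at which `g` takes the same
value. Two such corrections suffice; the second moves only indices different from `k`. -/
theorem exists_perm_of_two_values [DecidableEq ι] (f g : ι → α)
    (h : ∃ σ : Equiv.Perm ι, ∀ i, f i = g (σ i)) {i j k l : ι} (hij : i ≠ j) (hkl : k ≠ l)
    (hik : f i = g k) (hjl : f j = g l) :
    ∃ σ : Equiv.Perm ι, (∀ i, f i = g (σ i)) ∧ σ i = k ∧ σ j = l := by
  have key : ∀ (τ : Equiv.Perm ι), (∀ m, f m = g (τ m)) → ∀ i k, f i = g k →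
      ∀ m, f m = g ((Equiv.swap (τ i) k * τ) m) := by
    intro τ hτ i k hik m
    rw [Equiv.Perm.mul_apply]
    by_cases h1 : τ m = τ i
    · rw [h1, Equiv.swap_apply_left, ← hik, τ.injective h1]
    · by_cases h2 : τ m = k
      · rw [h2, Equiv.swap_apply_right, ← hτ i, hτ m, h2, hik]
      · rw [Equiv.swap_apply_of_ne_of_ne h1 h2, hτ]
  obtain ⟨σ₀, h₀⟩ := h
  set σ₁ := Equiv.swap (σ₀ i) k * σ₀ with hσ₁
  have h₁ : ∀ m, f m = g (σ₁ m) := key σ₀ h₀ i k hik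
  have h1i : σ₁ i = k := by simp [hσ₁]
  refine ⟨Equiv.swap (σ₁ j) l * σ₁, key σ₁ h₁ j l hjl, ?_, by simp⟩
  rw [Equiv.Perm.mul_apply, h1i, Equiv.swap_apply_of_ne_of_ne _ hkl]
  rw [← h1i]; exact fun h => hij (σ₁.injective h)

theorem sum_sub_sum_of_eq_off_pair [Fintype ι] [DecidableEq ι] {φ ψ : ι → ℤ} {i j : ι} (hij : i ≠ j)
    (h : ∀ k, k ≠ i → k ≠ j → φ k = ψ k) :
    ∑ k, φ k - ∑ k, ψ k = (φ i - ψ i) + (φ j - ψ j) := by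
  rw [← Finset.sum_sub_distrib]
  exact Finset.sum_eq_add i j hij (fun k _ hk => by rw [h k hk.1 hk.2, sub_self])
    (by simp) (by simp)

end RowPermutations

/-! ### Binary tables

A table of sample size `|ι|` is a family of rows `r i : V → Fin 2`. -/

namespace BinaryTable

set_option linter.unusedSectionVars false

/-- The value of a binary digit as an integer. -/
def bit (a : Fin 2) : ℤ := (a : ℕ)

theorem bit_eq_zero_or_one : ∀ a : Fin 2, bit a = 0 ∨ bit a = 1 := by decide

theorem bit_injective : Function.Injective bit := by
  intro a b; revert a b; decide

theorem bit_nonneg (a : Fin 2) : 0 ≤ bit a := by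
  rcases bit_eq_zero_or_one a with h | h <;> omega

theorem bit_le_one (a : Fin 2) : bit a ≤ 1 := by
  rcases bit_eq_zero_or_one a with h | h <;> omega

theorem indicator_eq_bits (a b : Fin 2) :
    (if a = b then (1 : ℤ) else 0) = (1 - bit b) + (2 * bit b - 1) * bit a := by
  revert a b; decide

variable {ι : Type*} [Fintype ι] [DecidableEq ι]

/-- The number of rows with the values `a₁`, `a₂`, `a₃` in three columns. -/
def cellCount (b x t : ι → Fin 2) (a₁ a₂ a₃ : Fin 2) : ℤ :=
  ∑ i, if (b i, x i, t i) = (a₁, a₂, a₃) then 1 else 0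

theorem cellCount_nonneg (b x t : ι → Fin 2) (a₁ a₂ a₃ : Fin 2) : 0 ≤ cellCount b x t a₁ a₂ a₃ :=
  Finset.sum_nonneg fun i _ => by split_ifs <;> norm_num

theorem exists_row_of_cellCount_pos {b x t : ι → Fin 2} {a₁ a₂ a₃ : Fin 2}
    (h : 0 < cellCount b x t a₁ a₂ a₃) : ∃ i, b i = a₁ ∧ x i = a₂ ∧ t i = a₃ := by
  obtain ⟨i, -, hi⟩ := Finset.exists_ne_zero_of_sum_ne_zero h.ne'
  refine ⟨i, ?_⟩
  by_contra hcon
  exact hi (if_neg (by simpa using hcon))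

/-- The indicator of a binary value is affine in the bit, so a product of three indicators expands
into moments. Hence a three-column margin is determined by the sample size, the column sums, the
three pair moments and the triple moment. -/
theorem cellCount_eq (b x t : ι → Fin 2) (a₁ a₂ a₃ : Fin 2) :
    cellCount b x t a₁ a₂ a₃ =
    (Fintype.card ι) * ((1 - bit a₁) * (1 - bit a₂) * (1 - bit a₃))
    + (2 * bit a₁ - 1) * (1 - bit a₂) * (1 - bit a₃) * ∑ i, bit (b i)
    + (1 - bit a₁) * (2 * bit a₂ - 1) * (1 - bit a₃) * ∑ i, bit (x i)
    + (1 - bit a₁) * (1 - bit a₂) * (2 * bit a₃ - 1) * ∑ i, bit (t i)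
    + (2 * bit a₁ - 1) * (2 * bit a₂ - 1) * (1 - bit a₃) * ∑ i, bit (b i) * bit (x i)
    + (1 - bit a₁) * (2 * bit a₂ - 1) * (2 * bit a₃ - 1) * ∑ i, bit (x i) * bit (t i)
    + (2 * bit a₁ - 1) * (1 - bit a₂) * (2 * bit a₃ - 1) * ∑ i, bit (b i) * bit (t i)
    + (2 * bit a₁ - 1) * (2 * bit a₂ - 1) * (2 * bit a₃ - 1) *
        ∑ i, bit (b i) * bit (x i) * bit (t i) := by
  have hc : (Fintype.card ι : ℤ) * ((1 - bit a₁) * (1 - bit a₂) * (1 - bit a₃)) =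
      ∑ _i : ι, ((1 - bit a₁) * (1 - bit a₂) * (1 - bit a₃)) := by simp
  rw [hc, cellCount]
  simp only [Finset.mul_sum, ← Finset.sum_add_distrib]
  refine Finset.sum_congr rfl fun i _ => ?_
  have : (if (b i, x i, t i) = (a₁, a₂, a₃) then (1 : ℤ) else 0) =
      (if b i = a₁ then (1 : ℤ) else 0) * (if x i = a₂ then (1 : ℤ) else 0) *
        (if t i = a₃ then (1 : ℤ) else 0) := by
    by_cases h1 : b i = a₁ <;> by_cases h2 : x i = a₂ <;> by_cases h3 : t i = a₃ <;>
      simp [h1, h2, h3]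
  rw [this]
  simp only [indicator_eq_bits]
  ring

theorem exists_perm_of_three_columns (b x t b' x' t' : ι → Fin 2)
    (hb : ∑ i, bit (b i) = ∑ i, bit (b' i)) (hx : ∑ i, bit (x i) = ∑ i, bit (x' i))
    (ht : ∑ i, bit (t i) = ∑ i, bit (t' i))
    (hbx : ∑ i, bit (b i) * bit (x i) = ∑ i, bit (b' i) * bit (x' i))
    (hxt : ∑ i, bit (x i) * bit (t i) = ∑ i, bit (x' i) * bit (t' i))
    (hbt : ∑ i, bit (b i) * bit (t i) = ∑ i, bit (b' i) * bit (t' i))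
    (hbxt : ∑ i, bit (b i) * bit (x i) * bit (t i) = ∑ i, bit (b' i) * bit (x' i) * bit (t' i)) :
    ∃ σ : Equiv.Perm ι, ∀ i, b i = b' (σ i) ∧ x i = x' (σ i) ∧ t i = t' (σ i) := by
  obtain ⟨σ, hσ⟩ := exists_perm_of_count_eq (fun i => (b i, x i, t i)) (fun i => (b' i, x' i, t' i))
    (fun a => by
      obtain ⟨a₁, a₂, a₃⟩ := a
      change cellCount b x t a₁ a₂ a₃ = cellCount b' x' t' a₁ a₂ a₃
      rw [cellCount_eq, cellCount_eq, hb, hx, ht, hbx, hxt, hbt, hbxt])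
  exact ⟨σ, fun i => by simpa using hσ i⟩

/-! ### Column margins and fibers of tables -/

variable {V : Type*}

/-- The tables `r` and `s` have the same joint margin on the columns `x` and `y`. -/
def ColEq (r s : ι → V → Fin 2) (x y : V) : Prop :=
  ∃ σ : Equiv.Perm ι, ∀ i, r i x = s (σ i) x ∧ r i y = s (σ i) y

/-- The number of ones in column `x`. -/
def colSum (r : ι → V → Fin 2) (x : V) : ℤ := ∑ i, bit (r i x)

/-- The number of rows with ones in both columns `x` and `y`. -/
def level (r : ι → V → Fin 2) (x y : V) : ℤ := ∑ i, bit (r i x) * bit (r i y)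

theorem sum_comp_perm (φ : ι → ℤ) (σ : Equiv.Perm ι) : ∑ i, φ (σ i) = ∑ i, φ i :=
  Equiv.sum_comp σ φ

theorem ColEq.refl (r : ι → V → Fin 2) (x y : V) : ColEq r r x y := ⟨1, fun _ => ⟨rfl, rfl⟩⟩

theorem ColEq.symm {r s : ι → V → Fin 2} {x y : V} (h : ColEq r s x y) : ColEq s r x y := by
  obtain ⟨σ, hσ⟩ := h
  exact ⟨σ⁻¹, fun i => by
    simpa [eq_comm] using hσ (σ⁻¹ i)⟩

theorem ColEq.trans {r s u : ι → V → Fin 2} {x y : V} (h : ColEq r s x y) (h' : ColEq s u x y) :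
    ColEq r u x y := by
  obtain ⟨σ, hσ⟩ := h
  obtain ⟨τ, hτ⟩ := h'
  exact ⟨τ * σ, fun i => ⟨(hσ i).1.trans (hτ (σ i)).1, (hσ i).2.trans (hτ (σ i)).2⟩⟩

theorem ColEq.swap {r s : ι → V → Fin 2} {x y : V} (h : ColEq r s x y) : ColEq r s y x := by
  obtain ⟨σ, hσ⟩ := h
  exact ⟨σ, fun i => (hσ i).symm⟩

theorem ColEq.colSum_eq {r s : ι → V → Fin 2} {x y : V} (h : ColEq r s x y) :
    colSum r x = colSum s x := by
  obtain ⟨σ, hσ⟩ := h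
  unfold colSum
  rw [← sum_comp_perm (fun i => bit (s i x)) σ]
  exact Finset.sum_congr rfl fun i _ => by rw [(hσ i).1]

theorem ColEq.level_eq {r s : ι → V → Fin 2} {x y : V} (h : ColEq r s x y) :
    level r x y = level s x y := by
  obtain ⟨σ, hσ⟩ := h
  unfold level
  rw [← sum_comp_perm (fun i => bit (s i x) * bit (s i y)) σ]
  exact Finset.sum_congr rfl fun i _ => by rw [(hσ i).1, (hσ i).2]

/-- A constant third column reduces this to the case of three columns, with all moments involving it
equal to zero. -/
theorem colEq_of_sums {r s : ι → V → Fin 2} {x y : V} (hx : colSum r x = colSum s x)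
    (hy : colSum r y = colSum s y) (h : level r x y = level s x y) : ColEq r s x y := by
  obtain ⟨σ, hσ⟩ := exists_perm_of_three_columns (fun i => r i x) (fun i => r i y) (fun _ => 0)
    (fun i => s i x) (fun i => s i y) (fun _ => 0) hx hy rfl h (by simp [bit]) (by simp [bit])
    (by simp [bit])
  exact ⟨σ, fun i => ⟨(hσ i).1, (hσ i).2.1⟩⟩

/-- The diagonal case of `SameFiber` records the vertex margins, which matter at isolated vertices.
Bits are idempotent, so there the level is the column sum. -/
theorem colEq_self_iff {r s : ι → V → Fin 2} {x : V} :
    ColEq r s x x ↔ colSum r x = colSum s x := by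
  refine ⟨fun h => h.colSum_eq, fun h => colEq_of_sums h h ?_⟩
  have : ∀ r : ι → V → Fin 2, level r x x = colSum r x := fun r =>
    Finset.sum_congr rfl fun i _ => by rcases bit_eq_zero_or_one (r i x) with h | h <;> simp [h]
  rw [this, this, h]

theorem colEq_of_cols {r s : ι → V → Fin 2} {x y : V} (h : ∀ i, r i x = s i x)
    (h' : ∀ i, r i y = s i y) : ColEq r s x y := ⟨1, fun i => ⟨h i, h' i⟩⟩

theorem colEq_perm (r : ι → V → Fin 2) (σ : Equiv.Perm ι) (x y : V) :
    ColEq (fun i => r (σ i)) r x y := ⟨σ, fun _ => ⟨rfl, rfl⟩⟩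

/-- The tables `r` and `s` lie in the same fiber of the binary graph model of `G`. -/
def SameFiber (G : SimpleGraph V) (r s : ι → V → Fin 2) : Prop :=
  ∀ x y, x = y ∨ G.Adj x y → ColEq r s x y

section SameFiber

variable {G : SimpleGraph V} {r s u : ι → V → Fin 2}

theorem SameFiber.refl (G : SimpleGraph V) (r : ι → V → Fin 2) : SameFiber G r r :=
  fun _ _ _ => ColEq.refl _ _ _

theorem SameFiber.symm (h : SameFiber G r s) : SameFiber G s r := fun x y hxy => (h x y hxy).symm

theorem SameFiber.trans (h : SameFiber G r s) (h' : SameFiber G s u) : SameFiber G r u :=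
  fun x y hxy => (h x y hxy).trans (h' x y hxy)

theorem sameFiber_perm (G : SimpleGraph V) (r : ι → V → Fin 2) (σ : Equiv.Perm ι) :
    SameFiber G (fun i => r (σ i)) r := fun _ _ _ => colEq_perm _ _ _ _

theorem SameFiber.colSum_eq (h : SameFiber G r s) (x : V) : colSum r x = colSum s x :=
  (h x x (Or.inl rfl)).colSum_eq

theorem SameFiber.colEq_of_level (h : SameFiber G r s) {x y : V}
    (hl : level r x y = level s x y) : ColEq r s x y :=
  colEq_of_sums (h.colSum_eq x) (h.colSum_eq y) hl

end SameFiber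

/-! ### Small moves and well-connected fibers -/

/-- The rows of `r` and `s` agree up to a permutation, or outside two rows, or outside four rows
among which no row of `r` equals a row of `s`. -/
def SmallMove (r s : ι → V → Fin 2) : Prop :=
  (∃ σ : Equiv.Perm ι, ∀ i, s i = r (σ i)) ∨
  (∃ J : Finset ι, J.card = 2 ∧ ∀ i ∉ J, r i = s i) ∨
  ∃ J : Finset ι, J.card = 4 ∧ (∀ i ∉ J, r i = s i) ∧ ∀ i ∈ J, ∀ j ∈ J, r i ≠ s j

theorem SmallMove.symm {r s : ι → V → Fin 2} (h : SmallMove r s) : SmallMove s r := by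
  rcases h with ⟨σ, hσ⟩ | ⟨J, hJ, h⟩ | ⟨J, hJ, h, h'⟩
  · exact Or.inl ⟨σ⁻¹, fun i => by simp [hσ]⟩
  · exact Or.inr (Or.inl ⟨J, hJ, fun i hi => (h i hi).symm⟩)
  · exact Or.inr (Or.inr ⟨J, hJ, fun i hi => (h i hi).symm, fun i hi j hj e => h' j hj i hi e.symm⟩)

/-- A small move within a fiber that is constant on the columns `b` and `t`. -/
def Step (G : SimpleGraph V) (b t : V) (r s : ι → V → Fin 2) : Prop :=
  SameFiber G r s ∧ ColEq r s b t ∧ SmallMove r s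

/-- Connectedness by small moves that are constant on the columns `b` and `t`. -/
def Conn (G : SimpleGraph V) (b t : V) : (ι → V → Fin 2) → (ι → V → Fin 2) → Prop :=
  Relation.ReflTransGen (Step G b t)

section Conn

variable {G : SimpleGraph V} {b t : V} {r s u : ι → V → Fin 2}

theorem Step.symm (h : Step G b t r s) : Step G b t s r :=
  ⟨h.1.symm, h.2.1.symm, h.2.2.symm⟩

theorem Conn.symm (h : Conn G b t r s) : Conn G b t s r := by
  induction h with
  | refl => exact Relation.ReflTransGen.refl
  | tail _ h ih => exact Relation.ReflTransGen.head h.symm ih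

theorem Conn.swap (h : Conn G b t r s) : Conn G t b r s := by
  induction h with
  | refl => exact Relation.ReflTransGen.refl
  | tail _ h ih => exact ih.tail ⟨h.1, h.2.1.swap, h.2.2⟩

theorem Conn.sameFiber (h : Conn G b t r s) : SameFiber G r s := by
  induction h with
  | refl => exact SameFiber.refl _ _
  | tail _ h ih => exact ih.trans h.1

theorem Conn.colEq (h : Conn G b t r s) : ColEq r s b t := by
  induction h with
  | refl => exact ColEq.refl _ _ _
  | tail _ h ih => exact ih.trans h.2.1

theorem conn_perm (G : SimpleGraph V) (b t : V) (r : ι → V → Fin 2) (σ : Equiv.Perm ι) :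
    Conn G b t (fun i => r (σ i)) r :=
  Relation.ReflTransGen.single (Step.symm
    ⟨(sameFiber_perm G r σ).symm, (colEq_perm r σ b t).symm, Or.inl ⟨σ, fun _ => rfl⟩⟩)

theorem conn_of_eq_off_pair (h : SameFiber G r s) (hc : ColEq r s b t) {i j : ι} (hij : i ≠ j)
    (hr : ∀ k, k ≠ i → k ≠ j → r k = s k) : Conn G b t r s :=
  Relation.ReflTransGen.single ⟨h, hc, Or.inr (Or.inl ⟨{i, j}, Finset.card_pair hij, fun k hk => by
    simp only [Finset.mem_insert, Finset.mem_singleton, not_or] at hk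
    exact hr k hk.1 hk.2⟩)⟩

end Conn

/-- The fibers of the binary graph model of `G` are well connected with respect to the vertices
`b` and `t`: tables with the same margin on `{b, t}` are connected by small moves preserving that
margin, and consecutive levels are joined by a move of two rows. -/
structure WellConnected (ι : Type*) [Fintype ι] [DecidableEq ι] (G : SimpleGraph V) (b t : V) :
    Prop where
  conn : ∀ r s : ι → V → Fin 2, SameFiber G r s → ColEq r s b t → Conn G b t r s
  up : ∀ r s : ι → V → Fin 2, SameFiber G r s → level r b t < level s b t →
    ∃ r' s' : ι → V → Fin 2, SameFiber G r r' ∧ SameFiber G r s' ∧ level r' b t = level r b t ∧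
      level s' b t = level r b t + 1 ∧ ∃ i j, i ≠ j ∧ ∀ k, k ≠ i → k ≠ j → r' k = s' k

theorem level_comm (r : ι → V → Fin 2) (b t : V) : level r b t = level r t b :=
  Finset.sum_congr rfl fun _ _ => mul_comm _ _

theorem WellConnected.swap {G : SimpleGraph V} {b t : V} (h : WellConnected ι G b t) :
    WellConnected ι G t b where
  conn r s h₁ h₂ := (h.conn r s h₁ h₂.swap).swap
  up r s h₁ h₂ := by
    simp only [level_comm _ t b] at h₂ ⊢
    exact h.up r s h₁ h₂

/-- The field `up` only describes the step out of the level of its first table. Restarting it at the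
table just reached climbs through all levels below that of `s`. -/
theorem WellConnected.exists_step_at {G : SimpleGraph V} {b t : V} (h : WellConnected ι G b t)
    {r s : ι → V → Fin 2} (hrs : SameFiber G r s) (m : ℤ) (h₁ : level r b t ≤ m)
    (h₂ : m < level s b t) :
    ∃ r' s' : ι → V → Fin 2, SameFiber G r r' ∧ SameFiber G r s' ∧ level r' b t = m ∧
      level s' b t = m + 1 ∧ ∃ i j, i ≠ j ∧ ∀ k, k ≠ i → k ≠ j → r' k = s' k := by
  induction m, h₁ using Int.leInduction with
  | base => exact h.up r s hrs h₂
  | succ m hm ih =>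
    obtain ⟨r', s', -, hs', -, hl, -⟩ := ih (by omega)
    obtain ⟨r₂, s₂, h3, h4, h5, h6, h7⟩ := h.up s' s (hs'.symm.trans hrs) (by omega)
    exact ⟨r₂, s₂, hs'.trans h3, hs'.trans h4, by omega, by omega, h7⟩

/-- With fixed column sums, two rows can change their level only by trading {00, 11} for {01, 10},
and such a trade is an exchange within one of the two columns. -/
theorem pairs_of_level_change (a b c d a' b' c' d' : Fin 2) (h₁ : bit a + bit c = bit a' + bit c')
    (h₂ : bit b + bit d = bit b' + bit d')
    (h₃ : bit a * bit b + bit c * bit d ≠ bit a' * bit b' + bit c' * bit d') :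
    a ≠ c ∧ b ≠ d ∧ ((a' = c ∧ c' = a ∧ b' = b ∧ d' = d) ∨ (a' = a ∧ c' = c ∧ b' = d ∧ d' = b)) := by
  revert a b c d a' b' c' d'; decide

/-- The sign of the level change under an exchange tells {00, 11} from {01, 10}, so it determines
the two rows up to their order. -/
theorem pairs_of_level_change_eq (a b c d a' b' c' d' : Fin 2) (hac : a ≠ c) (hbd : b ≠ d)
    (hac' : a' ≠ c') (hbd' : b' ≠ d')
    (h : bit c * bit b + bit a * bit d - (bit a * bit b + bit c * bit d) =
      bit c' * bit b' + bit a' * bit d' - (bit a' * bit b' + bit c' * bit d')) :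
    (a' = a ∧ b' = b ∧ c' = c ∧ d' = d) ∨ (a' = c ∧ b' = d ∧ c' = a ∧ d' = b) := by
  revert a b c d a' b' c' d'; decide

theorem sum_eq_off_pair {i j : ι} (hij : i ≠ j) {r s : ι → V → Fin 2}
    (h : ∀ k, k ≠ i → k ≠ j → r k = s k) (φ : (V → Fin 2) → ℤ) :
    ∑ k, φ (s k) - ∑ k, φ (r k) = φ (s i) + φ (s j) - (φ (r i) + φ (r j)) := by
  rw [sum_sub_sum_of_eq_off_pair hij (fun k h1 h2 => by rw [h k h1 h2])]
  ring

/-- Two rows that differ in both columns `b` and `t` can exchange their `b`-entries, after a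
change of the table outside these columns. -/
theorem WellConnected.exchange {G : SimpleGraph V} {b t : V} (h : WellConnected ι G b t)
    {r s : ι → V → Fin 2} (hrs : SameFiber G r s) {i j : ι} (hij : i ≠ j)
    (hb : r i b ≠ r j b) (ht : r i t ≠ r j t)
    (hl : (level r b t ≤ ∑ k, bit (r (Equiv.swap i j k) b) * bit (r k t) ∧
        ∑ k, bit (r (Equiv.swap i j k) b) * bit (r k t) ≤ level s b t) ∨
      (level s b t ≤ ∑ k, bit (r (Equiv.swap i j k) b) * bit (r k t) ∧
        ∑ k, bit (r (Equiv.swap i j k) b) * bit (r k t) ≤ level r b t)) :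
    ∃ r' s' : ι → V → Fin 2, SameFiber G r r' ∧ SameFiber G r s' ∧
      (∀ k, r' k b = r k b ∧ r' k t = r k t) ∧
      (∀ k, s' k b = r (Equiv.swap i j k) b ∧ s' k t = r k t) ∧
      ∀ k, k ≠ i → k ≠ j → r' k = s' k := by
  set L := ∑ k, bit (r (Equiv.swap i j k) b) * bit (r k t) with hL
  have hLr : L - level r b t = bit (r j b) * bit (r i t) + bit (r i b) * bit (r j t)
      - (bit (r i b) * bit (r i t) + bit (r j b) * bit (r j t)) := by
    rw [hL, level, sum_sub_sum_of_eq_off_pair hij]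
    · simp only [Equiv.swap_apply_left, Equiv.swap_apply_right]; ring
    · intro k h1 h2; rw [Equiv.swap_apply_of_ne_of_ne h1 h2]
  -- The change is minus the product of the differences of the two rows in the columns `b` and `t`,
  -- and both differences are ±1.
  have hval : L - level r b t = 1 ∨ L - level r b t = -1 := by
    rw [hLr]
    generalize r i b = a at *; generalize r j b = c at *
    generalize r i t = d at *; generalize r j t = e at *
    clear hLr hL hl
    revert a c d e; decide
  -- Adjacent tables at the levels of `r` and of the exchange: climb from `r` towards `s` if the
  -- level grows, and from `s` towards `r` if it drops.
  obtain ⟨ρ, ρ', hρ, hρ', hlρ, hlρ', k, l, hkl, hoff⟩ : ∃ ρ ρ' : ι → V → Fin 2,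
      SameFiber G r ρ ∧ SameFiber G r ρ' ∧ level ρ b t = level r b t ∧ level ρ' b t = L ∧
      ∃ i j, i ≠ j ∧ ∀ k, k ≠ i → k ≠ j → ρ k = ρ' k := by
    rcases hval with hv | hv
    · obtain ⟨ρ, ρ', h1, h2, h3, h4, h5⟩ := h.exists_step_at hrs (level r b t) le_rfl (by omega)
      exact ⟨ρ, ρ', h1, h2, h3, by omega, h5⟩
    · obtain ⟨ρ', ρ, h1, h2, h3, h4, k, l, hkl, h5⟩ :=
        h.exists_step_at hrs.symm L (by omega) (by omega)
      exact ⟨ρ, ρ', hrs.trans h2, hrs.trans h1, by omega, by omega, k, l, hkl,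
        fun m h6 h7 => (h5 m h6 h7).symm⟩
  have e1 := sum_eq_off_pair hkl hoff (fun v => bit (v b))
  have e2 := sum_eq_off_pair hkl hoff (fun v => bit (v t))
  have e3 := sum_eq_off_pair hkl hoff (fun v => bit (v b) * bit (v t))
  have c1 := (hρ.symm.trans hρ').colSum_eq b
  have c2 := (hρ.symm.trans hρ').colSum_eq t
  simp only [colSum] at c1 c2
  simp only [level] at hlρ hlρ' hval
  obtain ⟨hkb, hkt, hor⟩ := pairs_of_level_change (ρ k b) (ρ k t) (ρ l b) (ρ l t) (ρ' k b) (ρ' k t)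
    (ρ' l b) (ρ' l t) (by omega) (by omega) (by omega)
  -- choose the names of the two rows so that they match `i` and `j`
  obtain ⟨k, l, hkl, hoff, hki, hor⟩ : ∃ k l, k ≠ l ∧ (∀ m, m ≠ k → m ≠ l → ρ m = ρ' m) ∧
      (ρ k b = r i b ∧ ρ k t = r i t ∧ ρ l b = r j b ∧ ρ l t = r j t) ∧
      ((ρ' k b = r j b ∧ ρ' l b = r i b ∧ ρ' k t = r i t ∧ ρ' l t = r j t) ∨
       (ρ' k b = r i b ∧ ρ' l b = r j b ∧ ρ' k t = r j t ∧ ρ' l t = r i t)) := by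
    have := pairs_of_level_change_eq (r i b) (r i t) (r j b) (r j t) (ρ k b) (ρ k t) (ρ l b) (ρ l t)
      hb ht hkb hkt (by
        rw [← hLr]
        simp only [level]
        rcases hor with ⟨h1, h2, h3, h4⟩ | ⟨h1, h2, h3, h4⟩
        · rw [h1, h2, h3, h4] at e3; linarith
        · rw [h1, h2, h3, h4] at e3; linarith)
    rcases this with ⟨h1, h2, h3, h4⟩ | ⟨h1, h2, h3, h4⟩
    · refine ⟨k, l, hkl, hoff, ⟨h1, h2, h3, h4⟩, ?_⟩
      rw [h1, h2, h3, h4] at hor; exact hor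
    · refine ⟨l, k, hkl.symm, fun m h5 h6 => hoff m h6 h5, ⟨h3, h4, h1, h2⟩, ?_⟩
      rw [h1, h2, h3, h4] at hor; tauto
  have hcol : ∃ σ : Equiv.Perm ι, ∀ i, (r i b, r i t) = (ρ (σ i) b, ρ (σ i) t) := by
    obtain ⟨σ, hσ⟩ := hρ.colEq_of_level (x := b) (y := t) hlρ.symm
    exact ⟨σ, fun i => Prod.ext (hσ i).1 (hσ i).2⟩
  -- Rows of `ρ` are relabelled so that its `b` and `t` columns become those of `r`, with the two
  -- rows of the move placed at `i` and `j`.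
  obtain ⟨σ, hσ, hσi, hσj⟩ := exists_perm_of_two_values (fun i => (r i b, r i t))
    (fun i => (ρ i b, ρ i t)) hcol hij hkl (by simp [hki]) (by simp [hki])
  simp only [Prod.mk.injEq] at hσ
  have hσoff : ∀ m, m ≠ i → m ≠ j → σ m ≠ k ∧ σ m ≠ l := fun m h1 h2 =>
    ⟨fun e => h1 (σ.injective (e.trans hσi.symm)), fun e => h2 (σ.injective (e.trans hσj.symm))⟩
  refine ⟨fun m => ρ (σ m), ?_⟩
  rcases hor with ⟨h1, h2, h3, h4⟩ | ⟨h1, h2, h3, h4⟩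
  · refine ⟨fun m => ρ' (σ m), hρ.trans (sameFiber_perm G ρ σ).symm,
      hρ'.trans (sameFiber_perm G ρ' σ).symm, fun m => ⟨(hσ m).1.symm, (hσ m).2.symm⟩, fun m => ?_,
      fun m h5 h6 => hoff _ (hσoff m h5 h6).1 (hσoff m h5 h6).2⟩
    beta_reduce
    by_cases hmi : m = i
    · subst hmi; rw [Equiv.swap_apply_left, hσi]; exact ⟨h1, h3⟩
    · by_cases hmj : m = j
      · subst hmj; rw [Equiv.swap_apply_right, hσj]; exact ⟨h2, h4⟩
      · rw [Equiv.swap_apply_of_ne_of_ne hmi hmj,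
          ← hoff _ (hσoff m hmi hmj).1 (hσoff m hmi hmj).2]
        exact ⟨(hσ m).1.symm, (hσ m).2.symm⟩
  -- Here the move exchanges the `t`-entries. Relabelling rows `i` and `j` of the second table turns
  -- this into an exchange of the `b`-entries.
  · refine ⟨fun m => ρ' (σ (Equiv.swap i j m)), hρ.trans (sameFiber_perm G ρ σ).symm,
      hρ'.trans (sameFiber_perm G ρ' (σ * Equiv.swap i j)).symm,
      fun m => ⟨(hσ m).1.symm, (hσ m).2.symm⟩, fun m => ?_, fun m h5 h6 => ?_⟩
    · beta_reduce
      by_cases hmi : m = i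
      · subst hmi; rw [Equiv.swap_apply_left, hσj]; exact ⟨h2, h4⟩
      · by_cases hmj : m = j
        · subst hmj; rw [Equiv.swap_apply_right, hσi]; exact ⟨h1, h3⟩
        · rw [Equiv.swap_apply_of_ne_of_ne hmi hmj,
            ← hoff _ (hσoff m hmi hmj).1 (hσoff m hmi hmj).2]
          exact ⟨(hσ m).1.symm, (hσ m).2.symm⟩
    · beta_reduce
      rw [Equiv.swap_apply_of_ne_of_ne h5 h6]
      exact hoff _ (hσoff m h5 h6).1 (hσoff m h5 h6).2

end BinaryTable

namespace BinaryTable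

set_option linter.unusedSectionVars false

variable {ι : Type*} [Fintype ι] [DecidableEq ι] {V V₁ V₂ : Type*}

/-! ### Exchanging entries of two rows -/

open Classical in
/-- The table obtained from `r` by exchanging the entries of rows `i` and `j` in the columns of
the set `K`. -/
noncomputable def swapCols (K : Set V) (r : ι → V → Fin 2) (i j : ι) : ι → V → Fin 2 :=
  fun k v => if v ∈ K then r (Equiv.swap i j k) v else r k v

theorem swapCols_of_mem {K : Set V} (r : ι → V → Fin 2) (i j k : ι) {v : V} (hv : v ∈ K) :
    swapCols K r i j k v = r (Equiv.swap i j k) v := if_pos hv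

theorem swapCols_of_notMem {K : Set V} (r : ι → V → Fin 2) (i j k : ι) {v : V} (hv : v ∉ K) :
    swapCols K r i j k v = r k v := if_neg hv

theorem swapCols_off (K : Set V) (r : ι → V → Fin 2) {i j k : ι} (hi : k ≠ i) (hj : k ≠ j) :
    swapCols K r i j k = r k := by
  funext v
  by_cases hv : v ∈ K
  · rw [swapCols_of_mem r i j k hv, Equiv.swap_apply_of_ne_of_ne hi hj]
  · rw [swapCols_of_notMem r i j k hv]

theorem colSum_swapCols (K : Set V) (r : ι → V → Fin 2) (i j : ι) (v : V) :
    colSum (swapCols K r i j) v = colSum r v := by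
  unfold colSum
  by_cases hv : v ∈ K
  · simp only [swapCols_of_mem r i j _ hv]
    exact sum_comp_perm (fun k => bit (r k v)) (Equiv.swap i j)
  · simp only [swapCols_of_notMem r i j _ hv]

/-- Exchanging entries of two rows in the columns `b` or `t` is realized by a two-row move within
the fiber, after a change of the table outside these columns, provided the new level lies between
two levels of the fiber. -/
theorem WellConnected.realize {G : SimpleGraph V} {b t : V} (h : WellConnected ι G b t)
    {r s : ι → V → Fin 2} (hrs : SameFiber G r s) {i j : ι} (hij : i ≠ j) (K : Set V)
    (hl : level (swapCols K r i j) b t ∈ Set.uIcc (level r b t) (level s b t)) :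
    ∃ r' s' : ι → V → Fin 2, SameFiber G r r' ∧ SameFiber G r s' ∧
      (∀ k, r' k b = r k b ∧ r' k t = r k t) ∧
      (∀ k, s' k b = swapCols K r i j k b ∧ s' k t = swapCols K r i j k t) ∧
      ∀ k, k ≠ i → k ≠ j → r' k = s' k := by
  have trivial_case : (∀ k, swapCols K r i j k b = r k b ∧ swapCols K r i j k t = r k t) → _ :=
    fun hk => (⟨r, r, SameFiber.refl G r, SameFiber.refl G r, fun _ => ⟨rfl, rfl⟩,
      fun k => ⟨(hk k).1.symm, (hk k).2.symm⟩, fun _ _ _ => rfl⟩ :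
      ∃ r' s' : ι → V → Fin 2, SameFiber G r r' ∧ SameFiber G r s' ∧
      (∀ k, r' k b = r k b ∧ r' k t = r k t) ∧
      (∀ k, s' k b = swapCols K r i j k b ∧ s' k t = swapCols K r i j k t) ∧
      ∀ k, k ≠ i → k ≠ j → r' k = s' k)
  have swap_case : (∀ k, swapCols K r i j k b = r (Equiv.swap i j k) b ∧
      swapCols K r i j k t = r (Equiv.swap i j k) t) → _ :=
    fun hk => (⟨r, fun k => r (Equiv.swap i j k), SameFiber.refl G r, (sameFiber_perm G r _).symm,
      fun _ => ⟨rfl, rfl⟩, fun k => ⟨(hk k).1.symm, (hk k).2.symm⟩,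
      fun k h1 h2 => by simp only [Equiv.swap_apply_of_ne_of_ne h1 h2]⟩ :
      ∃ r' s' : ι → V → Fin 2, SameFiber G r r' ∧ SameFiber G r s' ∧
      (∀ k, r' k b = r k b ∧ r' k t = r k t) ∧
      (∀ k, s' k b = swapCols K r i j k b ∧ s' k t = swapCols K r i j k t) ∧
      ∀ k, k ≠ i → k ≠ j → r' k = s' k)
  have heq : ∀ v, r i v = r j v → ∀ k, r (Equiv.swap i j k) v = r k v := by
    intro v hv k
    by_cases h1 : k = i
    · subst h1; rw [Equiv.swap_apply_left, hv]
    · by_cases h2 : k = j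
      · subst h2; rw [Equiv.swap_apply_right, hv]
      · rw [Equiv.swap_apply_of_ne_of_ne h1 h2]
  -- `exchange` is needed only if exactly one of the two columns lies in `K` and the rows differ in
  -- both. Otherwise, on these columns, the exchange is either invisible or a relabelling of rows
  -- `i` and `j`.
  by_cases hb : b ∈ K <;> by_cases ht : t ∈ K
  · exact swap_case fun k => ⟨swapCols_of_mem r i j k hb, swapCols_of_mem r i j k ht⟩
  · by_cases eb : r i b = r j b
    · exact trivial_case fun k =>
        ⟨by rw [swapCols_of_mem r i j k hb, heq b eb], swapCols_of_notMem r i j k ht⟩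
    · by_cases et : r i t = r j t
      · exact swap_case fun k =>
          ⟨swapCols_of_mem r i j k hb, by rw [swapCols_of_notMem r i j k ht, heq t et]⟩
      · obtain ⟨r', s', h1, h2, h3, h4, h5⟩ := h.exchange hrs hij eb et (by
          simp only [level, swapCols_of_mem r i j _ hb, swapCols_of_notMem r i j _ ht] at hl ⊢
          rcases Set.mem_uIcc.1 hl with h | h
          · exact Or.inl h
          · exact Or.inr h)
        refine ⟨r', s', h1, h2, h3, fun k => ?_, h5⟩
        rw [swapCols_of_mem r i j k hb, swapCols_of_notMem r i j k ht]
        exact h4 k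
  · by_cases et : r i t = r j t
    · exact trivial_case fun k =>
        ⟨swapCols_of_notMem r i j k hb, by rw [swapCols_of_mem r i j k ht, heq t et]⟩
    · by_cases eb : r i b = r j b
      · exact swap_case fun k =>
          ⟨by rw [swapCols_of_notMem r i j k hb, heq b eb], swapCols_of_mem r i j k ht⟩
      · obtain ⟨r', s', h1, h2, h3, h4, h5⟩ := h.swap.exchange hrs hij et eb (by
          simp only [level_comm _ t b]
          simp only [level, swapCols_of_mem r i j _ ht, swapCols_of_notMem r i j _ hb,
            mul_comm (bit (r _ b)) (bit (r (Equiv.swap i j _) t))] at hl ⊢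
          rcases Set.mem_uIcc.1 hl with h | h
          · exact Or.inl h
          · exact Or.inr h)
        refine ⟨r', s', h1, h2, fun k => (h3 k).symm, fun k => ?_, h5⟩
        rw [swapCols_of_mem r i j k ht, swapCols_of_notMem r i j k hb]
        exact (h4 k).symm
  · exact trivial_case fun k => ⟨swapCols_of_notMem r i j k hb, swapCols_of_notMem r i j k ht⟩

/-! ### Gluing two tables -/

/-- The restriction of a table along a map of vertex sets. -/
def res (f : V₁ → V) (r : ι → V → Fin 2) : ι → V₁ → Fin 2 := fun i v => r i (f v)

/-- `V` is the union of the images of `V₁` and `V₂`, whose common vertices are among the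
distinguished vertices of both parts. -/
structure IsGluing (f₁ : V₁ ↪ V) (f₂ : V₂ ↪ V) (p₁ q₁ : V₁) (p₂ q₂ : V₂) : Prop where
  cover : ∀ v, (∃ x, f₁ x = v) ∨ ∃ y, f₂ y = v
  left : ∀ x y, f₁ x = f₂ y → x = p₁ ∨ x = q₁
  right : ∀ x y, f₁ x = f₂ y → y = p₂ ∨ y = q₂

section Gluing

variable {f₁ : V₁ ↪ V} {f₂ : V₂ ↪ V} {p₁ q₁ : V₁} {p₂ q₂ : V₂}

theorem IsGluing.symm (hg : IsGluing f₁ f₂ p₁ q₁ p₂ q₂) : IsGluing f₂ f₁ p₂ q₂ p₁ q₁ where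
  cover v := (hg.cover v).symm
  left x y h := hg.right y x h.symm
  right x y h := hg.left y x h.symm

theorem exists_join (f₁ : V₁ ↪ V) (f₂ : V₂ ↪ V) (r₁ : ι → V₁ → Fin 2) (r₂ : ι → V₂ → Fin 2)
    (h : ∀ i x y, f₁ x = f₂ y → r₁ i x = r₂ i y) :
    ∃ r : ι → V → Fin 2, res f₁ r = r₁ ∧ res f₂ r = r₂ := by
  classical
  refine ⟨fun i v => if hv : ∃ x, f₁ x = v then r₁ i hv.choose else
    if hv : ∃ y, f₂ y = v then r₂ i hv.choose else 0, ?_, ?_⟩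
  · funext i x
    have hx : ∃ x', f₁ x' = f₁ x := ⟨x, rfl⟩
    simp only [res, dif_pos hx]
    rw [f₁.injective hx.choose_spec]
  · funext i y
    have hy : ∃ y', f₂ y' = f₂ y := ⟨y, rfl⟩
    by_cases hx : ∃ x, f₁ x = f₂ y
    · simp only [res, dif_pos hx]
      exact h i _ _ hx.choose_spec
    · simp only [res, dif_neg hx, dif_pos hy]
      rw [f₂.injective hy.choose_spec]

theorem IsGluing.row_ext (hg : IsGluing f₁ f₂ p₁ q₁ p₂ q₂) {r s : ι → V → Fin 2} {i j : ι}
    (h₁ : res f₁ r i = res f₁ s j) (h₂ : res f₂ r i = res f₂ s j) : r i = s j := by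
  funext v
  rcases hg.cover v with ⟨x, rfl⟩ | ⟨y, rfl⟩
  · exact congrFun h₁ x
  · exact congrFun h₂ y

theorem IsGluing.sameFiber_iff (hg : IsGluing f₁ f₂ p₁ q₁ p₂ q₂) {G : SimpleGraph V}
    {G₁ : SimpleGraph V₁} {G₂ : SimpleGraph V₂} (hG : G = G₁.map f₁ ⊔ G₂.map f₂)
    {r s : ι → V → Fin 2} :
    SameFiber G r s ↔ SameFiber G₁ (res f₁ r) (res f₁ s) ∧ SameFiber G₂ (res f₂ r) (res f₂ s) := by
  subst hG
  constructor
  · intro h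
    refine ⟨fun x y hxy => h (f₁ x) (f₁ y) ?_, fun x y hxy => h (f₂ x) (f₂ y) ?_⟩
    · exact hxy.imp (congrArg f₁) fun h => Or.inl ((SimpleGraph.map_adj _ _ _ _).2 ⟨x, y, h, rfl, rfl⟩)
    · exact hxy.imp (congrArg f₂) fun h => Or.inr ((SimpleGraph.map_adj _ _ _ _).2 ⟨x, y, h, rfl, rfl⟩)
  · rintro ⟨h₁, h₂⟩ x y (rfl | h | h)
    · rcases hg.cover x with ⟨a, rfl⟩ | ⟨a, rfl⟩
      · exact h₁ a a (Or.inl rfl)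
      · exact h₂ a a (Or.inl rfl)
    · obtain ⟨a, c, hac, rfl, rfl⟩ := (SimpleGraph.map_adj _ _ _ _).1 h
      exact h₁ a c (Or.inr hac)
    · obtain ⟨a, c, hac, rfl, rfl⟩ := (SimpleGraph.map_adj _ _ _ _).1 h
      exact h₂ a c (Or.inr hac)

/-- A small move on the first part that is constant on its distinguished vertices lifts to the
union. -/
theorem IsGluing.lift_step (hg : IsGluing f₁ f₂ p₁ q₁ p₂ q₂) {G : SimpleGraph V}
    {G₁ : SimpleGraph V₁} {G₂ : SimpleGraph V₂} (hG : G = G₁.map f₁ ⊔ G₂.map f₂) {P Q : V}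
    (hP : (P = f₁ p₁ ∨ P = f₁ q₁) ∨ ∃ y, f₂ y = P) (hQ : (Q = f₁ p₁ ∨ Q = f₁ q₁) ∨ ∃ y, f₂ y = Q)
    {r₁ s₁ : ι → V₁ → Fin 2} (h : Step G₁ p₁ q₁ r₁ s₁) (r : ι → V → Fin 2) (τ : Equiv.Perm ι)
    (hr : ∀ i, res f₁ r i = r₁ (τ i)) :
    ∃ (r' : ι → V → Fin 2) (σ : Equiv.Perm ι), Conn G P Q r r' ∧ (∀ i, res f₁ r' i = s₁ (σ i)) ∧
      res f₂ r' = res f₂ r ∧ ∀ i, r' i (f₁ p₁) = r i (f₁ p₁) ∧ r' i (f₁ q₁) = r i (f₁ q₁) := by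
  obtain ⟨hfib, ⟨ω, hω⟩, hmove⟩ := h
  have lift : ∀ J : Finset ι, (∀ i ∉ J, r₁ i = s₁ i) → ∃ (r' : ι → V → Fin 2) (σ : Equiv.Perm ι),
      SameFiber G r r' ∧ ColEq r r' P Q ∧ (∀ i ∉ J.map τ⁻¹.toEmbedding, r i = r' i) ∧
      (∀ i, i ∈ J.map τ⁻¹.toEmbedding → σ i ∈ J) ∧ (∀ i, res f₁ r' i = s₁ (σ i)) ∧
      res f₂ r' = res f₂ r ∧
      ∀ i, r' i (f₁ p₁) = r i (f₁ p₁) ∧ r' i (f₁ q₁) = r i (f₁ q₁) := by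
    intro J hJ
    -- Constancy on the terminals lets the new first parts be reordered to fit the old second parts
    -- row by row. Since `ρ` is the identity off `J`, the lifted move still changes at most `J.card`
    -- rows.
    obtain ⟨ρ, hρ, hρJ⟩ := exists_perm_fixing_off (fun i => (r₁ i p₁, r₁ i q₁))
      (fun i => (s₁ i p₁, s₁ i q₁)) J ⟨ω, fun i => Prod.ext (hω i).1 (hω i).2⟩
      (fun i hi => by simp only [hJ i hi])
    simp only [Prod.mk.injEq] at hρ
    have hkey : ∀ i, s₁ (ρ (τ i)) p₁ = r i (f₁ p₁) ∧ s₁ (ρ (τ i)) q₁ = r i (f₁ q₁) := fun i =>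
      ⟨(hρ (τ i)).1.symm.trans (congrFun (hr i) p₁).symm,
        (hρ (τ i)).2.symm.trans (congrFun (hr i) q₁).symm⟩
    obtain ⟨r', hr'₁, hr'₂⟩ := exists_join f₁ f₂ (fun i => s₁ (ρ (τ i))) (res f₂ r) (by
      intro i x y hxy
      have : res f₂ r i y = r i (f₁ x) := by rw [hxy]; rfl
      rw [this]
      rcases hg.left x y hxy with rfl | rfl
      · exact (hkey i).1
      · exact (hkey i).2)
    have hkey' : ∀ i, r' i (f₁ p₁) = r i (f₁ p₁) ∧ r' i (f₁ q₁) = r i (f₁ q₁) := by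
      intro i
      have := congrFun hr'₁ i
      exact ⟨(congrFun this p₁).trans (hkey i).1, (congrFun this q₁).trans (hkey i).2⟩
    -- This is the use of `hP` and `hQ`: the columns `P` and `Q` are terminals of the first part or
    -- lie in the second part, so the lift leaves them untouched.
    have hcol : ∀ v, ((v = f₁ p₁ ∨ v = f₁ q₁) ∨ ∃ y, f₂ y = v) → ∀ i, r i v = r' i v := by
      rintro v ((rfl | rfl) | ⟨y, rfl⟩) i
      · exact (hkey' i).1.symm
      · exact (hkey' i).2.symm
      · exact (congrFun (congrFun hr'₂ i) y).symm
    refine ⟨r', ρ * τ, ?_, colEq_of_cols (hcol P hP) (hcol Q hQ), ?_, ?_,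
      fun i => congrFun hr'₁ i, hr'₂, hkey'⟩
    · rw [hg.sameFiber_iff hG, hr'₁, hr'₂]
      refine ⟨?_, SameFiber.refl _ _⟩
      have e1 : res f₁ r = fun i => r₁ (τ i) := funext hr
      rw [e1]
      exact ((sameFiber_perm G₁ r₁ τ).trans hfib).trans (sameFiber_perm G₁ s₁ (ρ * τ)).symm
    · intro i hi
      have hi' : τ i ∉ J := by
        intro hJ
        exact hi (Finset.mem_map.2 ⟨τ i, hJ, by simp⟩)
      refine hg.row_ext ?_ (congrFun hr'₂ i).symm
      rw [hr'₁, hr, hJ _ hi']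
      simp only [hρJ _ hi']
    · intro i hi
      obtain ⟨k, hk, rfl⟩ := Finset.mem_map.1 hi
      have : (ρ * τ) (τ⁻¹.toEmbedding k) = ρ k := by simp
      rw [this]
      by_contra hcon
      have := ρ.injective (hρJ _ hcon)
      rw [this] at hcon
      exact hcon hk
  rcases hmove with ⟨σ, hσ⟩ | ⟨J, hJ, hoff⟩ | ⟨J, hJ, hoff, hne⟩
  · refine ⟨r, σ⁻¹ * τ, Relation.ReflTransGen.refl, fun i => ?_, rfl, fun _ => ⟨rfl, rfl⟩⟩
    rw [hr, hσ]
    simp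
  · obtain ⟨r', σ, h1, h2, h3, -, h5, h6, h7⟩ := lift J hoff
    exact ⟨r', σ, Relation.ReflTransGen.single ⟨h1, h2, Or.inr (Or.inl ⟨_, by simpa using hJ, h3⟩)⟩,
      h5, h6, h7⟩
  · obtain ⟨r', σ, h1, h2, h3, h4, h5, h6, h7⟩ := lift J hoff
    refine ⟨r', σ, Relation.ReflTransGen.single ⟨h1, h2, Or.inr (Or.inr
      ⟨_, by simpa using hJ, h3, fun i hi j hj e => ?_⟩)⟩, h5, h6, h7⟩
    have hi' : τ i ∈ J := by
      obtain ⟨k, hk, rfl⟩ := Finset.mem_map.1 hi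
      simpa using hk
    apply hne (τ i) hi' (σ j) (h4 j hj)
    rw [← hr, ← h5]
    funext x
    exact congrFun e (f₁ x)

/-- Every lift reaches its target only up to a permutation of the first parts. `lift_step` accepts
such a permutation as input, so the lifts can be chained. -/
theorem IsGluing.lift_conn (hg : IsGluing f₁ f₂ p₁ q₁ p₂ q₂) {G : SimpleGraph V}
    {G₁ : SimpleGraph V₁} {G₂ : SimpleGraph V₂} (hG : G = G₁.map f₁ ⊔ G₂.map f₂) {P Q : V}
    (hP : (P = f₁ p₁ ∨ P = f₁ q₁) ∨ ∃ y, f₂ y = P) (hQ : (Q = f₁ p₁ ∨ Q = f₁ q₁) ∨ ∃ y, f₂ y = Q)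
    (r : ι → V → Fin 2) {s₁ : ι → V₁ → Fin 2} (h : Conn G₁ p₁ q₁ (res f₁ r) s₁) :
    ∃ (r' : ι → V → Fin 2) (σ : Equiv.Perm ι), Conn G P Q r r' ∧ (∀ i, res f₁ r' i = s₁ (σ i)) ∧
      res f₂ r' = res f₂ r ∧ ∀ i, r' i (f₁ p₁) = r i (f₁ p₁) ∧ r' i (f₁ q₁) = r i (f₁ q₁) := by
  induction h with
  | refl => exact ⟨r, 1, Relation.ReflTransGen.refl, fun _ => rfl, rfl, fun _ => ⟨rfl, rfl⟩⟩
  | tail _ hstep ih =>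
    obtain ⟨r', σ, h1, h2, h3, h4⟩ := ih
    obtain ⟨r'', σ', h1', h2', h3', h4'⟩ := hg.lift_step hG hP hQ hstep r' σ h2
    exact ⟨r'', σ', h1.trans h1', h2', h3'.trans h3,
      fun i => ⟨(h4' i).1.trans (h4 i).1, (h4' i).2.trans (h4 i).2⟩⟩

/-- Permuting the second parts of the rows, within classes of rows that agree on the distinguished
vertices, is a sequence of two-row moves. -/
theorem IsGluing.conn_of_perm_right (hg : IsGluing f₁ f₂ p₁ q₁ p₂ q₂) {G : SimpleGraph V}
    {G₁ : SimpleGraph V₁} {G₂ : SimpleGraph V₂} (hG : G = G₁.map f₁ ⊔ G₂.map f₂) {P Q : V}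
    (hP : (P = f₂ p₂ ∨ P = f₂ q₂) ∨ ∃ x, f₁ x = P) (hQ : (Q = f₂ p₂ ∨ Q = f₂ q₂) ∨ ∃ x, f₁ x = Q)
    (r s : ι → V → Fin 2) (τ : Equiv.Perm ι) (h₁ : res f₁ r = res f₁ s)
    (h₂ : ∀ i, res f₂ r i = res f₂ s (τ i))
    (hτ : ∀ i, s (τ i) (f₂ p₂) = s i (f₂ p₂) ∧ s (τ i) (f₂ q₂) = s i (f₂ q₂)) :
    Conn G P Q r s := by
  induction hn : τ.support.card using Nat.strong_induction_on generalizing s τ with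
  | _ n ih =>
  by_cases hone : τ = 1
  · subst hone
    have : r = s := funext fun i => hg.row_ext (congrFun h₁ i) (h₂ i)
    rw [this]
    exact Relation.ReflTransGen.refl
  obtain ⟨k, hk⟩ : ∃ k, τ k ≠ k := by
    by_contra hcon
    push Not at hcon
    exact hone (Equiv.ext hcon)
  have hswap : ∀ i, s (Equiv.swap k (τ k) i) (f₂ p₂) = s i (f₂ p₂) ∧
      s (Equiv.swap k (τ k) i) (f₂ q₂) = s i (f₂ q₂) := by
    intro i
    by_cases e1 : i = k
    · subst e1; rw [Equiv.swap_apply_left]; exact hτ i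
    · by_cases e2 : i = τ k
      · rw [e2, Equiv.swap_apply_right]; exact ⟨(hτ k).1.symm, (hτ k).2.symm⟩
      · rw [Equiv.swap_apply_of_ne_of_ne e1 e2]; exact ⟨rfl, rfl⟩
  -- One transposition of second parts is a two-row move, and multiplying `τ` by it shrinks the
  -- support.
  obtain ⟨s', hs'₁, hs'₂⟩ := exists_join f₁ f₂ (res f₁ s) (fun i => res f₂ s (Equiv.swap k (τ k) i)) (by
    intro i x y hxy
    have : res f₁ s i x = s i (f₂ y) := by rw [← hxy]; rfl
    rw [this]
    rcases hg.right x y hxy with rfl | rfl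
    · exact (hswap i).1.symm
    · exact (hswap i).2.symm)
  have hs'key : ∀ i, s' i (f₂ p₂) = s i (f₂ p₂) ∧ s' i (f₂ q₂) = s i (f₂ q₂) := by
    intro i
    have := congrFun hs'₂ i
    exact ⟨(congrFun this p₂).trans (hswap i).1, (congrFun this q₂).trans (hswap i).2⟩
  have hcol : ∀ v, ((v = f₂ p₂ ∨ v = f₂ q₂) ∨ ∃ x, f₁ x = v) → ∀ i, s' i v = s i v := by
    rintro v ((rfl | rfl) | ⟨x, rfl⟩) i
    · exact (hs'key i).1
    · exact (hs'key i).2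
    · exact congrFun (congrFun hs'₁ i) x
  have hstep : Conn G P Q s' s := by
    refine conn_of_eq_off_pair ?_ (colEq_of_cols (hcol P hP) (hcol Q hQ)) hk.symm ?_
    · rw [hg.sameFiber_iff hG, hs'₁, hs'₂]
      exact ⟨SameFiber.refl _ _, sameFiber_perm _ _ _⟩
    · intro i e1 e2
      refine hg.row_ext (congrFun hs'₁ i) ?_
      rw [hs'₂]
      simp only [Equiv.swap_apply_of_ne_of_ne e1 e2]
  refine Relation.ReflTransGen.trans (ih _ ?_ s' (Equiv.swap k (τ k) * τ) (h₁.trans hs'₁.symm)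
    ?_ ?_ rfl) hstep
  · rw [← hn]; exact Equiv.Perm.card_support_swap_mul hk
  · intro i
    rw [hs'₂, h₂]
    simp
  · intro i
    rw [(hs'key _).1, (hs'key _).2, (hs'key _).1, (hs'key _).2, Equiv.Perm.mul_apply,
      (hswap _).1, (hswap _).2]
    exact hτ i

/-- Tables in the same fiber with the same joint margin on all distinguished vertices are
connected. -/
theorem IsGluing.conn_of_key_margin (hg : IsGluing f₁ f₂ p₁ q₁ p₂ q₂) {G : SimpleGraph V}
    {G₁ : SimpleGraph V₁} {G₂ : SimpleGraph V₂} (hG : G = G₁.map f₁ ⊔ G₂.map f₂)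
    (hw₁ : WellConnected ι G₁ p₁ q₁) (hw₂ : WellConnected ι G₂ p₂ q₂) {P Q : V}
    (hP : (P = f₁ p₁ ∨ P = f₁ q₁) ∨ P = f₂ p₂ ∨ P = f₂ q₂)
    (hQ : (Q = f₁ p₁ ∨ Q = f₁ q₁) ∨ Q = f₂ p₂ ∨ Q = f₂ q₂)
    {r s : ι → V → Fin 2} (hrs : SameFiber G r s) (π : Equiv.Perm ι)
    (hp₁ : ∀ i, r i (f₁ p₁) = s (π i) (f₁ p₁)) (hq₁ : ∀ i, r i (f₁ q₁) = s (π i) (f₁ q₁))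
    (hp₂ : ∀ i, r i (f₂ p₂) = s (π i) (f₂ p₂)) (hq₂ : ∀ i, r i (f₂ q₂) = s (π i) (f₂ q₂)) :
    Conn G P Q r s := by
  have left : ∀ v, ((v = f₁ p₁ ∨ v = f₁ q₁) ∨ v = f₂ p₂ ∨ v = f₂ q₂) →
      (v = f₁ p₁ ∨ v = f₁ q₁) ∨ ∃ y, f₂ y = v := by
    rintro v (h | h | h)
    · exact Or.inl h
    · exact Or.inr ⟨_, h.symm⟩
    · exact Or.inr ⟨_, h.symm⟩
  have right : ∀ v, ((v = f₁ p₁ ∨ v = f₁ q₁) ∨ v = f₂ p₂ ∨ v = f₂ q₂) →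
      (v = f₂ p₂ ∨ v = f₂ q₂) ∨ ∃ y, f₁ y = v := by
    rintro v ((h | h) | h)
    · exact Or.inr ⟨_, h.symm⟩
    · exact Or.inr ⟨_, h.symm⟩
    · exact Or.inl h
  have hG' : G = G₂.map f₂ ⊔ G₁.map f₁ := by rw [hG, sup_comm]
  obtain ⟨hrs₁, hrs₂⟩ := (hg.sameFiber_iff hG).1 hrs
  obtain ⟨r', σ, c1, e1, e2, e3⟩ := hg.lift_conn hG (left P hP) (left Q hQ) r
    (hw₁.conn _ _ hrs₁ ⟨π, fun i => ⟨hp₁ i, hq₁ i⟩⟩)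
  obtain ⟨r'', τ, c2, d1, d2, d3⟩ := hg.symm.lift_conn hG' (right P hP) (right Q hQ) r'
    (s₁ := res f₂ s) (by rw [e2]; exact hw₂.conn _ _ hrs₂ ⟨π, fun i => ⟨hp₂ i, hq₂ i⟩⟩)
  -- Both parts now agree with those of `s`, but up to the unrelated permutations `σ` and `τ`. It
  -- remains to bring both to the common permutation `π`.
  refine c1.trans (c2.trans (Relation.ReflTransGen.trans ?_ (conn_perm G P Q s π)))
  have k1 : ∀ i, r'' i (f₁ p₁) = s (π i) (f₁ p₁) := fun i =>
    (congrFun (congrFun d2 i) p₁).trans ((e3 i).1.trans (hp₁ i))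
  have k2 : ∀ i, r'' i (f₁ q₁) = s (π i) (f₁ q₁) := fun i =>
    (congrFun (congrFun d2 i) q₁).trans ((e3 i).2.trans (hq₁ i))
  have k3 : ∀ i, r'' i (f₂ p₂) = s (π i) (f₂ p₂) := fun i =>
    (d3 i).1.trans ((congrFun (congrFun e2 i) p₂).trans (hp₂ i))
  have k4 : ∀ i, r'' i (f₂ q₂) = s (π i) (f₂ q₂) := fun i =>
    (d3 i).2.trans ((congrFun (congrFun e2 i) q₂).trans (hq₂ i))
  have e1' : ∀ i, res f₁ r'' i = res f₁ s (σ i) := fun i => by rw [d2, e1]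
  -- The intermediate table `m` has the first part already in order `π` and the second part still in
  -- the order of `r''`, so that each half of the correction permutes one part only.
  obtain ⟨m, hm₁, hm₂⟩ := exists_join f₁ f₂ (fun i => res f₁ s (π i)) (res f₂ r'') (by
    intro i x y hxy
    have : res f₂ r'' i y = r'' i (f₁ x) := by rw [hxy]; rfl
    rw [this]
    rcases hg.left x y hxy with rfl | rfl
    · exact (k1 i).symm
    · exact (k2 i).symm)
  have m1 : ∀ i v, m i (f₁ v) = s (π i) (f₁ v) := fun i v => congrFun (congrFun hm₁ i) v
  refine Relation.ReflTransGen.trans (b := m) ?_ ?_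
  · refine hg.symm.conn_of_perm_right hG' (left P hP) (left Q hQ) r'' m (π⁻¹ * σ) hm₂.symm ?_ ?_
    · intro i
      rw [hm₁, e1']
      simp
    · intro i
      simp only [m1]
      rw [← k1 i, ← k2 i]
      have := e1' i
      simpa [eq_comm, res] using And.intro (congrFun this p₁) (congrFun this q₁)
  · refine hg.conn_of_perm_right hG (right P hP) (right Q hQ) m _ (π⁻¹ * τ) hm₁ ?_ ?_
    · intro i
      rw [hm₂, d1]
      funext y
      simp [res]
    · intro i
      rw [← k3 i, ← k4 i]
      have := d1 i
      simpa [eq_comm, res] using And.intro (congrFun this p₂) (congrFun this q₂)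

/-- Exchanging entries of two rows in some of the distinguished columns is realized by a two-row
move, after a change of the table outside these columns. -/
theorem IsGluing.realize (hg : IsGluing f₁ f₂ p₁ q₁ p₂ q₂) {G : SimpleGraph V}
    {G₁ : SimpleGraph V₁} {G₂ : SimpleGraph V₂} (hG : G = G₁.map f₁ ⊔ G₂.map f₂)
    (hw₁ : WellConnected ι G₁ p₁ q₁) (hw₂ : WellConnected ι G₂ p₂ q₂)
    {r s : ι → V → Fin 2} (hrs : SameFiber G r s) {i j : ι} (hij : i ≠ j) (K : Set V)
    (hl₁ : level (swapCols K r i j) (f₁ p₁) (f₁ q₁) ∈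
      Set.uIcc (level r (f₁ p₁) (f₁ q₁)) (level s (f₁ p₁) (f₁ q₁)))
    (hl₂ : level (swapCols K r i j) (f₂ p₂) (f₂ q₂) ∈
      Set.uIcc (level r (f₂ p₂) (f₂ q₂)) (level s (f₂ p₂) (f₂ q₂))) :
    ∃ r' s' : ι → V → Fin 2, SameFiber G r r' ∧ SameFiber G r s' ∧
      (∀ k v, ((v = f₁ p₁ ∨ v = f₁ q₁) ∨ v = f₂ p₂ ∨ v = f₂ q₂) →
        r' k v = r k v ∧ s' k v = swapCols K r i j k v) ∧
      ∀ k, k ≠ i → k ≠ j → r' k = s' k := by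
  obtain ⟨hrs₁, hrs₂⟩ := (hg.sameFiber_iff hG).1 hrs
  obtain ⟨a, a', a1, a2, a3, a4, a5⟩ := hw₁.realize hrs₁ hij (f₁ ⁻¹' K) hl₁
  obtain ⟨c, c', c1, c2, c3, c4, c5⟩ := hw₂.realize hrs₂ hij (f₂ ⁻¹' K) hl₂
  have join : ∀ (u₁ : ι → V₁ → Fin 2) (u₂ : ι → V₂ → Fin 2) (w : ι → V → Fin 2),
      (∀ k, u₁ k p₁ = w k (f₁ p₁) ∧ u₁ k q₁ = w k (f₁ q₁)) →
      (∀ k, u₂ k p₂ = w k (f₂ p₂) ∧ u₂ k q₂ = w k (f₂ q₂)) →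
      ∃ u : ι → V → Fin 2, res f₁ u = u₁ ∧ res f₂ u = u₂ ∧
        ∀ k v, ((v = f₁ p₁ ∨ v = f₁ q₁) ∨ v = f₂ p₂ ∨ v = f₂ q₂) → u k v = w k v := by
    intro u₁ u₂ w h₁ h₂
    obtain ⟨u, hu₁, hu₂⟩ := exists_join f₁ f₂ u₁ u₂ (by
      intro k x y hxy
      have e1 : u₁ k x = w k (f₁ x) := by
        rcases hg.left x y hxy with rfl | rfl
        · exact (h₁ k).1
        · exact (h₁ k).2
      have e2 : u₂ k y = w k (f₂ y) := by
        rcases hg.right x y hxy with rfl | rfl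
        · exact (h₂ k).1
        · exact (h₂ k).2
      rw [e1, e2, hxy])
    refine ⟨u, hu₁, hu₂, ?_⟩
    have e1 := fun k x => congrFun (congrFun hu₁ k) x
    have e2 := fun k x => congrFun (congrFun hu₂ k) x
    rintro k v ((rfl | rfl) | rfl | rfl)
    · exact (e1 k _).trans (h₁ k).1
    · exact (e1 k _).trans (h₁ k).2
    · exact (e2 k _).trans (h₂ k).1
    · exact (e2 k _).trans (h₂ k).2
  obtain ⟨r', h1, h2, h3⟩ := join a c r a3 c3
  obtain ⟨s', h4, h5, h6⟩ := join a' c' (swapCols K r i j) a4 c4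
  refine ⟨r', s', ?_, ?_, fun k v hv => ⟨h3 k v hv, h6 k v hv⟩, fun k e1 e2 => ?_⟩
  · rw [hg.sameFiber_iff hG, h1, h2]; exact ⟨a1, c1⟩
  · rw [hg.sameFiber_iff hG, h4, h5]; exact ⟨a2, c2⟩
  · refine hg.row_ext ?_ ?_
    · rw [h1, h4]; exact a5 k e1 e2
    · rw [h2, h5]; exact c5 k e1 e2

end Gluing

end BinaryTable

namespace BinaryTable

set_option linter.unusedSectionVars false

variable {ι : Type*} [Fintype ι] [DecidableEq ι] {V V₁ V₂ : Type*}

/-- Only rows `i` and `j` matter, and passing from parallel to crossed products costs the product of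
the two differences. -/
theorem level_swapCols_left {K : Set V} (r : ι → V → Fin 2) {i j : ι} (hij : i ≠ j) {x y : V}
    (hx : x ∈ K) (hy : y ∉ K) :
    level (swapCols K r i j) x y =
      level r x y - (bit (r i x) - bit (r j x)) * (bit (r i y) - bit (r j y)) := by
  have := sum_eq_off_pair hij (r := r) (s := swapCols K r i j)
    (fun k h1 h2 => (swapCols_off K r h1 h2).symm) (fun v => bit (v x) * bit (v y))
  simp only [swapCols_of_mem r i j _ hx, swapCols_of_notMem r i j _ hy, Equiv.swap_apply_left,
    Equiv.swap_apply_right] at this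
  simp only [level, swapCols_of_mem r i j _ hx, swapCols_of_notMem r i j _ hy]
  linarith

theorem level_swapCols_right {K : Set V} (r : ι → V → Fin 2) {i j : ι} (hij : i ≠ j) {x y : V}
    (hx : x ∉ K) (hy : y ∈ K) :
    level (swapCols K r i j) x y =
      level r x y - (bit (r i x) - bit (r j x)) * (bit (r i y) - bit (r j y)) := by
  rw [level_comm, level_swapCols_left r hij hy hx, level_comm r y x, mul_comm]

theorem level_swapCols_of_notMem {K : Set V} (r : ι → V → Fin 2) {i j : ι} {x y : V}
    (hx : x ∉ K) (hy : y ∉ K) : level (swapCols K r i j) x y = level r x y := by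
  simp only [level, swapCols_of_notMem r i j _ hx, swapCols_of_notMem r i j _ hy]

theorem level_congr {r s : ι → V → Fin 2} {x y : V} (hx : ∀ i, r i x = s i x)
    (hy : ∀ i, r i y = s i y) : level r x y = level s x y := by
  simp only [level, hx, hy]

theorem level_le_colSum (r : ι → V → Fin 2) (x y : V) : level r x y ≤ colSum r x :=
  Finset.sum_le_sum fun _ _ =>
    mul_le_of_le_one_right (bit_nonneg _) (bit_le_one _)

/-- If the level is not maximal, there are rows with the values `(1, 0)` and `(0, 1)`. -/
theorem exists_rows_of_level_lt {r s : ι → V → Fin 2} {x y : V} (hx : colSum r x = colSum s x)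
    (hy : colSum r y = colSum s y) (h : level r x y < level s x y) :
    ∃ i j, i ≠ j ∧ r i x = 1 ∧ r i y = 0 ∧ r j x = 0 ∧ r j y = 1 := by
  have key : ∀ x y, colSum r x = colSum s x → level r x y < level s x y →
      ∃ i, r i x = 1 ∧ r i y = 0 := by
    intro x y hx h
    have h1 := level_le_colSum s x y
    have h2 := cellCount_eq (fun i => r i x) (fun i => r i y) (fun _ => 0) 1 0 0
    simp only [colSum, level] at hx h h1
    have h3 : 0 < cellCount (fun i => r i x) (fun i => r i y) (fun _ => 0) 1 0 0 := by
      rw [h2]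
      simp only [bit, Fin.val_one, Fin.val_zero] at *
      simp only [Nat.cast_one, Nat.cast_zero, mul_zero, sub_zero, Finset.sum_const_zero]
      linarith
    obtain ⟨i, h4, h5, -⟩ := exists_row_of_cellCount_pos h3
    exact ⟨i, h4, h5⟩
  obtain ⟨i, h1, h2⟩ := key x y hx h
  obtain ⟨j, h3, h4⟩ := key y x hy (by rwa [level_comm, level_comm s])
  refine ⟨i, j, ?_, h1, h2, h4, h3⟩
  rintro rfl
  rw [h1] at h4
  exact absurd h4 (by decide)

/-! ### Base case and parallel construction -/

/-- No column lies outside {t, b}, so equal margins mean equal tables up to row order. The edge may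
be missing from `G`; this is the only place where the induction meets a proper subgraph directly. -/
theorem wellConnected_of_two_vertices (G : SimpleGraph V) {t b : V} (htb : t ≠ b)
    (hV : ∀ v, v = t ∨ v = b) : WellConnected ι G t b where
  conn r s _ h := by
    obtain ⟨σ, hσ⟩ := h
    have : r = fun i => s (σ i) := by
      funext i v
      rcases hV v with rfl | rfl
      · exact (hσ i).1
      · exact (hσ i).2
    rw [this]
    exact conn_perm G t b s σ
  up r s hrs hl := by
    obtain ⟨i, j, hij, h1, h2, h3, h4⟩ :=
      exists_rows_of_level_lt (hrs.colSum_eq t) (hrs.colSum_eq b) hl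
    -- An edge between the two vertices would fix the level, which is assumed to vary.
    have hnadj : ∀ x y, ¬ G.Adj x y := by
      intro x y hxy
      have htb' : G.Adj t b := by
        rcases hV x with rfl | rfl <;> rcases hV y with rfl | rfl
        · exact absurd hxy (G.irrefl)
        · exact hxy
        · exact hxy.symm
        · exact absurd hxy (G.irrefl)
      exact hl.ne (hrs t b (Or.inr htb')).level_eq
    refine ⟨r, swapCols {t} r i j, SameFiber.refl G r, ?_, rfl, ?_, i, j, hij,
      fun k h5 h6 => (swapCols_off {t} r h5 h6).symm⟩
    · rintro x y (rfl | hxy)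
      · exact colEq_self_iff.2 (colSum_swapCols _ _ _ _ _).symm
      · exact absurd hxy (hnadj x y)
    · rw [level_swapCols_left r hij (Set.mem_singleton t) (by simpa using htb.symm), h1, h2, h3, h4]
      simp [bit]

/-- Both parts see the same pair of terminals, so one pair margin is the whole terminal margin, and
the level condition of `IsGluing.realize` is the same for both parts. -/
theorem wellConnected_parallel {f₁ : V₁ ↪ V} {f₂ : V₂ ↪ V} {t₁ b₁ : V₁} {t₂ b₂ : V₂}
    (hg : IsGluing f₁ f₂ t₁ b₁ t₂ b₂) (ht : f₁ t₁ = f₂ t₂) (hb : f₁ b₁ = f₂ b₂)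
    {G₁ : SimpleGraph V₁} {G₂ : SimpleGraph V₂} (htb : t₁ ≠ b₁)
    (hw₁ : WellConnected ι G₁ t₁ b₁) (hw₂ : WellConnected ι G₂ t₂ b₂) :
    WellConnected ι (G₁.map f₁ ⊔ G₂.map f₂) (f₁ t₁) (f₁ b₁) where
  conn r s hrs h := by
    obtain ⟨σ, hσ⟩ := h
    exact hg.conn_of_key_margin rfl hw₁ hw₂ (by simp) (by simp) hrs σ (fun i => (hσ i).1)
      (fun i => (hσ i).2) (fun i => ht ▸ (hσ i).1) (fun i => hb ▸ (hσ i).2)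
  up r s hrs hl := by
    obtain ⟨i, j, hij, h1, h2, h3, h4⟩ :=
      exists_rows_of_level_lt (hrs.colSum_eq _) (hrs.colSum_eq _) hl
    have hlev : level (swapCols {f₁ t₁} r i j) (f₁ t₁) (f₁ b₁) = level r (f₁ t₁) (f₁ b₁) + 1 := by
      rw [level_swapCols_left r hij (Set.mem_singleton _) (by simpa using htb.symm), h1, h2, h3, h4]
      simp [bit]
    have hmem : level (swapCols {f₁ t₁} r i j) (f₁ t₁) (f₁ b₁) ∈
        Set.uIcc (level r (f₁ t₁) (f₁ b₁)) (level s (f₁ t₁) (f₁ b₁)) := by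
      rw [Set.mem_uIcc]; left; constructor <;> omega
    obtain ⟨r', s', e1, e2, e3, e4⟩ := hg.realize rfl hw₁ hw₂ hrs hij {f₁ t₁} hmem
      (by rw [← ht, ← hb]; exact hmem)
    refine ⟨r', s', e1, e2, ?_, ?_, i, j, hij, e4⟩
    · exact level_congr (fun k => (e3 k _ (by simp)).1) (fun k => (e3 k _ (by simp)).1)
    · rw [← hlev]
      exact level_congr (fun k => (e3 k _ (by simp)).2) (fun k => (e3 k _ (by simp)).2)

/-! ### Series construction -/

/-- The number of rows with ones in three columns. -/
def level₃ (r : ι → V → Fin 2) (x y z : V) : ℤ := ∑ i, bit (r i x) * bit (r i y) * bit (r i z)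

section Cells

variable (r : ι → V → Fin 2) (x y z : V)

theorem cellCount_table (a₁ a₂ a₃ : Fin 2) :
    cellCount (fun i => r i x) (fun i => r i y) (fun i => r i z) a₁ a₂ a₃ =
    (Fintype.card ι) * ((1 - bit a₁) * (1 - bit a₂) * (1 - bit a₃))
    + (2 * bit a₁ - 1) * (1 - bit a₂) * (1 - bit a₃) * colSum r x
    + (1 - bit a₁) * (2 * bit a₂ - 1) * (1 - bit a₃) * colSum r y
    + (1 - bit a₁) * (1 - bit a₂) * (2 * bit a₃ - 1) * colSum r z
    + (2 * bit a₁ - 1) * (2 * bit a₂ - 1) * (1 - bit a₃) * level r x y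
    + (1 - bit a₁) * (2 * bit a₂ - 1) * (2 * bit a₃ - 1) * level r y z
    + (2 * bit a₁ - 1) * (1 - bit a₂) * (2 * bit a₃ - 1) * level r x z
    + (2 * bit a₁ - 1) * (2 * bit a₂ - 1) * (2 * bit a₃ - 1) * level₃ r x y z :=
  cellCount_eq _ _ _ _ _ _

end Cells

theorem exists_row_of_cell_lt {r s : ι → V → Fin 2} {x y z : V} (a₁ a₂ a₃ : Fin 2)
    (h : cellCount (fun i => s i x) (fun i => s i y) (fun i => s i z) a₁ a₂ a₃ <
      cellCount (fun i => r i x) (fun i => r i y) (fun i => r i z) a₁ a₂ a₃) :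
    ∃ i, r i x = a₁ ∧ r i y = a₂ ∧ r i z = a₃ :=
  exists_row_of_cellCount_pos ((cellCount_nonneg _ _ _ _ _ _).trans_lt h)

theorem sum_eq_off_finset (J : Finset ι) {r s : ι → V → Fin 2} (h : ∀ k ∉ J, r k = s k)
    (φ : (V → Fin 2) → ℤ) :
    ∑ k, φ (s k) = ∑ k, φ (r k) + ∑ k ∈ J, (φ (s k) - φ (r k)) := by
  rw [← Finset.sum_add_sum_compl J (fun k => φ (s k)), ← Finset.sum_add_sum_compl J (fun k => φ (r k)),
    Finset.sum_sub_distrib]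
  have : ∑ k ∈ Jᶜ, φ (s k) = ∑ k ∈ Jᶜ, φ (r k) :=
    Finset.sum_congr rfl fun k hk => by rw [h k (by simpa using hk)]
  rw [this]; ring

section Series

variable {f₁ : V₁ ↪ V} {f₂ : V₂ ↪ V} {b₁ t₁ : V₁} {b₂ t₂ : V₂}
  {G₁ : SimpleGraph V₁} {G₂ : SimpleGraph V₂}

/-- `IsGluing.realize` first alters `r` away from the terminals. That preparation is free by
`conn_of_key_margin`, and what follows is a single two-row move that keeps the level of the outer
terminals. -/
theorem series_conn_swap (hg : IsGluing f₁ f₂ b₁ t₁ b₂ t₂)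
    (hw₁ : WellConnected ι G₁ b₁ t₁) (hw₂ : WellConnected ι G₂ b₂ t₂)
    {r s : ι → V → Fin 2} (hrs : SameFiber (G₁.map f₁ ⊔ G₂.map f₂) r s) {i j : ι} (hij : i ≠ j)
    (K : Set V)
    (hl₁ : level (swapCols K r i j) (f₁ b₁) (f₁ t₁) ∈
      Set.uIcc (level r (f₁ b₁) (f₁ t₁)) (level s (f₁ b₁) (f₁ t₁)))
    (hl₂ : level (swapCols K r i j) (f₂ b₂) (f₂ t₂) ∈
      Set.uIcc (level r (f₂ b₂) (f₂ t₂)) (level s (f₂ b₂) (f₂ t₂)))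
    (hl : level (swapCols K r i j) (f₁ b₁) (f₂ t₂) = level r (f₁ b₁) (f₂ t₂)) :
    ∃ s', Conn (G₁.map f₁ ⊔ G₂.map f₂) (f₁ b₁) (f₂ t₂) r s' ∧
      level s' (f₁ b₁) (f₁ t₁) = level (swapCols K r i j) (f₁ b₁) (f₁ t₁) ∧
      level s' (f₂ b₂) (f₂ t₂) = level (swapCols K r i j) (f₂ b₂) (f₂ t₂) := by
  obtain ⟨r', s', e1, e2, e3, e4⟩ := hg.realize rfl hw₁ hw₂ hrs hij K hl₁ hl₂
  have hconn : Conn (G₁.map f₁ ⊔ G₂.map f₂) (f₁ b₁) (f₂ t₂) r r' :=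
    hg.conn_of_key_margin rfl hw₁ hw₂ (by simp) (by simp) e1 1
      (fun k => (e3 k _ (by simp)).1.symm) (fun k => (e3 k _ (by simp)).1.symm)
      (fun k => (e3 k _ (by simp)).1.symm) (fun k => (e3 k _ (by simp)).1.symm)
  refine ⟨s', hconn.trans (conn_of_eq_off_pair (e1.symm.trans e2) ?_ hij e4), ?_, ?_⟩
  · refine (e1.symm.trans e2).colEq_of_level ?_
    rw [level_congr (fun k => (e3 k _ (by simp)).1) (fun k => (e3 k _ (by simp)).1),
      level_congr (fun k => (e3 k _ (by simp)).2) (fun k => (e3 k _ (by simp)).2), hl]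
  · exact level_congr (fun k => (e3 k _ (by simp)).2) (fun k => (e3 k _ (by simp)).2)
  · exact level_congr (fun k => (e3 k _ (by simp)).2) (fun k => (e3 k _ (by simp)).2)

/-- The four-row move that exchanges the even and the odd cells of the three distinguished
columns. -/
theorem series_conn_parity (hg : IsGluing f₁ f₂ b₁ t₁ b₂ t₂) (hx : f₁ t₁ = f₂ b₂)
    (hshare : ∀ x y, f₁ x = f₂ y → x = t₁ ∧ y = b₂)
    {r : ι → V → Fin 2} {i₁ i₂ i₃ i₄ : ι}
    (h₁ : r i₁ (f₁ b₁) = 0 ∧ r i₁ (f₁ t₁) = 0 ∧ r i₁ (f₂ t₂) = 0)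
    (h₂ : r i₂ (f₁ b₁) = 0 ∧ r i₂ (f₁ t₁) = 1 ∧ r i₂ (f₂ t₂) = 1)
    (h₃ : r i₃ (f₁ b₁) = 1 ∧ r i₃ (f₁ t₁) = 0 ∧ r i₃ (f₂ t₂) = 1)
    (h₄ : r i₄ (f₁ b₁) = 1 ∧ r i₄ (f₁ t₁) = 1 ∧ r i₄ (f₂ t₂) = 0) :
    ∃ s, Conn (G₁.map f₁ ⊔ G₂.map f₂) (f₁ b₁) (f₂ t₂) r s ∧
      level s (f₁ b₁) (f₁ t₁) = level r (f₁ b₁) (f₁ t₁) ∧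
      level s (f₂ b₂) (f₂ t₂) = level r (f₂ b₂) (f₂ t₂) ∧
      level₃ s (f₁ b₁) (f₁ t₁) (f₂ t₂) = level₃ r (f₁ b₁) (f₁ t₁) (f₂ t₂) + 1 := by
  have hne : ∀ {i j : ι} {v : V}, r i v = 0 → r j v = 1 → i ≠ j := by
    rintro i j v h h' rfl
    rw [h] at h'; exact absurd h' (by decide)
  have n12 : i₁ ≠ i₂ := hne h₁.2.1 h₂.2.1
  have n13 : i₁ ≠ i₃ := hne h₁.1 h₃.1
  have n14 : i₁ ≠ i₄ := hne h₁.1 h₄.1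
  have n23 : i₂ ≠ i₃ := hne h₂.1 h₃.1
  have n24 : i₂ ≠ i₄ := hne h₂.1 h₄.1
  have n34 : i₃ ≠ i₄ := hne h₃.2.1 h₄.2.1
  -- Second parts are exchanged between 000 and 101 and between 011 and 110. Each pair agrees in the
  -- middle column, so the parts still fit, and the results 001, 100, 010, 111 are the odd cells.
  set ρ : Equiv.Perm ι := Equiv.swap i₁ i₃ * Equiv.swap i₂ i₄ with hρ
  have ρ1 : ρ i₁ = i₃ := by
    rw [hρ, Equiv.Perm.mul_apply, Equiv.swap_apply_of_ne_of_ne n12 n14, Equiv.swap_apply_left]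
  have ρ2 : ρ i₂ = i₄ := by
    rw [hρ, Equiv.Perm.mul_apply, Equiv.swap_apply_left,
      Equiv.swap_apply_of_ne_of_ne n14.symm n34.symm]
  have ρ3 : ρ i₃ = i₁ := by
    rw [hρ, Equiv.Perm.mul_apply, Equiv.swap_apply_of_ne_of_ne n23.symm n34,
      Equiv.swap_apply_right]
  have ρ4 : ρ i₄ = i₂ := by
    rw [hρ, Equiv.Perm.mul_apply, Equiv.swap_apply_right, Equiv.swap_apply_of_ne_of_ne n12.symm n23]
  have ρoff : ∀ k, k ≠ i₁ → k ≠ i₂ → k ≠ i₃ → k ≠ i₄ → ρ k = k := by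
    intro k k1 k2 k3 k4
    rw [hρ, Equiv.Perm.mul_apply, Equiv.swap_apply_of_ne_of_ne k2 k4,
      Equiv.swap_apply_of_ne_of_ne k1 k3]
  have ρx : ∀ k, r (ρ k) (f₁ t₁) = r k (f₁ t₁) := by
    intro k
    by_cases k1 : k = i₁
    · rw [k1, ρ1, h₁.2.1, h₃.2.1]
    by_cases k2 : k = i₂
    · rw [k2, ρ2, h₂.2.1, h₄.2.1]
    by_cases k3 : k = i₃
    · rw [k3, ρ3, h₁.2.1, h₃.2.1]
    by_cases k4 : k = i₄
    · rw [k4, ρ4, h₂.2.1, h₄.2.1]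
    rw [ρoff k k1 k2 k3 k4]
  obtain ⟨s, hs₁, hs₂⟩ := exists_join f₁ f₂ (res f₁ r) (fun k => res f₂ r (ρ k)) (by
    intro k x y hxy
    obtain ⟨rfl, rfl⟩ := hshare x y hxy
    simp only [res]
    rw [← hx, ρx])
  have sb : ∀ k, s k (f₁ b₁) = r k (f₁ b₁) := fun k => congrFun (congrFun hs₁ k) b₁
  have sx : ∀ k, s k (f₁ t₁) = r k (f₁ t₁) := fun k => congrFun (congrFun hs₁ k) t₁
  have st : ∀ k, s k (f₂ t₂) = r (ρ k) (f₂ t₂) := fun k => congrFun (congrFun hs₂ k) t₂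
  have sx' : ∀ k, s k (f₂ b₂) = r (ρ k) (f₂ b₂) := fun k => congrFun (congrFun hs₂ k) b₂
  have hfib : SameFiber (G₁.map f₁ ⊔ G₂.map f₂) r s := by
    rw [hg.sameFiber_iff rfl, hs₁, hs₂]
    exact ⟨SameFiber.refl _ _, (sameFiber_perm _ _ _).symm⟩
  set J : Finset ι := {i₁, i₂, i₃, i₄} with hJ
  have hoff : ∀ k ∉ J, r k = s k := by
    intro k hk
    simp only [hJ, Finset.mem_insert, Finset.mem_singleton, not_or] at hk
    refine hg.row_ext (congrFun hs₁ k).symm ?_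
    rw [hs₂]
    simp only [ρoff k hk.1 hk.2.1 hk.2.2.1 hk.2.2.2]
  have hsum : ∀ φ : (V → Fin 2) → ℤ, ∑ k, φ (s k) = ∑ k, φ (r k) +
      ((φ (s i₁) - φ (r i₁)) + ((φ (s i₂) - φ (r i₂)) + ((φ (s i₃) - φ (r i₃)) +
        (φ (s i₄) - φ (r i₄))))) := by
    intro φ
    rw [sum_eq_off_finset J hoff φ, hJ, Finset.sum_insert (by simp [n12, n13, n14]),
      Finset.sum_insert (by simp [n23, n24]), Finset.sum_insert (by simp [n34]),
      Finset.sum_singleton]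
  have hlev : level s (f₁ b₁) (f₂ t₂) = level r (f₁ b₁) (f₂ t₂) := by
    have := hsum (fun v => bit (v (f₁ b₁)) * bit (v (f₂ t₂)))
    simp only [sb, st, ρ1, ρ2, ρ3, ρ4, h₁, h₂, h₃, h₄] at this
    simp only [level, sb, st]
    rw [this]; simp [bit]
  -- Even cells differ from odd cells already on the terminals; hence nothing cancels and the move
  -- has degree exactly four.
  have hpar : ∀ k ∈ J, ∀ l ∈ J, r k ≠ s l := by
    intro k hk l hl e
    have e1 := congrFun e (f₁ b₁)
    have e2 := congrFun e (f₁ t₁)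
    have e3 := congrFun e (f₂ t₂)
    rw [sb] at e1; rw [sx] at e2; rw [st] at e3
    simp only [hJ, Finset.mem_insert, Finset.mem_singleton] at hk hl
    rcases hk with rfl | rfl | rfl | rfl <;> rcases hl with rfl | rfl | rfl | rfl <;>
      simp [ρ1, ρ2, ρ3, ρ4, h₁, h₂, h₃, h₄] at e1 e2 e3
  refine ⟨s, Relation.ReflTransGen.single ⟨hfib, hfib.colEq_of_level hlev.symm, Or.inr (Or.inr
    ⟨J, ?_, hoff, hpar⟩)⟩, level_congr sb sx, ?_, ?_⟩
  · rw [hJ, Finset.card_insert_of_notMem (by simp [n12, n13, n14]),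
      Finset.card_insert_of_notMem (by simp [n23, n24]), Finset.card_pair n34]
  · simp only [level, st, sx']
    exact sum_comp_perm (fun k => bit (r k (f₂ b₂)) * bit (r k (f₂ t₂))) ρ
  · have := hsum (fun v => bit (v (f₁ b₁)) * bit (v (f₁ t₁)) * bit (v (f₂ t₂)))
    simp only [sb, sx, st, ρ1, ρ2, ρ3, ρ4, h₁, h₂, h₃, h₄] at this
    simp only [level₃, sb, sx, st]
    rw [this]; simp [bit]

end Series

end BinaryTable

namespace BinaryTable

set_option linter.unusedSectionVars false

variable {ι : Type*} [Fintype ι] [DecidableEq ι] {V V₁ V₂ : Type*}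

/-- A cell of three columns that is more frequent in `r` than in `s` occurs as a row of `r`. -/
theorem exists_rows_of_cells {r s : ι → V → Fin 2} {x y z : V} (hx : colSum r x = colSum s x)
    (hy : colSum r y = colSum s y) (hz : colSum r z = colSum s z) {a c q w : ℤ}
    (ha : level s x y = level r x y + a) (hc : level s y z = level r y z + c)
    (hq : level s x z = level r x z + q) (hw : level₃ s x y z = level₃ r x y z + w) :
    (w < 0 → ∃ i, r i x = 1 ∧ r i y = 1 ∧ r i z = 1) ∧
    (a < w → ∃ i, r i x = 1 ∧ r i y = 1 ∧ r i z = 0) ∧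
    (c < w → ∃ i, r i x = 0 ∧ r i y = 1 ∧ r i z = 1) ∧
    (q < w → ∃ i, r i x = 1 ∧ r i y = 0 ∧ r i z = 1) ∧
    (w < a + q → ∃ i, r i x = 1 ∧ r i y = 0 ∧ r i z = 0) ∧
    (w < a + c → ∃ i, r i x = 0 ∧ r i y = 1 ∧ r i z = 0) ∧
    (w < c + q → ∃ i, r i x = 0 ∧ r i y = 0 ∧ r i z = 1) ∧
    (a + c + q < w → ∃ i, r i x = 0 ∧ r i y = 0 ∧ r i z = 0) := by
  have h0 : bit 0 = 0 := rfl
  have h1 : bit 1 = 1 := rfl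
  refine ⟨?_, ?_, ?_, ?_, ?_, ?_, ?_, ?_⟩ <;> intro h <;>
    refine exists_row_of_cell_lt (s := s) _ _ _ ?_ <;>
    rw [cellCount_table, cellCount_table, ← hx, ← hy, ← hz, ha, hc, hq, hw] <;>
    simp only [h0, h1] <;> linarith

section Series

variable {f₁ : V₁ ↪ V} {f₂ : V₂ ↪ V} {b₁ t₁ : V₁} {b₂ t₂ : V₂}
  {G₁ : SimpleGraph V₁} {G₂ : SimpleGraph V₂}

/-- With the three pair margins equal, the three-column margins differ by `n` times the even-odd
move. For positive `n` every even cell is more frequent in `r`, so the quartic applies and lowers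
`n` by one. -/
theorem series_conn_of_levels_eq (hg : IsGluing f₁ f₂ b₁ t₁ b₂ t₂) (hx : f₁ t₁ = f₂ b₂)
    (hshare : ∀ x y, f₁ x = f₂ y → x = t₁ ∧ y = b₂)
    (hw₁ : WellConnected ι G₁ b₁ t₁) (hw₂ : WellConnected ι G₂ b₂ t₂) (n : ℕ) :
    ∀ r s : ι → V → Fin 2, SameFiber (G₁.map f₁ ⊔ G₂.map f₂) r s →
      level s (f₁ b₁) (f₁ t₁) = level r (f₁ b₁) (f₁ t₁) →
      level s (f₁ t₁) (f₂ t₂) = level r (f₁ t₁) (f₂ t₂) →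
      level s (f₁ b₁) (f₂ t₂) = level r (f₁ b₁) (f₂ t₂) →
      level₃ s (f₁ b₁) (f₁ t₁) (f₂ t₂) = level₃ r (f₁ b₁) (f₁ t₁) (f₂ t₂) + n →
      Conn (G₁.map f₁ ⊔ G₂.map f₂) (f₁ b₁) (f₂ t₂) r s := by
  induction n with
  | zero =>
    intro r s hrs h1 h2 h3 h4
    obtain ⟨σ, hσ⟩ := exists_perm_of_three_columns (fun i => r i (f₁ b₁)) (fun i => r i (f₁ t₁))
      (fun i => r i (f₂ t₂)) (fun i => s i (f₁ b₁)) (fun i => s i (f₁ t₁)) (fun i => s i (f₂ t₂))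
      (hrs.colSum_eq _) (hrs.colSum_eq _) (hrs.colSum_eq _) h1.symm h2.symm h3.symm
      (by simpa [level₃] using h4.symm)
    exact hg.conn_of_key_margin rfl hw₁ hw₂ (by simp) (by simp) hrs σ (fun i => (hσ i).1)
      (fun i => (hσ i).2.1) (fun i => hx ▸ (hσ i).2.1) (fun i => (hσ i).2.2)
  | succ n ih =>
    intro r s hrs h1 h2 h3 h4
    obtain ⟨-, c110, c011, c101, -, -, -, c000⟩ := exists_rows_of_cells (hrs.colSum_eq (f₁ b₁))
      (hrs.colSum_eq (f₁ t₁)) (hrs.colSum_eq (f₂ t₂)) (a := 0) (c := 0) (q := 0) (by simpa using h1)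
      (by simpa using h2) (by simpa using h3) h4
    obtain ⟨i₁, e1⟩ := c000 (by positivity)
    obtain ⟨i₂, e2⟩ := c011 (by positivity)
    obtain ⟨i₃, e3⟩ := c101 (by positivity)
    obtain ⟨i₄, e4⟩ := c110 (by positivity)
    obtain ⟨r', g1, g2, g3, g4⟩ := series_conn_parity (G₁ := G₁) (G₂ := G₂) hg hx hshare e1 e2 e3 e4
    rw [← hx] at g3
    refine g1.trans (ih r' s (g1.sameFiber.symm.trans hrs) (by omega) (by omega) ?_ ?_)
    · rw [← g1.colEq.level_eq, h3]
    · push_cast at h4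
      omega

/-- Induction on |a| + |c|. A cell more frequent in `r` than in `s` is guaranteed to occur in `r`,
and the surplus of each cell is linear in `a`, `c` and `w`. In every sign pattern two surplus rows
allow an exchange that moves `a` or `c` towards zero without overshooting either, while the outer
level is unchanged. -/
theorem series_conn (hg : IsGluing f₁ f₂ b₁ t₁ b₂ t₂) (hx : f₁ t₁ = f₂ b₂)
    (hshare : ∀ x y, f₁ x = f₂ y → x = t₁ ∧ y = b₂) (hb : b₁ ≠ t₁) (ht : t₂ ≠ b₂)
    (hw₁ : WellConnected ι G₁ b₁ t₁) (hw₂ : WellConnected ι G₂ b₂ t₂) (n : ℕ) :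
    ∀ r s : ι → V → Fin 2, SameFiber (G₁.map f₁ ⊔ G₂.map f₂) r s →
      level s (f₁ b₁) (f₂ t₂) = level r (f₁ b₁) (f₂ t₂) →
      (level s (f₁ b₁) (f₁ t₁) - level r (f₁ b₁) (f₁ t₁)).natAbs +
        (level s (f₁ t₁) (f₂ t₂) - level r (f₁ t₁) (f₂ t₂)).natAbs = n →
      Conn (G₁.map f₁ ⊔ G₂.map f₂) (f₁ b₁) (f₂ t₂) r s := by
  have nbx : f₁ b₁ ≠ f₁ t₁ := f₁.injective.ne hb
  have nxt : f₁ t₁ ≠ f₂ t₂ := by rw [hx]; exact f₂.injective.ne ht.symm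
  have nbt : f₁ b₁ ≠ f₂ t₂ := fun h => hb (hshare _ _ h).1
  induction n using Nat.strong_induction_on with
  | _ n ih =>
  intro r s hrs hq hn
  obtain ⟨a, ha⟩ : ∃ a, level s (f₁ b₁) (f₁ t₁) = level r (f₁ b₁) (f₁ t₁) + a := ⟨_, (add_sub_cancel _ _).symm⟩
  obtain ⟨c, hc⟩ : ∃ c, level s (f₁ t₁) (f₂ t₂) = level r (f₁ t₁) (f₂ t₂) + c := ⟨_, (add_sub_cancel _ _).symm⟩
  obtain ⟨w, hw⟩ : ∃ w, level₃ s (f₁ b₁) (f₁ t₁) (f₂ t₂) = level₃ r (f₁ b₁) (f₁ t₁) (f₂ t₂) + w :=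
    ⟨_, (add_sub_cancel _ _).symm⟩
  by_cases hac : a = 0 ∧ c = 0
  · obtain ⟨rfl, rfl⟩ := hac
    rw [add_zero] at ha hc
    rcases le_total 0 w with h0 | h0
    · obtain ⟨m, rfl⟩ := Int.eq_ofNat_of_zero_le h0
      exact series_conn_of_levels_eq hg hx hshare hw₁ hw₂ m r s hrs ha hc hq hw
    · obtain ⟨m, hm⟩ := Int.eq_ofNat_of_zero_le (neg_nonneg.2 h0)
      exact (series_conn_of_levels_eq hg hx hshare hw₁ hw₂ m s r hrs.symm ha.symm hc.symm hq.symm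
        (by omega)).symm
  -- apply a two-row exchange and use the induction hypothesis
  have key : ∀ (K : Set V) (i j : ι), i ≠ j →
      level (swapCols K r i j) (f₁ b₁) (f₂ t₂) = level r (f₁ b₁) (f₂ t₂) → ∀ a' c' : ℤ,
      level (swapCols K r i j) (f₁ b₁) (f₁ t₁) = level r (f₁ b₁) (f₁ t₁) + a' →
      level (swapCols K r i j) (f₁ t₁) (f₂ t₂) = level r (f₁ t₁) (f₂ t₂) + c' →
      ((0 ≤ a' ∧ a' ≤ a) ∨ (a ≤ a' ∧ a' ≤ 0)) → ((0 ≤ c' ∧ c' ≤ c) ∨ (c ≤ c' ∧ c' ≤ 0)) →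
      (a' ≠ 0 ∨ c' ≠ 0) → Conn (G₁.map f₁ ⊔ G₂.map f₂) (f₁ b₁) (f₂ t₂) r s := by
    intro K i j hij h1 a' c' h2 h3 h4 h5 h6
    obtain ⟨s', g1, g2, g3⟩ := series_conn_swap hg hw₁ hw₂ hrs hij K
      (by rw [Set.mem_uIcc, h2, ha]; omega) (by rw [← hx, Set.mem_uIcc, h3, hc]; omega) h1
    rw [← hx] at g3
    refine g1.trans (ih _ ?_ s' s (g1.sameFiber.symm.trans hrs) ?_ rfl)
    · rw [g2, g3, h2, h3, ha, hc]
      rw [ha, hc] at hn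
      omega
    · rw [← g1.colEq.level_eq, hq]
  have keyb : ∀ i j : ι, r i (f₁ b₁) = 1 → r j (f₁ b₁) = 0 → r i (f₂ t₂) = r j (f₂ t₂) →
      ∀ a' : ℤ, bit (r j (f₁ t₁)) - bit (r i (f₁ t₁)) = a' → a' ≠ 0 →
      ((0 ≤ a' ∧ a' ≤ a) ∨ (a ≤ a' ∧ a' ≤ 0)) →
      Conn (G₁.map f₁ ⊔ G₂.map f₂) (f₁ b₁) (f₂ t₂) r s := by
    intro i j h1 h2 h3 a' h4 h5 h6
    have hij : i ≠ j := by rintro rfl; rw [h1] at h2; exact absurd h2 (by decide)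
    refine key {f₁ b₁} i j hij ?_ a' 0 ?_ ?_ h6 (by omega) (Or.inl h5)
    · rw [level_swapCols_left r hij (Set.mem_singleton _) (by simpa using nbt.symm), h3]; ring
    · rw [level_swapCols_left r hij (Set.mem_singleton _) (by simpa using nbx.symm), h1, h2, ← h4]
      simp [bit]; ring
    · rw [level_swapCols_of_notMem r (by simpa using nbx.symm) (by simpa using nbt.symm)]; simp
  have keyt : ∀ i j : ι, r i (f₂ t₂) = 1 → r j (f₂ t₂) = 0 → r i (f₁ b₁) = r j (f₁ b₁) →
      ∀ c' : ℤ, bit (r j (f₁ t₁)) - bit (r i (f₁ t₁)) = c' → c' ≠ 0 →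
      ((0 ≤ c' ∧ c' ≤ c) ∨ (c ≤ c' ∧ c' ≤ 0)) →
      Conn (G₁.map f₁ ⊔ G₂.map f₂) (f₁ b₁) (f₂ t₂) r s := by
    intro i j h1 h2 h3 c' h4 h5 h6
    have hij : i ≠ j := by rintro rfl; rw [h1] at h2; exact absurd h2 (by decide)
    refine key {f₂ t₂} i j hij ?_ 0 c' ?_ ?_ (by omega) h6 (Or.inr h5)
    · rw [level_swapCols_right r hij (by simpa using nbt) (Set.mem_singleton _), h3]; ring
    · rw [level_swapCols_of_notMem r (by simpa using nbt) (by simpa using nxt)]; simp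
    · rw [level_swapCols_right r hij (by simpa using nxt) (Set.mem_singleton _), h1, h2, ← h4]
      simp [bit]; ring
  have keyx : ∀ i j : ι, r i (f₁ t₁) = 0 → r j (f₁ t₁) = 1 →
      ∀ a' c' : ℤ, bit (r i (f₁ b₁)) - bit (r j (f₁ b₁)) = a' →
      bit (r i (f₂ t₂)) - bit (r j (f₂ t₂)) = c' → a' ≠ 0 →
      ((0 ≤ a' ∧ a' ≤ a) ∨ (a ≤ a' ∧ a' ≤ 0)) → ((0 ≤ c' ∧ c' ≤ c) ∨ (c ≤ c' ∧ c' ≤ 0)) →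
      Conn (G₁.map f₁ ⊔ G₂.map f₂) (f₁ b₁) (f₂ t₂) r s := by
    intro i j h1 h2 a' c' h3 h4 h5 h6 h7
    have hij : i ≠ j := by rintro rfl; rw [h1] at h2; exact absurd h2 (by decide)
    refine key {f₁ t₁} i j hij ?_ a' c' ?_ ?_ h6 h7 (Or.inl h5)
    · rw [level_swapCols_of_notMem r (by simpa using nbx) (by simpa using nxt.symm)]
    · rw [level_swapCols_right r hij (by simpa using nbx) (Set.mem_singleton _), h1, h2, h3]
      simp [bit]
    · rw [level_swapCols_left r hij (Set.mem_singleton _) (by simpa using nxt.symm), h1, h2, h4]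
      simp [bit]
  obtain ⟨c111, c110, c011, c101, c100, c010, c001, c000⟩ :=
    exists_rows_of_cells (hrs.colSum_eq (f₁ b₁)) (hrs.colSum_eq (f₁ t₁)) (hrs.colSum_eq (f₂ t₂))
      (q := 0) ha hc (by simpa using hq) hw
  rw [add_zero] at c100 c001 c000
  -- In the next eight facts the letter names the column exchanged, the direction is the change of
  -- its level with the middle column, and the index is the common entry of the two rows in the
  -- other outer column. That common entry keeps the outer level fixed.
  have b_up₀ : 0 < a → w < a → w < a + c → Conn (G₁.map f₁ ⊔ G₂.map f₂) (f₁ b₁) (f₂ t₂) r s := by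
    intro g0 h1 h2
    obtain ⟨i, i1, i2, i3⟩ := c100 h1
    obtain ⟨j, j1, j2, j3⟩ := c010 h2
    exact keyb i j i1 j1 (i3.trans j3.symm) (1) (by rw [i2, j2]; rfl) (by norm_num) (by omega)
  have b_up₁ : 0 < a → 0 < w → c < w → Conn (G₁.map f₁ ⊔ G₂.map f₂) (f₁ b₁) (f₂ t₂) r s := by
    intro g0 h1 h2
    obtain ⟨i, i1, i2, i3⟩ := c101 h1
    obtain ⟨j, j1, j2, j3⟩ := c011 h2
    exact keyb i j i1 j1 (i3.trans j3.symm) (1) (by rw [i2, j2]; rfl) (by norm_num) (by omega)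
  have b_down₀ : a < 0 → a < w → a + c < w → Conn (G₁.map f₁ ⊔ G₂.map f₂) (f₁ b₁) (f₂ t₂) r s := by
    intro g0 h1 h2
    obtain ⟨i, i1, i2, i3⟩ := c110 h1
    obtain ⟨j, j1, j2, j3⟩ := c000 h2
    exact keyb i j i1 j1 (i3.trans j3.symm) (-1) (by rw [i2, j2]; rfl) (by norm_num) (by omega)
  have b_down₁ : a < 0 → w < 0 → w < c → Conn (G₁.map f₁ ⊔ G₂.map f₂) (f₁ b₁) (f₂ t₂) r s := by
    intro g0 h1 h2
    obtain ⟨i, i1, i2, i3⟩ := c111 h1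
    obtain ⟨j, j1, j2, j3⟩ := c001 h2
    exact keyb i j i1 j1 (i3.trans j3.symm) (-1) (by rw [i2, j2]; rfl) (by norm_num) (by omega)
  have t_up₀ : 0 < c → w < c → w < a + c → Conn (G₁.map f₁ ⊔ G₂.map f₂) (f₁ b₁) (f₂ t₂) r s := by
    intro g0 h1 h2
    obtain ⟨i, i1, i2, i3⟩ := c001 h1
    obtain ⟨j, j1, j2, j3⟩ := c010 h2
    exact keyt i j i3 j3 (i1.trans j1.symm) (1) (by rw [i2, j2]; rfl) (by norm_num) (by omega)
  have t_up₁ : 0 < c → 0 < w → a < w → Conn (G₁.map f₁ ⊔ G₂.map f₂) (f₁ b₁) (f₂ t₂) r s := by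
    intro g0 h1 h2
    obtain ⟨i, i1, i2, i3⟩ := c101 h1
    obtain ⟨j, j1, j2, j3⟩ := c110 h2
    exact keyt i j i3 j3 (i1.trans j1.symm) (1) (by rw [i2, j2]; rfl) (by norm_num) (by omega)
  have t_down₀ : c < 0 → c < w → a + c < w → Conn (G₁.map f₁ ⊔ G₂.map f₂) (f₁ b₁) (f₂ t₂) r s := by
    intro g0 h1 h2
    obtain ⟨i, i1, i2, i3⟩ := c011 h1
    obtain ⟨j, j1, j2, j3⟩ := c000 h2
    exact keyt i j i3 j3 (i1.trans j1.symm) (-1) (by rw [i2, j2]; rfl) (by norm_num) (by omega)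
  have t_down₁ : c < 0 → w < 0 → w < a → Conn (G₁.map f₁ ⊔ G₂.map f₂) (f₁ b₁) (f₂ t₂) r s := by
    intro g0 h1 h2
    obtain ⟨i, i1, i2, i3⟩ := c111 h1
    obtain ⟨j, j1, j2, j3⟩ := c100 h2
    exact keyt i j i3 j3 (i1.trans j1.symm) (-1) (by rw [i2, j2]; rfl) (by norm_num) (by omega)
  -- An exchange in the middle column between complementary rows changes both inner levels at once.
  -- The outer columns do not move.
  have x_up_up : 0 < a → 0 < c → 0 < w → w < a + c → Conn (G₁.map f₁ ⊔ G₂.map f₂) (f₁ b₁) (f₂ t₂) r s := by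
    intro g0 g1 h1 h2
    obtain ⟨i, i1, i2, i3⟩ := c101 h1
    obtain ⟨j, j1, j2, j3⟩ := c010 h2
    exact keyx i j i2 j2 (1) (1) (by rw [i1, j1]; rfl) (by rw [i3, j3]; rfl) (by norm_num)
      (by omega) (by omega)
  have x_down_down : a < 0 → c < 0 → a + c < w → w < 0 → Conn (G₁.map f₁ ⊔ G₂.map f₂) (f₁ b₁) (f₂ t₂) r s := by
    intro g0 g1 h1 h2
    obtain ⟨i, i1, i2, i3⟩ := c000 h1
    obtain ⟨j, j1, j2, j3⟩ := c111 h2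
    exact keyx i j i2 j2 (-1) (-1) (by rw [i1, j1]; rfl) (by rw [i3, j3]; rfl) (by norm_num)
      (by omega) (by omega)
  have x_up_down : 0 < a → c < 0 → w < a → c < w → Conn (G₁.map f₁ ⊔ G₂.map f₂) (f₁ b₁) (f₂ t₂) r s := by
    intro g0 g1 h1 h2
    obtain ⟨i, i1, i2, i3⟩ := c100 h1
    obtain ⟨j, j1, j2, j3⟩ := c011 h2
    exact keyx i j i2 j2 (1) (-1) (by rw [i1, j1]; rfl) (by rw [i3, j3]; rfl) (by norm_num)
      (by omega) (by omega)
  have x_down_up : a < 0 → 0 < c → w < c → a < w → Conn (G₁.map f₁ ⊔ G₂.map f₂) (f₁ b₁) (f₂ t₂) r s := by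
    intro g0 g1 h1 h2
    obtain ⟨i, i1, i2, i3⟩ := c001 h1
    obtain ⟨j, j1, j2, j3⟩ := c110 h2
    exact keyx i j i2 j2 (-1) (1) (by rw [i1, j1]; rfl) (by rw [i3, j3]; rfl) (by norm_num)
      (by omega) (by omega)
  -- For each sign pattern of `a` and `c`, the thresholds for `w` in the facts above cover the whole
  -- line; the pattern with both zero was settled before.
  rcases lt_trichotomy a 0 with a0 | a0 | a0 <;> rcases lt_trichotomy c 0 with d0 | d0 | d0
  · by_cases h : w < 0
    · by_cases h' : a + c < w
      · exact x_down_down a0 d0 h' h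
      · exact b_down₁ a0 h (by omega)
    · exact b_down₀ a0 (by omega) (by omega)
  · by_cases h : w < 0
    · exact b_down₁ a0 h (by omega)
    · exact b_down₀ a0 (by omega) (by omega)
  · by_cases h : w ≤ a
    · exact b_down₁ a0 (by omega) (by omega)
    · by_cases h' : w < c
      · exact x_down_up a0 d0 h' (by omega)
      · exact b_down₀ a0 (by omega) (by omega)
  · by_cases h : w < 0
    · exact t_down₁ d0 h (by omega)
    · exact t_down₀ d0 (by omega) (by omega)
  · exact absurd ⟨a0, d0⟩ hac
  · by_cases h : w < c
    · exact t_up₀ d0 h (by omega)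
    · exact t_up₁ d0 (by omega) (by omega)
  · by_cases h : w ≤ c
    · exact t_down₁ d0 (by omega) (by omega)
    · by_cases h' : w < a
      · exact x_up_down a0 d0 h' (by omega)
      · exact b_up₁ a0 (by omega) (by omega)
  · by_cases h : w < a
    · exact b_up₀ a0 h (by omega)
    · exact b_up₁ a0 (by omega) (by omega)
  · by_cases h : w ≤ 0
    · exact b_up₀ a0 (by omega) (by omega)
    · by_cases h' : w < a + c
      · exact x_up_up a0 d0 (by omega) h'
      · exact b_up₁ a0 (by omega) (by omega)

theorem wellConnected_series (hg : IsGluing f₁ f₂ b₁ t₁ b₂ t₂) (hx : f₁ t₁ = f₂ b₂)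
    (hshare : ∀ x y, f₁ x = f₂ y → x = t₁ ∧ y = b₂) (hb : b₁ ≠ t₁) (ht : t₂ ≠ b₂)
    (hw₁ : WellConnected ι G₁ b₁ t₁) (hw₂ : WellConnected ι G₂ b₂ t₂) :
    WellConnected ι (G₁.map f₁ ⊔ G₂.map f₂) (f₁ b₁) (f₂ t₂) where
  conn r s hrs h := series_conn hg hx hshare hb ht hw₁ hw₂ _ r s hrs h.level_eq.symm rfl
  up r s hrs hl := by
    have nbx : f₁ b₁ ≠ f₁ t₁ := f₁.injective.ne hb
    have nxt : f₁ t₁ ≠ f₂ t₂ := by rw [hx]; exact f₂.injective.ne ht.symm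
    have nbt : f₁ b₁ ≠ f₂ t₂ := fun h => hb (hshare _ _ h).1
    obtain ⟨a, ha⟩ : ∃ a, level s (f₁ b₁) (f₁ t₁) = level r (f₁ b₁) (f₁ t₁) + a :=
      ⟨_, (add_sub_cancel _ _).symm⟩
    obtain ⟨c, hc⟩ : ∃ c, level s (f₁ t₁) (f₂ t₂) = level r (f₁ t₁) (f₂ t₂) + c :=
      ⟨_, (add_sub_cancel _ _).symm⟩
    obtain ⟨q, hq⟩ : ∃ q, level s (f₁ b₁) (f₂ t₂) = level r (f₁ b₁) (f₂ t₂) + q :=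
      ⟨_, (add_sub_cancel _ _).symm⟩
    obtain ⟨w, hw⟩ : ∃ w, level₃ s (f₁ b₁) (f₁ t₁) (f₂ t₂) = level₃ r (f₁ b₁) (f₁ t₁) (f₂ t₂) + w :=
      ⟨_, (add_sub_cancel _ _).symm⟩
    have key : ∀ (K : Set V) (i j : ι), i ≠ j →
        level (swapCols K r i j) (f₁ b₁) (f₂ t₂) = level r (f₁ b₁) (f₂ t₂) + 1 → ∀ a' c' : ℤ,
        level (swapCols K r i j) (f₁ b₁) (f₁ t₁) = level r (f₁ b₁) (f₁ t₁) + a' →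
        level (swapCols K r i j) (f₁ t₁) (f₂ t₂) = level r (f₁ t₁) (f₂ t₂) + c' →
        ((0 ≤ a' ∧ a' ≤ a) ∨ (a ≤ a' ∧ a' ≤ 0)) → ((0 ≤ c' ∧ c' ≤ c) ∨ (c ≤ c' ∧ c' ≤ 0)) →
        ∃ r' s' : ι → V → Fin 2, SameFiber (G₁.map f₁ ⊔ G₂.map f₂) r r' ∧
          SameFiber (G₁.map f₁ ⊔ G₂.map f₂) r s' ∧
          level r' (f₁ b₁) (f₂ t₂) = level r (f₁ b₁) (f₂ t₂) ∧
          level s' (f₁ b₁) (f₂ t₂) = level r (f₁ b₁) (f₂ t₂) + 1 ∧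
          ∃ i j, i ≠ j ∧ ∀ k, k ≠ i → k ≠ j → r' k = s' k := by
      intro K i j hij h1 a' c' h2 h3 h4 h5
      obtain ⟨r', s', e1, e2, e3, e4⟩ := hg.realize rfl hw₁ hw₂ hrs hij K
        (by rw [Set.mem_uIcc, h2, ha]; omega) (by rw [← hx, Set.mem_uIcc, h3, hc]; omega)
      refine ⟨r', s', e1, e2, ?_, ?_, i, j, hij, e4⟩
      · exact level_congr (fun k => (e3 k _ (by simp)).1) (fun k => (e3 k _ (by simp)).1)
      · rw [← h1]
        exact level_congr (fun k => (e3 k _ (by simp)).2) (fun k => (e3 k _ (by simp)).2)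
    have keyb : ∀ i j : ι, r i (f₁ b₁) = 1 → r j (f₁ b₁) = 0 → r i (f₂ t₂) = 0 → r j (f₂ t₂) = 1 →
        ∀ a' : ℤ, bit (r j (f₁ t₁)) - bit (r i (f₁ t₁)) = a' →
        ((0 ≤ a' ∧ a' ≤ a) ∨ (a ≤ a' ∧ a' ≤ 0)) →
        ∃ r' s' : ι → V → Fin 2, SameFiber (G₁.map f₁ ⊔ G₂.map f₂) r r' ∧
          SameFiber (G₁.map f₁ ⊔ G₂.map f₂) r s' ∧
          level r' (f₁ b₁) (f₂ t₂) = level r (f₁ b₁) (f₂ t₂) ∧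
          level s' (f₁ b₁) (f₂ t₂) = level r (f₁ b₁) (f₂ t₂) + 1 ∧
          ∃ i j, i ≠ j ∧ ∀ k, k ≠ i → k ≠ j → r' k = s' k := by
      intro i j h1 h2 h3 h4 a' h5 h6
      have hij : i ≠ j := by rintro rfl; rw [h1] at h2; exact absurd h2 (by decide)
      refine key {f₁ b₁} i j hij ?_ a' 0 ?_ ?_ h6 (by omega)
      · rw [level_swapCols_left r hij (Set.mem_singleton _) (by simpa using nbt.symm), h1, h2, h3, h4]
        simp [bit]
      · rw [level_swapCols_left r hij (Set.mem_singleton _) (by simpa using nbx.symm), h1, h2, ← h5]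
        simp [bit]; ring
      · rw [level_swapCols_of_notMem r (by simpa using nbx.symm) (by simpa using nbt.symm)]; simp
    have keyt : ∀ i j : ι, r i (f₁ b₁) = 1 → r j (f₁ b₁) = 0 → r i (f₂ t₂) = 0 → r j (f₂ t₂) = 1 →
        ∀ c' : ℤ, bit (r i (f₁ t₁)) - bit (r j (f₁ t₁)) = c' →
        ((0 ≤ c' ∧ c' ≤ c) ∨ (c ≤ c' ∧ c' ≤ 0)) →
        ∃ r' s' : ι → V → Fin 2, SameFiber (G₁.map f₁ ⊔ G₂.map f₂) r r' ∧
          SameFiber (G₁.map f₁ ⊔ G₂.map f₂) r s' ∧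
          level r' (f₁ b₁) (f₂ t₂) = level r (f₁ b₁) (f₂ t₂) ∧
          level s' (f₁ b₁) (f₂ t₂) = level r (f₁ b₁) (f₂ t₂) + 1 ∧
          ∃ i j, i ≠ j ∧ ∀ k, k ≠ i → k ≠ j → r' k = s' k := by
      intro i j h1 h2 h3 h4 c' h5 h6
      have hij : i ≠ j := by rintro rfl; rw [h1] at h2; exact absurd h2 (by decide)
      refine key {f₂ t₂} i j hij ?_ 0 c' ?_ ?_ (by omega) h6
      · rw [level_swapCols_right r hij (by simpa using nbt) (Set.mem_singleton _), h1, h2, h3, h4]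
        simp [bit]
      · rw [level_swapCols_of_notMem r (by simpa using nbt) (by simpa using nxt)]; simp
      · rw [level_swapCols_right r hij (by simpa using nxt) (Set.mem_singleton _), h3, h4, ← h5]
        simp [bit]; ring
    obtain ⟨-, c110, c011, -, c100, -, c001, -⟩ :=
      exists_rows_of_cells (hrs.colSum_eq (f₁ b₁)) (hrs.colSum_eq (f₁ t₁)) (hrs.colSum_eq (f₂ t₂))
        ha hc hq hw
    have hqpos : 0 < q := by omega
    -- As `q` is positive, 100 or 110 is in surplus, and so is 001 or 011. Rows with equal middle
    -- entries are exchanged without touching the inner levels. If only 100 and 011 are available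
    -- then c < a, so `a` may rise or `c` may fall; if only 110 and 001 are, then a < c and the
    -- roles are reversed.
    by_cases h100 : w < a + q
    · obtain ⟨i, i1, i2, i3⟩ := c100 h100
      by_cases h001 : w < c + q
      · obtain ⟨j, j1, j2, j3⟩ := c001 h001
        exact keyb i j i1 j1 i3 j3 0 (by rw [i2, j2]; rfl) (by omega)
      · obtain ⟨j, j1, j2, j3⟩ := c011 (by omega)
        by_cases h110 : a < w
        · obtain ⟨k, k1, k2, k3⟩ := c110 h110
          exact keyb k j k1 j1 k3 j3 0 (by rw [k2, j2]; rfl) (by omega)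
        · by_cases h0 : 1 ≤ a
          · exact keyb i j i1 j1 i3 j3 1 (by rw [i2, j2]; rfl) (by omega)
          · exact keyt i j i1 j1 i3 j3 (-1) (by rw [i2, j2]; rfl) (by omega)
    · obtain ⟨i, i1, i2, i3⟩ := c110 (by omega)
      by_cases h011 : c < w
      · obtain ⟨j, j1, j2, j3⟩ := c011 h011
        exact keyb i j i1 j1 i3 j3 0 (by rw [i2, j2]; rfl) (by omega)
      · obtain ⟨j, j1, j2, j3⟩ := c001 (by omega)
        by_cases h0 : 1 ≤ c
        · exact keyt i j i1 j1 i3 j3 1 (by rw [i2, j2]; rfl) (by omega)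
        · exact keyb i j i1 j1 i3 j3 (-1) (by rw [i2, j2]; rfl) (by omega)

end Series

/-! ### Subgraphs of series-parallel graphs -/

theorem top_ne_bottom {V : Type*} {H : SimpleGraph V} {t b : V} (h : IsSeriesParallel H t b) :
    t ≠ b := by
  induction h with
  | edge G t b hV hG => exact hG.ne
  | series G₁ G₂ t₁ b₁ t₂ b₂ f₁ f₂ h₁ h₂ hcover hglue ih₁ ih₂ =>
    exact fun h => ih₂ ((hglue _ _).1 h.symm).2
  | parallel G₁ G₂ t₁ b₁ t₂ b₂ f₁ f₂ h₁ h₂ hcover hglue ih₁ ih₂ =>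
    exact fun h => ih₁ (f₁.injective h)

theorem eq_map_sup_map_of_le {f₁ : V₁ ↪ V} {f₂ : V₂ ↪ V} {G : SimpleGraph V}
    {H₁ : SimpleGraph V₁} {H₂ : SimpleGraph V₂} (h : G ≤ H₁.map f₁ ⊔ H₂.map f₂) :
    G = (G.comap f₁ ⊓ H₁).map f₁ ⊔ (G.comap f₂ ⊓ H₂).map f₂ := by
  refine le_antisymm ?_ (sup_le ?_ ?_)
  · intro x y hxy
    rcases h hxy with h | h
    · obtain ⟨a, c, hac, rfl, rfl⟩ := (SimpleGraph.map_adj _ _ _ _).1 h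
      exact Or.inl ((SimpleGraph.map_adj _ _ _ _).2 ⟨a, c, ⟨hxy, hac⟩, rfl, rfl⟩)
    · obtain ⟨a, c, hac, rfl, rfl⟩ := (SimpleGraph.map_adj _ _ _ _).1 h
      exact Or.inr ((SimpleGraph.map_adj _ _ _ _).2 ⟨a, c, ⟨hxy, hac⟩, rfl, rfl⟩)
  · intro x y hxy
    obtain ⟨a, c, hac, rfl, rfl⟩ := (SimpleGraph.map_adj _ _ _ _).1 hxy
    exact hac.1
  · intro x y hxy
    obtain ⟨a, c, hac, rfl, rfl⟩ := (SimpleGraph.map_adj _ _ _ _).1 hxy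
    exact hac.1

theorem cover_of_range_union {f₁ : V₁ ↪ V} {f₂ : V₂ ↪ V}
    (h : Set.range f₁ ∪ Set.range f₂ = Set.univ) (v : V) : (∃ x, f₁ x = v) ∨ ∃ y, f₂ y = v := by
  have : v ∈ Set.range f₁ ∪ Set.range f₂ := h ▸ Set.mem_univ v
  exact this

/-- A spanning subgraph inherits the decomposition of `H` by intersecting it with each part, and the
gluing steps never ask the parts to be connected. -/
theorem wellConnected_of_le_seriesParallel (ι : Type*) [Fintype ι] [DecidableEq ι] {V : Type*}
    {H : SimpleGraph V} {t b : V} (h : IsSeriesParallel H t b) :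
    ∀ G : SimpleGraph V, G ≤ H → WellConnected ι G t b := by
  induction h with
  | edge H t b hV hH => exact fun G _ => wellConnected_of_two_vertices G hH.ne hV
  | series H₁ H₂ t₁ b₁ t₂ b₂ f₁ f₂ h₁ h₂ hcover hglue ih₁ ih₂ =>
    intro G hG
    rw [eq_map_sup_map_of_le hG]
    refine (wellConnected_series ⟨cover_of_range_union hcover, ?_, ?_⟩ ((hglue _ _).2 ⟨rfl, rfl⟩)
      (fun x y => (hglue x y).1) (top_ne_bottom h₁).symm (top_ne_bottom h₂)
      (ih₁ _ inf_le_right).swap (ih₂ _ inf_le_right).swap).swap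
    · exact fun x y hxy => Or.inr ((hglue x y).1 hxy).1
    · exact fun x y hxy => Or.inl ((hglue x y).1 hxy).2
  | parallel H₁ H₂ t₁ b₁ t₂ b₂ f₁ f₂ h₁ h₂ hcover hglue ih₁ ih₂ =>
    intro G hG
    rw [eq_map_sup_map_of_le hG]
    refine wellConnected_parallel ⟨cover_of_range_union hcover, ?_, ?_⟩
      ((hglue _ _).2 (Or.inl ⟨rfl, rfl⟩)) ((hglue _ _).2 (Or.inr ⟨rfl, rfl⟩)) (top_ne_bottom h₁)
      (ih₁ _ inf_le_right) (ih₂ _ inf_le_right)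
    · exact fun x y hxy => ((hglue x y).1 hxy).imp And.left And.left
    · exact fun x y hxy => ((hglue x y).1 hxy).imp And.right And.right

end BinaryTable

/-! ### Graphs without a `K₄` minor -/

section MinDegree

variable {V : Type*} {G : SimpleGraph V}

theorem isMinorOf_completeGraph_four {A B C D : Set V} (hA : (G.induce A).Connected)
    (hB : (G.induce B).Connected) (hC : (G.induce C).Connected) (hD : (G.induce D).Connected)
    (dAB : Disjoint A B) (dAC : Disjoint A C) (dAD : Disjoint A D) (dBC : Disjoint B C)
    (dBD : Disjoint B D) (dCD : Disjoint C D) (eAB : ∃ x ∈ A, ∃ y ∈ B, G.Adj x y)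
    (eAC : ∃ x ∈ A, ∃ y ∈ C, G.Adj x y) (eAD : ∃ x ∈ A, ∃ y ∈ D, G.Adj x y)
    (eBC : ∃ x ∈ B, ∃ y ∈ C, G.Adj x y) (eBD : ∃ x ∈ B, ∃ y ∈ D, G.Adj x y)
    (eCD : ∃ x ∈ C, ∃ y ∈ D, G.Adj x y) : IsMinorOf (⊤ : SimpleGraph (Fin 4)) G := by
  have symm : ∀ {A B : Set V}, (∃ x ∈ A, ∃ y ∈ B, G.Adj x y) → ∃ x ∈ B, ∃ y ∈ A, G.Adj x y :=
    fun ⟨x, hx, y, hy, h⟩ => ⟨y, hy, x, hx, h.symm⟩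
  refine ⟨![A, B, C, D], fun w => ?_, fun w w' hw => ?_, fun w w' hw => ?_⟩
  · fin_cases w
    exacts [hA, hB, hC, hD]
  · fin_cases w <;> fin_cases w' <;> first
      | exact absurd rfl hw
      | assumption
      | exact Disjoint.symm (by assumption)
  · fin_cases w <;> fin_cases w' <;> first
      | exact absurd rfl hw.ne
      | assumption
      | exact symm (by assumption)

/-- `p 0, …, p k` is a path in `G`. -/
def IsPathSeq (G : SimpleGraph V) (k : ℕ) (p : ℕ → V) : Prop :=
  (∀ i < k, G.Adj (p i) (p (i + 1))) ∧ Set.InjOn p (Set.Iic k)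

theorem IsPathSeq.connected_induce_image {k : ℕ} {p : ℕ → V} (hp : IsPathSeq G k p) {a b : ℕ}
    (hab : a ≤ b) (hb : b ≤ k) : (G.induce (p '' Set.Icc a b)).Connected := by
  have hreach : ∀ c (hac : a ≤ c) (hcb : c ≤ b),
      (G.induce (p '' Set.Icc a b)).Reachable ⟨p a, a, ⟨le_rfl, hab⟩, rfl⟩ ⟨p c, c, ⟨hac, hcb⟩, rfl⟩ := by
    intro c hac
    induction c, hac using Nat.le_induction with
    | base => exact fun _ => SimpleGraph.Reachable.refl _
    | succ c hac ih =>
      intro hcb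
      refine (ih (by omega)).trans (SimpleGraph.Adj.reachable ?_)
      exact hp.1 c (by omega)
  have : Nonempty (p '' Set.Icc a b) := ⟨⟨p a, a, ⟨le_rfl, hab⟩, rfl⟩⟩
  refine ⟨?_⟩
  rintro ⟨_, c, hc, rfl⟩ ⟨_, d, hd, rfl⟩
  exact (hreach c hc.1 hc.2).symm.trans (hreach d hd.1 hd.2)

theorem IsPathSeq.disjoint_image {k : ℕ} {p : ℕ → V} (hp : IsPathSeq G k p) {a b c d : ℕ}
    (hbc : b < c) (hd : d ≤ k) : Disjoint (p '' Set.Icc a b) (p '' Set.Icc c d) := by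
  rw [Set.disjoint_left]
  rintro _ ⟨m, hm, rfl⟩ ⟨n, hn, hmn⟩
  have h1 := hm.2
  have h2 := hn.1
  have h3 := hn.2
  have := hp.2 (show n ∈ Set.Iic k from h3.trans hd) (show m ∈ Set.Iic k by
    rw [Set.mem_Iic]; omega) hmn
  omega

/-- Reversing an initial segment of a path along a chord from its first vertex. -/
theorem IsPathSeq.rotate {k : ℕ} {p : ℕ → V} (hp : IsPathSeq G k p) {i : ℕ}
    (hik : i ≤ k) (h : G.Adj (p 0) (p i)) :
    IsPathSeq G k fun m => if m < i then p (i - 1 - m) else p m := by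
  constructor
  · intro m hm
    by_cases h1 : m + 1 < i
    · have e := (hp.1 (i - 1 - (m + 1)) (by omega)).symm
      rw [show i - 1 - (m + 1) + 1 = i - 1 - m by omega] at e
      simpa [show m < i by omega, h1] using e
    · by_cases h2 : m < i
      · have : m + 1 = i := by omega
        simpa only [if_pos h2, show i - 1 - m = 0 by omega, this, lt_irrefl, if_false] using h
      · simpa only [if_neg h2, if_neg h1] using hp.1 m hm
  · intro m hm n hn hmn
    rw [Set.mem_Iic] at hm hn
    have inj : ∀ {a c : ℕ}, a ≤ k → c ≤ k → p a = p c → a = c := fun ha hc h => hp.2 ha hc h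
    by_cases h1 : m < i <;> by_cases h2 : n < i
    · simp only [if_pos h1, if_pos h2] at hmn
      have := inj (by omega) (by omega) hmn
      omega
    · simp only [if_pos h1, if_neg h2] at hmn
      have := inj (by omega) (by omega) hmn
      omega
    · simp only [if_neg h1, if_pos h2] at hmn
      have := inj (by omega) (by omega) hmn
      omega
    · simp only [if_neg h1, if_neg h2] at hmn
      exact inj hm hn hmn

/-- A finite nonempty graph of minimum degree at least three has a `K₄` minor. -/
theorem isMinorOf_of_min_degree [Finite V] [Nonempty V]
    (h : ∀ v x y : V, ∃ z, G.Adj v z ∧ z ≠ x ∧ z ≠ y) : IsMinorOf (⊤ : SimpleGraph (Fin 4)) G := by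
  classical
  have hbound : ∀ k, (∃ p, IsPathSeq G k p) → k ≤ Nat.card V := by
    rintro k ⟨p, hp⟩
    have h1 : (p '' (Set.Iic k)).ncard = k + 1 := by
      rw [Set.InjOn.ncard_image hp.2]
      simp [Set.ncard_eq_toFinset_card']
    have h2 := Set.ncard_le_card (p '' (Set.Iic k))
    omega
  obtain ⟨k, ⟨p₀, hp₀⟩, hmax⟩ : ∃ k, (∃ p, IsPathSeq G k p) ∧ ∀ p, ¬ IsPathSeq G (k + 1) p := by
    by_contra hcon
    push Not at hcon
    have : ∀ k, ∃ p, IsPathSeq G k p := by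
      intro k
      induction k with
      | zero =>
        refine ⟨fun _ => Classical.arbitrary V, fun i hi => absurd hi (by omega), ?_⟩
        intro a ha c hc _
        rw [Set.mem_Iic] at ha hc
        omega
      | succ k ih => exact hcon k ih
    have := hbound _ (this (Nat.card V + 1))
    omega
  -- neighbours of the first vertex of a longest path lie on the path
  have hnbr : ∀ p, IsPathSeq G k p → ∀ z, G.Adj (p 0) z → ∃ j, 1 ≤ j ∧ j ≤ k ∧ p j = z := by
    intro p hp z hz
    by_contra hcon
    push Not at hcon
    have hz' : ∀ j, j ≤ k → p j ≠ z := by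
      intro j hj
      by_cases h0 : j = 0
      · subst h0; exact hz.ne
      · exact hcon j (by omega) hj
    refine hmax (fun m => if m = 0 then z else p (m - 1)) ⟨?_, ?_⟩
    · intro i hi
      by_cases h0 : i = 0
      · subst h0; simpa using hz.symm
      · have := hp.1 (i - 1) (by omega)
        rw [show i - 1 + 1 = i by omega] at this
        simpa [h0] using this
    · intro a ha c hc hac
      rw [Set.mem_Iic] at ha hc
      by_cases h1 : a = 0 <;> by_cases h2 : c = 0
      · omega
      · simp only [h1, h2, if_true, if_false] at hac
        exact absurd hac.symm (hz' _ (by omega))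
      · simp only [h1, h2, if_true, if_false] at hac
        exact absurd hac (hz' _ (by omega))
      · simp only [h1, h2, if_false] at hac
        have := hp.2 (show a - 1 ∈ Set.Iic k by rw [Set.mem_Iic]; omega)
          (show c - 1 ∈ Set.Iic k by rw [Set.mem_Iic]; omega) hac
        omega
  -- The chord from the first vertex is chosen shortest among all paths of maximal length, not just
  -- for one path, because the minimality is used again for a rotated path.
  have hex : ∃ i, ∃ p, IsPathSeq G k p ∧ 2 ≤ i ∧ i ≤ k ∧ G.Adj (p 0) (p i) := by
    obtain ⟨z, hz, hz1, -⟩ := h (p₀ 0) (p₀ 1) (p₀ 1)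
    obtain ⟨j, hj1, hj2, rfl⟩ := hnbr p₀ hp₀ z hz
    refine ⟨j, p₀, hp₀, ?_, hj2, hz⟩
    by_contra hcon
    exact hz1 (by rw [show j = 1 by omega])
  set i := Nat.find hex with hi
  obtain ⟨p, hp, hi2, hik, hadj⟩ := Nat.find_spec hex
  rw [← hi] at hi2 hik hadj
  have hmin : ∀ j p, IsPathSeq G k p → 2 ≤ j → j ≤ k → G.Adj (p 0) (p j) → i ≤ j :=
    fun j p h1 h2 h3 h4 => Nat.find_min' hex ⟨p, h1, h2, h3, h4⟩
  obtain ⟨j, hij, hjk, hj⟩ : ∃ j, i < j ∧ j ≤ k ∧ G.Adj (p 0) (p j) := by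
    obtain ⟨z, hz, hz1, hz2⟩ := h (p 0) (p 1) (p i)
    obtain ⟨j, hj1, hj2, rfl⟩ := hnbr p hp z hz
    have n1 : j ≠ 1 := fun h => hz1 (by rw [h])
    have n2 : j ≠ i := fun h => hz2 (by rw [h])
    have := hmin j p hp (by omega) hj2 hz
    exact ⟨j, by omega, hj2, hz⟩
  -- Rotation makes `p (i - 1)` the first vertex of another longest path. A chord from it landing
  -- before position `i` would be shorter than `i`, so its third neighbour lies beyond `p i`.
  obtain ⟨m, him, hmk, hm⟩ : ∃ m, i < m ∧ m ≤ k ∧ G.Adj (p (i - 1)) (p m) := by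
    have hrot := hp.rotate hik hadj
    obtain ⟨z, hz, hz1, hz2⟩ := h (p (i - 1)) (p (i - 2)) (p i)
    obtain ⟨l, hl1, hl2, hlz⟩ := hnbr _ hrot z (by simpa [show 0 < i by omega] using hz)
    by_cases hli : l < i
    · have hl3 : 2 ≤ l := by
        by_contra hcon
        have : l = 1 := by omega
        rw [if_pos hli, this] at hlz
        exact hz1 (by rw [← hlz, Nat.sub_sub])
      have := hmin l _ hrot hl3 hl2 (by
        rw [hlz]; simpa [show 0 < i by omega] using hz)
      omega
    · rw [if_neg hli] at hlz
      have : l ≠ i := fun h => hz2 (by rw [← hlz, h])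
      exact ⟨l, by omega, hl2, by rw [hlz]; exact hz⟩
  have hcons : ∀ n, 1 ≤ n → n ≤ k → G.Adj (p (n - 1)) (p n) := by
    intro n h1 h2
    have := hp.1 (n - 1) (by omega)
    rwa [show n - 1 + 1 = n by omega] at this
  have mem : ∀ {a b c : ℕ}, a ≤ c → c ≤ b → p c ∈ p '' Set.Icc a b := fun h1 h2 => ⟨_, ⟨h1, h2⟩, rfl⟩
  -- The path is cut into consecutive blocks: its first vertex, the rest before `p i`, the stretch
  -- from `p i` up to the nearer of `p j` and `p m`, and the stretch between those two. The three
  -- chords supply the edges between blocks that are not consecutive.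
  refine isMinorOf_completeGraph_four (A := p '' Set.Icc 0 0) (B := p '' Set.Icc 1 (i - 1))
    (C := p '' Set.Icc i (min j m - 1)) (D := p '' Set.Icc (min j m) (max j m))
    (hp.connected_induce_image le_rfl (by omega)) (hp.connected_induce_image (by omega) (by omega))
    (hp.connected_induce_image (by omega) (by omega))
    (hp.connected_induce_image (by omega) (by omega))
    (hp.disjoint_image (by omega) (by omega)) (hp.disjoint_image (by omega) (by omega))
    (hp.disjoint_image (by omega) (by omega)) (hp.disjoint_image (by omega) (by omega))
    (hp.disjoint_image (by omega) (by omega)) (hp.disjoint_image (by omega) (by omega))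
    ⟨_, mem le_rfl le_rfl, _, mem (c := 1) (by omega) (by omega), hp.1 0 (by omega)⟩
    ⟨_, mem le_rfl le_rfl, _, mem (c := i) (by omega) (by omega), hadj⟩
    ⟨_, mem le_rfl le_rfl, _, mem (c := j) (by omega) (by omega), hj⟩
    ⟨_, mem (c := i - 1) (by omega) (by omega), _, mem (c := i) (by omega) (by omega),
      hcons i (by omega) hik⟩
    ⟨_, mem (c := i - 1) (by omega) (by omega), _, mem (c := m) (by omega) (by omega), hm⟩
    ⟨_, mem (c := min j m - 1) (by omega) (by omega), _, mem (c := min j m) (by omega) (by omega),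
      hcons _ (by omega) (by omega)⟩

end MinDegree

/-! ### Attaching a vertex to a series-parallel graph -/

theorem IsSeriesParallel.exists_adj {V : Type u} {H : SimpleGraph V} {t b : V}
    (h : IsSeriesParallel H t b) : ∀ x, ∃ y, H.Adj x y := by
  induction h with
  | edge G t b hV hG =>
    intro x
    rcases hV x with rfl | rfl
    · exact ⟨_, hG⟩
    · exact ⟨_, hG.symm⟩
  | series G₁ G₂ t₁ b₁ t₂ b₂ f₁ f₂ h₁ h₂ hcover hglue ih₁ ih₂
  | parallel G₁ G₂ t₁ b₁ t₂ b₂ f₁ f₂ h₁ h₂ hcover hglue ih₁ ih₂ =>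
    intro x
    rcases BinaryTable.cover_of_range_union hcover x with ⟨a, rfl⟩ | ⟨a, rfl⟩
    · obtain ⟨y, hy⟩ := ih₁ a
      exact ⟨f₁ y, Or.inl ((SimpleGraph.map_adj _ _ _ _).2 ⟨a, y, hy, rfl, rfl⟩)⟩
    · obtain ⟨y, hy⟩ := ih₂ a
      exact ⟨f₂ y, Or.inr ((SimpleGraph.map_adj _ _ _ _).2 ⟨a, y, hy, rfl, rfl⟩)⟩

/-- The edge is put in parallel with the series composition of two edges through `v`; the result is
a triangle with the same terminals. -/
theorem IsSeriesParallel.attach_edge {V' V : Type u} {G : SimpleGraph V'} {t b : V'}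
    (hV : ∀ v, v = t ∨ v = b) (hG : G.Adj t b) (f : V' ↪ V) (v : V) (hv : ∀ x, f x ≠ v)
    (hcov : ∀ w, w = v ∨ ∃ x, f x = w) :
    ∃ H : SimpleGraph V, G.map f ≤ H ∧ H.Adj v (f t) ∧ H.Adj v (f b) ∧
      IsSeriesParallel H (f t) (f b) := by
  have htb : f t ≠ f b := f.injective.ne hG.ne
  let S₁ := {w : V // w = f b ∨ w = v}
  let S₂ := {w : V // w = v ∨ w = f t}
  have h₁ : IsSeriesParallel (⊤ : SimpleGraph S₁) ⟨v, Or.inr rfl⟩ ⟨f b, Or.inl rfl⟩ := by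
    refine IsSeriesParallel.edge _ _ _ ?_ ?_
    · rintro ⟨w, rfl | rfl⟩
      · exact Or.inr rfl
      · exact Or.inl rfl
    · exact fun h => hv b (congrArg Subtype.val h).symm
  have h₂ : IsSeriesParallel (⊤ : SimpleGraph S₂) ⟨f t, Or.inr rfl⟩ ⟨v, Or.inl rfl⟩ := by
    refine IsSeriesParallel.edge _ _ _ ?_ ?_
    · rintro ⟨w, rfl | rfl⟩
      · exact Or.inr rfl
      · exact Or.inl rfl
    · exact fun h => hv t (congrArg Subtype.val h)
  have h₃ := IsSeriesParallel.series (V := V) _ _ _ _ _ _ (Function.Embedding.subtype _)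
    (Function.Embedding.subtype _) h₁ h₂ (by
      ext w
      simp only [Set.mem_union, Set.mem_range, Set.mem_univ, iff_true]
      rcases hcov w with rfl | ⟨x, rfl⟩
      · exact Or.inl ⟨⟨_, Or.inr rfl⟩, rfl⟩
      · rcases hV x with rfl | rfl
        · exact Or.inr ⟨⟨_, Or.inr rfl⟩, rfl⟩
        · exact Or.inl ⟨⟨_, Or.inl rfl⟩, rfl⟩) (by
      rintro ⟨x, hx⟩ ⟨y, hy⟩
      simp only [Function.Embedding.subtype_apply, Subtype.mk.injEq]
      constructor
      · rintro rfl
        rcases hx with rfl | rfl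
        · rcases hy with h | h
          · exact absurd h (hv b)
          · exact absurd h.symm htb
        · exact ⟨rfl, rfl⟩
      · rintro ⟨rfl, rfl⟩; rfl)
  simp only [Function.Embedding.subtype_apply] at h₃
  have h₄ := IsSeriesParallel.parallel _ _ _ _ _ _ f (Function.Embedding.refl V)
    (IsSeriesParallel.edge G t b hV hG) h₃ (Set.eq_univ_of_forall fun w => Or.inr ⟨w, rfl⟩) (by
      intro x y
      rw [Function.Embedding.refl_apply]
      constructor
      · rintro rfl
        rcases hV x with rfl | rfl
        · exact Or.inl ⟨rfl, rfl⟩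
        · exact Or.inr ⟨rfl, rfl⟩
      · rintro (⟨rfl, rfl⟩ | ⟨rfl, rfl⟩) <;> rfl)
  refine ⟨_, le_sup_left, ?_, ?_, h₄⟩
  · refine Or.inr ((SimpleGraph.map_adj _ _ _ _).2 ⟨v, f t, Or.inr ?_, rfl, rfl⟩)
    exact (SimpleGraph.map_adj _ _ _ _).2 ⟨⟨v, Or.inl rfl⟩, ⟨f t, Or.inr rfl⟩,
      fun h => hv t (congrArg Subtype.val h).symm, rfl, rfl⟩
  · refine Or.inr ((SimpleGraph.map_adj _ _ _ _).2 ⟨v, f b, Or.inl ?_, rfl, rfl⟩)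
    exact (SimpleGraph.map_adj _ _ _ _).2 ⟨⟨v, Or.inr rfl⟩, ⟨f b, Or.inl rfl⟩,
      fun h => hv b (congrArg Subtype.val h).symm, rfl, rfl⟩

/-- In the induction for `attach` the new vertex is added to the part that contains the chosen edge.
`Option V₁` is that part enlarged by one point, which is sent to `v`. -/
theorem exists_extension {V₁ V : Type u} (k : V₁ ↪ V) (v : V) (hv : ∀ a, k a ≠ v) :
    ∃ (W : Type u) (g : V₁ ↪ W) (e : W ↪ V) (w₀ : W), (∀ a, e (g a) = k a) ∧ e w₀ = v ∧
      (∀ a, g a ≠ w₀) ∧ ∀ w, w = w₀ ∨ ∃ a, g a = w := by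
  refine ⟨Option V₁, Function.Embedding.some, ⟨fun o => o.elim v k, ?_⟩, none, fun _ => rfl, rfl,
    fun a => Option.some_ne_none a, ?_⟩
  · rintro (_ | a) (_ | c) h
    · rfl
    · exact absurd h.symm (hv c)
    · exact absurd h (hv a)
    · exact congrArg some (k.injective h)
  · rintro (_ | a)
    · exact Or.inl rfl
    · exact Or.inr ⟨a, rfl⟩

section Extension

variable {V₁ V₂ V' V W : Type*} {f₁ : V₁ ↪ V'} {f₂ : V₂ ↪ V'} {f : V' ↪ V} {v : V} {g : V₁ ↪ W}
  {e : W ↪ V} {w₀ : W}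

theorem extension_eq_iff (he : ∀ a, e (g a) = f (f₁ a)) (hw₀ : e w₀ = v) (hv : ∀ x, f x ≠ v)
    (hW : ∀ w, w = w₀ ∨ ∃ a, g a = w) (w : W) (c : V') :
    e w = f c ↔ ∃ a, g a = w ∧ f₁ a = c := by
  constructor
  · intro h
    rcases hW w with rfl | ⟨a, rfl⟩
    · exact absurd (h.symm.trans hw₀) (hv c)
    · exact ⟨a, rfl, f.injective ((he a).symm.trans h)⟩
  · rintro ⟨a, rfl, rfl⟩
    exact he a

theorem extension_cover (hcover : Set.range f₁ ∪ Set.range f₂ = Set.univ)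
    (he : ∀ a, e (g a) = f (f₁ a)) (hw₀ : e w₀ = v) (hcov : ∀ w, w = v ∨ ∃ x, f x = w) :
    Set.range e ∪ Set.range (f₂.trans f) = Set.univ := by
  ext w
  simp only [Set.mem_union, Set.mem_range, Set.mem_univ, iff_true]
  rcases hcov w with rfl | ⟨c, rfl⟩
  · exact Or.inl ⟨w₀, hw₀⟩
  · rcases BinaryTable.cover_of_range_union hcover c with ⟨a, rfl⟩ | ⟨a, rfl⟩
    · exact Or.inl ⟨g a, he a⟩
    · exact Or.inr ⟨a, rfl⟩

theorem extension_map_le {G₁ : SimpleGraph V₁} {G₂ : SimpleGraph V₂} {H : SimpleGraph W}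
    (he : ∀ a, e (g a) = f (f₁ a)) (hH : G₁.map g ≤ H) :
    (G₁.map f₁ ⊔ G₂.map f₂).map f ≤ H.map e ⊔ G₂.map (f₂.trans f) := by
  intro x y hxy
  obtain ⟨a, c, hac, rfl, rfl⟩ := (SimpleGraph.map_adj _ _ _ _).1 hxy
  rcases hac with h | h
  · obtain ⟨a, c, hac, rfl, rfl⟩ := (SimpleGraph.map_adj _ _ _ _).1 h
    exact Or.inl ((SimpleGraph.map_adj _ _ _ _).2 ⟨g a, g c,
      hH ((SimpleGraph.map_adj _ _ _ _).2 ⟨a, c, hac, rfl, rfl⟩), he a, he c⟩)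
  · obtain ⟨a, c, hac, rfl, rfl⟩ := (SimpleGraph.map_adj _ _ _ _).1 h
    exact Or.inr ((SimpleGraph.map_adj _ _ _ _).2 ⟨a, c, hac, rfl, rfl⟩)

end Extension

/-- A new vertex can be joined to both ends of an edge of a series-parallel graph. -/
theorem IsSeriesParallel.attach {V' : Type u} {H' : SimpleGraph V'} {t b : V'}
    (h : IsSeriesParallel H' t b) : ∀ {V : Type u} (f : V' ↪ V) (v : V), (∀ x, f x ≠ v) →
    (∀ w, w = v ∨ ∃ x, f x = w) → ∀ x y, H'.Adj x y →
    ∃ H : SimpleGraph V, H'.map f ≤ H ∧ H.Adj v (f x) ∧ H.Adj v (f y) ∧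
      IsSeriesParallel H (f t) (f b) := by
  induction h with
  | edge G t b hV hG =>
    intro V f v hv hcov x y hxy
    obtain ⟨H, h1, h2, h3, h4⟩ := IsSeriesParallel.attach_edge hV hG f v hv hcov
    refine ⟨H, h1, ?_, ?_, h4⟩
    · rcases hV x with rfl | rfl <;> assumption
    · rcases hV y with rfl | rfl <;> assumption
  | @series V₁ V₂ V' G₁ G₂ t₁ b₁ t₂ b₂ f₁ f₂ h₁ h₂ hcover hglue ih₁ ih₂ =>
    intro V f v hv hcov x y hxy
    rcases hxy with hxy | hxy
    · obtain ⟨x₁, y₁, hxy₁, rfl, rfl⟩ := (SimpleGraph.map_adj _ _ _ _).1 hxy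
      obtain ⟨W, g, e, w₀, he, hw₀, hg, hW⟩ := exists_extension (f₁.trans f) v fun a => hv _
      obtain ⟨H, g1, g2, g3, g4⟩ := ih₁ g w₀ hg hW x₁ y₁ hxy₁
      have g5 := IsSeriesParallel.series _ _ _ _ _ _ e (f₂.trans f) g4 h₂
        (extension_cover hcover he hw₀ hcov) (fun w c => by
          refine (extension_eq_iff he hw₀ hv hW w (f₂ c)).trans ⟨?_, ?_⟩
          · rintro ⟨a, rfl, h⟩
            obtain ⟨rfl, rfl⟩ := (hglue _ _).1 h
            exact ⟨rfl, rfl⟩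
          · rintro ⟨rfl, rfl⟩
            exact ⟨t₁, rfl, (hglue _ _).2 ⟨rfl, rfl⟩⟩)
      rw [he] at g5
      refine ⟨_, extension_map_le he g1, ?_, ?_, g5⟩
      · exact Or.inl ((SimpleGraph.map_adj _ _ _ _).2 ⟨_, _, g2, hw₀, he _⟩)
      · exact Or.inl ((SimpleGraph.map_adj _ _ _ _).2 ⟨_, _, g3, hw₀, he _⟩)
    · obtain ⟨x₁, y₁, hxy₁, rfl, rfl⟩ := (SimpleGraph.map_adj _ _ _ _).1 hxy
      obtain ⟨W, g, e, w₀, he, hw₀, hg, hW⟩ := exists_extension (f₂.trans f) v fun a => hv _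
      obtain ⟨H, g1, g2, g3, g4⟩ := ih₂ g w₀ hg hW x₁ y₁ hxy₁
      have g5 := IsSeriesParallel.series _ _ _ _ _ _ (f₁.trans f) e h₁ g4
        (by rw [Set.union_comm]; exact extension_cover (by rwa [Set.union_comm]) he hw₀ hcov)
        (fun c w => by
          refine eq_comm.trans ((extension_eq_iff he hw₀ hv hW w (f₁ c)).trans ⟨?_, ?_⟩)
          · rintro ⟨a, rfl, h⟩
            obtain ⟨rfl, rfl⟩ := (hglue _ _).1 h.symm
            exact ⟨rfl, rfl⟩
          · rintro ⟨rfl, rfl⟩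
            exact ⟨b₂, rfl, ((hglue _ _).2 ⟨rfl, rfl⟩).symm⟩)
      rw [he] at g5
      refine ⟨_, ?_, ?_, ?_, g5⟩
      · rw [sup_comm, sup_comm (SimpleGraph.map (f₁.trans f) G₁)]
        exact extension_map_le he g1
      · exact Or.inr ((SimpleGraph.map_adj _ _ _ _).2 ⟨_, _, g2, hw₀, he _⟩)
      · exact Or.inr ((SimpleGraph.map_adj _ _ _ _).2 ⟨_, _, g3, hw₀, he _⟩)
  | @parallel V₁ V₂ V' G₁ G₂ t₁ b₁ t₂ b₂ f₁ f₂ h₁ h₂ hcover hglue ih₁ ih₂ =>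
    intro V f v hv hcov x y hxy
    rcases hxy with hxy | hxy
    · obtain ⟨x₁, y₁, hxy₁, rfl, rfl⟩ := (SimpleGraph.map_adj _ _ _ _).1 hxy
      obtain ⟨W, g, e, w₀, he, hw₀, hg, hW⟩ := exists_extension (f₁.trans f) v fun a => hv _
      obtain ⟨H, g1, g2, g3, g4⟩ := ih₁ g w₀ hg hW x₁ y₁ hxy₁
      have g5 := IsSeriesParallel.parallel _ _ _ _ _ _ e (f₂.trans f) g4 h₂
        (extension_cover hcover he hw₀ hcov) (fun w c => by
          refine (extension_eq_iff he hw₀ hv hW w (f₂ c)).trans ⟨?_, ?_⟩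
          · rintro ⟨a, rfl, h⟩
            rcases (hglue _ _).1 h with ⟨rfl, rfl⟩ | ⟨rfl, rfl⟩
            · exact Or.inl ⟨rfl, rfl⟩
            · exact Or.inr ⟨rfl, rfl⟩
          · rintro (⟨rfl, rfl⟩ | ⟨rfl, rfl⟩)
            · exact ⟨t₁, rfl, (hglue _ _).2 (Or.inl ⟨rfl, rfl⟩)⟩
            · exact ⟨b₁, rfl, (hglue _ _).2 (Or.inr ⟨rfl, rfl⟩)⟩)
      rw [he, he] at g5
      refine ⟨_, extension_map_le he g1, ?_, ?_, g5⟩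
      · exact Or.inl ((SimpleGraph.map_adj _ _ _ _).2 ⟨_, _, g2, hw₀, he _⟩)
      · exact Or.inl ((SimpleGraph.map_adj _ _ _ _).2 ⟨_, _, g3, hw₀, he _⟩)
    · obtain ⟨x₁, y₁, hxy₁, rfl, rfl⟩ := (SimpleGraph.map_adj _ _ _ _).1 hxy
      obtain ⟨W, g, e, w₀, he, hw₀, hg, hW⟩ := exists_extension (f₂.trans f) v fun a => hv _
      obtain ⟨H, g1, g2, g3, g4⟩ := ih₂ g w₀ hg hW x₁ y₁ hxy₁
      have g5 := IsSeriesParallel.parallel _ _ _ _ _ _ (f₁.trans f) e h₁ g4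
        (by rw [Set.union_comm]; exact extension_cover (by rwa [Set.union_comm]) he hw₀ hcov)
        (fun c w => by
          refine eq_comm.trans ((extension_eq_iff he hw₀ hv hW w (f₁ c)).trans ⟨?_, ?_⟩)
          · rintro ⟨a, rfl, h⟩
            rcases (hglue _ _).1 h.symm with ⟨rfl, rfl⟩ | ⟨rfl, rfl⟩
            · exact Or.inl ⟨rfl, rfl⟩
            · exact Or.inr ⟨rfl, rfl⟩
          · rintro (⟨rfl, rfl⟩ | ⟨rfl, rfl⟩)
            · exact ⟨t₂, rfl, ((hglue _ _).2 (Or.inl ⟨rfl, rfl⟩)).symm⟩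
            · exact ⟨b₂, rfl, ((hglue _ _).2 (Or.inr ⟨rfl, rfl⟩)).symm⟩)
      refine ⟨_, ?_, ?_, ?_, g5⟩
      · rw [sup_comm, sup_comm (SimpleGraph.map (f₁.trans f) G₁)]
        exact extension_map_le he g1
      · exact Or.inr ((SimpleGraph.map_adj _ _ _ _).2 ⟨_, _, g2, hw₀, he _⟩)
      · exact Or.inr ((SimpleGraph.map_adj _ _ _ _).2 ⟨_, _, g3, hw₀, he _⟩)

/-! ### Elimination of a vertex of degree at most two -/

/-- The graph obtained by deleting `v` and joining its neighbours to each other. -/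
def eliminate {V : Type*} (G : SimpleGraph V) (v : V) : SimpleGraph {w // w ≠ v} where
  Adj a c := a ≠ c ∧ (G.Adj a c ∨ G.Adj v a ∧ G.Adj v c)
  symm := ⟨fun _ _ h => ⟨h.1.symm, h.2.imp SimpleGraph.Adj.symm And.symm⟩⟩
  loopless := ⟨fun _ h => h.1 rfl⟩

theorem isMinorOf_of_eliminate {W V : Type*} {H : SimpleGraph W} {G : SimpleGraph V} {v x y : V}
    (hv : ∀ z, G.Adj v z → z = x ∨ z = y) (h : IsMinorOf H (eliminate G v)) : IsMinorOf H G := by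
  obtain ⟨B, hconn, hdisj, hadj⟩ := h
  -- The vertex `v` is contracted into `x`: it joins the branch set containing `x`, if there is one
  -- and `x` is a neighbour. An edge created by the elimination has `x` as an end and becomes a path
  -- through `v`.
  let S : W → Set V := fun w => {z | (∃ a ∈ B w, a.1 = z) ∨ z = v ∧ G.Adj v x ∧ ∃ a ∈ B w, a.1 = x}
  have hval : ∀ w, ∀ a ∈ B w, a.1 ∈ S w := fun w a ha => Or.inl ⟨a, ha, rfl⟩
  have hpair : ∀ a c : {w // w ≠ v}, a ≠ c → G.Adj v a → G.Adj v c → a.1 = x ∨ c.1 = x := by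
    intro a c hac ha hc
    rcases hv _ ha with h | h
    · exact Or.inl h
    · rcases hv _ hc with h' | h'
      · exact Or.inr h'
      · exact absurd (Subtype.ext (h.trans h'.symm)) hac
  refine ⟨S, fun w => ?_, fun w w' hw => ?_, fun w w' hw => ?_⟩
  · have hstep : ∀ a c (ha : a ∈ B w) (hc : c ∈ B w), (eliminate G v).Adj a c →
        (G.induce (S w)).Reachable ⟨a.1, hval w a ha⟩ ⟨c.1, hval w c hc⟩ := by
      intro a c ha hc hac
      rcases hac.2 with h | ⟨h1, h2⟩
      · exact SimpleGraph.Adj.reachable h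
      · have hvS : v ∈ S w := by
          rcases hpair a c hac.1 h1 h2 with h | h
          · exact Or.inr ⟨rfl, h ▸ h1, a, ha, h⟩
          · exact Or.inr ⟨rfl, h ▸ h2, c, hc, h⟩
        exact (SimpleGraph.Adj.reachable (G := G.induce (S w)) (u := ⟨a.1, hval w a ha⟩)
          (v := ⟨v, hvS⟩) h1.symm).trans (SimpleGraph.Adj.reachable h2)
    have hreach : ∀ a c : B w, (G.induce (S w)).Reachable ⟨a.1.1, hval w a.1 a.2⟩
        ⟨c.1.1, hval w c.1 c.2⟩ := by
      intro a c
      obtain ⟨p⟩ := (hconn w).preconnected a c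
      induction p with
      | nil => exact SimpleGraph.Reachable.refl _
      | cons h p ih => exact (hstep _ _ (Subtype.prop _) (Subtype.prop _) h).trans ih
    obtain ⟨a₀⟩ := (hconn w).nonempty
    have hto : ∀ z : S w, (G.induce (S w)).Reachable z ⟨a₀.1.1, hval w a₀.1 a₀.2⟩ := by
      rintro ⟨z, ⟨a, ha, rfl⟩ | ⟨rfl, hx, a, ha, rfl⟩⟩
      · exact hreach ⟨a, ha⟩ a₀
      · exact (SimpleGraph.Adj.reachable (G := G.induce (S w))
          (u := ⟨_, Or.inr ⟨rfl, hx, a, ha, rfl⟩⟩) (v := ⟨a.1, hval w a ha⟩) hx).trans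
          (hreach ⟨a, ha⟩ a₀)
    have : Nonempty (S w) := ⟨⟨a₀.1.1, hval w a₀.1 a₀.2⟩⟩
    exact ⟨fun z z' => (hto z).trans (hto z').symm⟩
  · rw [Set.disjoint_left]
    rintro z (⟨a, ha, rfl⟩ | ⟨rfl, -, a, ha, hax⟩) (⟨c, hc, hca⟩ | ⟨hz, -, c, hc, hcx⟩)
    · rw [Subtype.ext hca] at hc
      exact Set.disjoint_left.1 (hdisj w w' hw) ha hc
    · exact a.2 hz
    · exact c.2 hca
    · rw [Subtype.ext (hcx.trans hax.symm)] at hc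
      exact Set.disjoint_left.1 (hdisj w w' hw) ha hc
  · obtain ⟨a, ha, c, hc, hac⟩ := hadj w w' hw
    rcases hac.2 with h | ⟨h1, h2⟩
    · exact ⟨a, hval w a ha, c, hval w' c hc, h⟩
    · rcases hpair a c hac.1 h1 h2 with h | h
      · exact ⟨v, Or.inr ⟨rfl, h ▸ h1, a, ha, h⟩, c, hval w' c hc, h2⟩
      · exact ⟨a, hval w a ha, v, Or.inr ⟨rfl, h ▸ h2, c, hc, h⟩, h1.symm⟩

/-- A graph without a `K₄` minor is a spanning subgraph of a series-parallel graph. -/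
theorem exists_seriesParallel_of_not_isMinorOf (n : ℕ) : ∀ {V : Type u} [Finite V],
    Nat.card V = n + 2 → ∀ G : SimpleGraph V, ¬ IsMinorOf (⊤ : SimpleGraph (Fin 4)) G →
    ∃ (H : SimpleGraph V) (t b : V), G ≤ H ∧ IsSeriesParallel H t b := by
  induction n with
  | zero =>
    intro V _ hcard G _
    obtain ⟨t, b, htb, huniv⟩ := Nat.card_eq_two_iff.1 hcard
    refine ⟨⊤, t, b, le_top, IsSeriesParallel.edge _ _ _ (fun v => ?_) htb⟩
    have : v ∈ ({t, b} : Set V) := huniv ▸ Set.mem_univ v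
    simpa using this
  | succ n ih =>
    intro V _ hcard G hG
    have : Nonempty V := (Nat.card_pos_iff.1 (by omega)).1
    obtain ⟨v, x, y, hv⟩ : ∃ v x y : V, ∀ z, G.Adj v z → z = x ∨ z = y := by
      by_contra hcon
      push Not at hcon
      exact hG (isMinorOf_of_min_degree hcon)
    have hcard' : Nat.card {w // w ≠ v} = n + 2 := by
      have h1 := Set.ncard_compl_add_ncard ({v} : Set V)
      rw [Set.ncard_singleton] at h1
      have h2 : Nat.card {w // w ≠ v} = ({v}ᶜ : Set V).ncard := rfl
      omega
    obtain ⟨H', t, b, hle, hsp⟩ := ih hcard' (eliminate G v)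
      fun h => hG (isMinorOf_of_eliminate hv h)
    obtain ⟨x₀, y₀, hxy, hcov⟩ : ∃ x₀ y₀ : {w // w ≠ v}, H'.Adj x₀ y₀ ∧
        ∀ z, G.Adj v z → z = x₀ ∨ z = y₀ := by
      -- Two distinct neighbours are adjacent after elimination, hence in `H'`. Otherwise `v` has at
      -- most one neighbour, and any edge of `H'` at it, or at `t` if there is none, will do.
      by_cases h2 : x ≠ y ∧ G.Adj v x ∧ G.Adj v y
      · exact ⟨⟨x, h2.2.1.ne'⟩, ⟨y, h2.2.2.ne'⟩, hle ⟨fun h => h2.1 (congrArg Subtype.val h),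
          Or.inr h2.2⟩, hv⟩
      · obtain ⟨x₀, hx₀⟩ : ∃ x₀ : {w // w ≠ v}, ∀ z, G.Adj v z → z = x₀ := by
          by_cases hx : G.Adj v x
          · refine ⟨⟨x, hx.ne'⟩, fun z hz => ?_⟩
            rcases hv z hz with h | rfl
            · exact h
            · by_contra hcon
              exact h2 ⟨fun h => hcon h.symm, hx, hz⟩
          · by_cases hy : G.Adj v y
            · refine ⟨⟨y, hy.ne'⟩, fun z hz => ?_⟩
              rcases hv z hz with rfl | h
              · exact absurd hz hx
              · exact h
            · refine ⟨t, fun z hz => ?_⟩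
              rcases hv z hz with rfl | rfl
              · exact absurd hz hx
              · exact absurd hz hy
        obtain ⟨y₀, hy₀⟩ := hsp.exists_adj x₀
        exact ⟨x₀, y₀, hy₀, fun z hz => Or.inl (hx₀ z hz)⟩
    obtain ⟨H, h1, h2, h3, h4⟩ := hsp.attach (Function.Embedding.subtype _) v (fun a => a.2)
      (fun w => by
        by_cases h : w = v
        · exact Or.inl h
        · exact Or.inr ⟨⟨w, h⟩, rfl⟩) x₀ y₀ hxy
    refine ⟨H, _, _, ?_, h4⟩
    have hvadj : ∀ z, G.Adj v z → H.Adj v z := by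
      intro z hz
      rcases hcov z hz with rfl | rfl
      · exact h2
      · exact h3
    intro a c hac
    by_cases ha : a = v
    · subst ha; exact hvadj c hac
    · by_cases hc : c = v
      · subst hc; exact (hvadj a hac.symm).symm
      · refine h1 ((SimpleGraph.map_adj _ _ _ _).2 ⟨⟨a, ha⟩, ⟨c, hc⟩, hle ⟨?_, Or.inl hac⟩, rfl, rfl⟩)
        exact fun h => hac.ne (congrArg Subtype.val h)

/-! ### Multisets of rows as exponent vectors -/

namespace MarkovBasis

variable {σ : Type*}

theorem toInt_apply (u : σ →₀ ℕ) (x : σ) : toInt u x = (u x : ℤ) := rfl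

theorem posExp_apply (f : σ →₀ ℤ) (x : σ) : posExp f x = (f x).toNat := rfl

theorem toInt_add (u v : σ →₀ ℕ) : toInt (u + v) = toInt u + toInt v := by
  ext x; simp [toInt_apply]

theorem toInt_injective : Function.Injective (toInt (σ := σ)) := by
  intro u v h
  ext x
  have := DFunLike.congr_fun h x
  simpa [toInt_apply] using this

theorem toInt_posExp_sub_toInt_negExp (f : σ →₀ ℤ) : toInt (posExp f) - toInt (negExp f) = f := by
  ext x
  simp only [Finsupp.coe_sub, Pi.sub_apply, toInt_apply, negExp, posExp_apply, Finsupp.neg_apply]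
  omega

theorem posExp_sub_of_disjoint {a c : σ →₀ ℕ} (h : ∀ x, a x = 0 ∨ c x = 0) :
    posExp (toInt a - toInt c) = a := by
  ext x
  simp only [posExp_apply, Finsupp.coe_sub, Pi.sub_apply, toInt_apply]
  rcases h x with h | h <;> omega

theorem hasDegree_of_disjoint {a c : σ →₀ ℕ} (h : ∀ x, a x = 0 ∨ c x = 0) {n : ℕ}
    (ha : a.degree = n) (hc : c.degree = n) : HasDegree (toInt a - toInt c) n := by
  refine ⟨?_, ?_⟩
  · rw [posExp_sub_of_disjoint h, ha]
  · rw [negExp, neg_sub, posExp_sub_of_disjoint (fun x => (h x).symm), hc]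

end MarkovBasis

namespace BinaryTable

set_option linter.unusedSectionVars false

open MarkovBasis

section Rows

variable {ι σ : Type*}

/-- The multiplicity vector of a finite family. -/
noncomputable def counts (J : Finset ι) (r : ι → σ) : σ →₀ ℕ := ∑ i ∈ J, Finsupp.single (r i) 1

theorem counts_degree (J : Finset ι) (r : ι → σ) : (counts J r).degree = J.card := by
  rw [counts, map_sum]
  simp

theorem counts_ne_zero {J : Finset ι} {r : ι → σ} {x : σ} (h : counts J r x ≠ 0) :
    ∃ i ∈ J, r i = x := by
  classical
  rw [counts, Finsupp.finsetSum_apply] at h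
  obtain ⟨i, hi, hix⟩ := Finset.exists_ne_zero_of_sum_ne_zero h
  refine ⟨i, hi, ?_⟩
  by_contra hcon
  exact hix (Finsupp.single_eq_of_ne (Ne.symm hcon))

theorem counts_univ_comp_perm [Fintype ι] (r : ι → σ) (τ : Equiv.Perm ι) :
    counts Finset.univ (fun i => r (τ i)) = counts Finset.univ r :=
  Equiv.sum_comp τ fun i => Finsupp.single (r i) 1

theorem toInt_counts (J : Finset ι) (r : ι → σ) :
    toInt (counts J r) = ∑ i ∈ J, Finsupp.single (r i) (1 : ℤ) := by
  classical
  ext x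
  rw [toInt_apply, counts, Finsupp.finsetSum_apply, Finsupp.finsetSum_apply]
  push_cast
  refine Finset.sum_congr rfl fun i _ => ?_
  by_cases h : r i = x
  · subst h; simp
  · rw [Finsupp.single_eq_of_ne (Ne.symm h), Finsupp.single_eq_of_ne (Ne.symm h)]; rfl

theorem exists_counts_eq (n : ℕ) : ∀ u : σ →₀ ℕ, u.degree = n →
    ∃ r : Fin n → σ, counts Finset.univ r = u := by
  classical
  induction n with
  | zero =>
    intro u hu
    refine ⟨Fin.elim0, ?_⟩
    rw [Finsupp.degree_eq_zero_iff] at hu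
    simp [hu, counts]
  | succ n ih =>
    intro u hu
    obtain ⟨a, ha⟩ : ∃ a, u a ≠ 0 := by
      by_contra hcon
      push Not at hcon
      have : u = 0 := Finsupp.ext hcon
      rw [this] at hu
      simp at hu
    have hsplit : Finsupp.single a 1 + (u - Finsupp.single a 1) = u := by
      apply add_tsub_cancel_of_le
      intro x
      by_cases h : a = x
      · subst h; simpa using Nat.one_le_iff_ne_zero.2 ha
      · rw [Finsupp.single_eq_of_ne (Ne.symm h)]; exact Nat.zero_le _
    have hdeg : (u - Finsupp.single a 1).degree = n := by
      have := congrArg Finsupp.degree hsplit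
      rw [map_add, hu, Finsupp.degree_single] at this
      omega
    obtain ⟨r, hr⟩ := ih _ hdeg
    refine ⟨Fin.cons a r, ?_⟩
    rw [counts, Fin.sum_univ_succ]
    simp only [Fin.cons_zero, Fin.cons_succ]
    rw [← counts, hr, hsplit]

theorem sum_single_eq_iff [Fintype ι] (f g : ι → σ) :
    ∑ i, Finsupp.single (f i) (1 : ℤ) = ∑ i, Finsupp.single (g i) (1 : ℤ) ↔
      ∃ τ : Equiv.Perm ι, ∀ i, f i = g (τ i) := by
  classical
  constructor
  · intro h
    refine exists_perm_of_count_eq f g fun a => ?_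
    have := DFunLike.congr_fun h a
    simpa [Finsupp.finsetSum_apply, Finsupp.single_apply] using this
  · rintro ⟨τ, hτ⟩
    simp only [hτ]
    exact Equiv.sum_comp τ fun i => Finsupp.single (g i) (1 : ℤ)

end Rows

/-! ### Margins of multiplicity vectors and fibers of the design map -/

section Fibers

open HierModel

variable {V : Type*}

theorem margin_counts {ι : Type*} (d : V → ℕ) (S : Finset V) (J : Finset ι) (r : ι → States d) :
    margin d S (toInt (counts J r)) = ∑ i ∈ J, Finsupp.single (S.restrict (r i)) (1 : ℤ) := by
  rw [toInt_counts, map_sum]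
  refine Finset.sum_congr rfl fun i _ => ?_
  simp [margin, Finsupp.mapDomain_single]

theorem exists_facet_of_mem [Finite V] {Γ : LowerSet (Finset V)} {F : Finset V} (hF : F ∈ Γ) :
    ∃ F' ∈ facets Γ, F ⊆ F' := by
  have hfin : (Γ : Set (Finset V)).Finite := Set.toFinite _
  obtain ⟨F', hle, hmax⟩ := hfin.exists_le_maximal hF
  exact ⟨F', by simpa [facets] using hmax, hle⟩

theorem mem_of_mem_facets [Finite V] {Γ : LowerSet (Finset V)} {F : Finset V} (hF : F ∈ facets Γ) :
    F ∈ Γ := by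
  have : Maximal (· ∈ Γ) F := by simpa [facets] using hF
  exact this.prop

theorem pair_mem_graphComplex [DecidableEq V] {G : SimpleGraph V} {x y : V}
    (h : x = y ∨ G.Adj x y) : ({x, y} : Finset V) ∈ graphComplex G := by
  refine ⟨Finset.card_le_two, ?_⟩
  intro a ha c hc hac
  simp only [Finset.coe_insert, Finset.coe_singleton, Set.mem_insert_iff,
    Set.mem_singleton_iff] at ha hc
  rcases h with rfl | h
  · rcases ha with rfl | rfl <;> rcases hc with rfl | rfl <;> exact absurd rfl hac
  · rcases ha with rfl | rfl <;> rcases hc with rfl | rfl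
    · exact absurd rfl hac
    · exact h
    · exact h.symm
    · exact absurd rfl hac

/-- The entries of any facet margin add up to the sample size. The hypothesis on the empty face
ensures that a facet exists. -/
theorem degree_eq_of_designMap_eq [Finite V] {Γ : LowerSet (Finset V)} (hΓ : ∅ ∈ Γ) {d : V → ℕ}
    {u v : States d →₀ ℕ} (h : designMap Γ d (toInt u) = designMap Γ d (toInt v)) :
    u.degree = v.degree := by
  obtain ⟨F, hF, -⟩ := exists_facet_of_mem hΓ
  have h1 : margin d F (toInt u) = margin d F (toInt v) := congrFun h ⟨F, hF⟩
  obtain ⟨r, hr⟩ := exists_counts_eq _ u rfl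
  obtain ⟨s, hs⟩ := exists_counts_eq _ v rfl
  rw [← hr, ← hs, margin_counts, margin_counts] at h1
  have h2 := congrArg (Finsupp.linearCombination ℤ fun _ => (1 : ℤ)) h1
  simpa using h2

theorem empty_mem_graphComplex (G : SimpleGraph V) : (∅ : Finset V) ∈ graphComplex G :=
  ⟨by simp, by simp⟩

theorem designMap_counts_eq_iff [Finite V] (G : SimpleGraph V) {ι : Type*} [Fintype ι]
    [DecidableEq ι] (r s : ι → V → Fin 2) :
    designMap (graphComplex G) (fun _ => 2) (toInt (counts Finset.univ r)) =
      designMap (graphComplex G) (fun _ => 2) (toInt (counts Finset.univ s)) ↔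
    SameFiber G r s := by
  classical
  constructor
  · intro h x y hxy
    obtain ⟨F, hF, hsub⟩ := exists_facet_of_mem (pair_mem_graphComplex hxy)
    have h1 : margin (fun _ => 2) F (toInt (counts Finset.univ r)) =
        margin (fun _ => 2) F (toInt (counts Finset.univ s)) := congrFun h ⟨F, hF⟩
    rw [margin_counts, margin_counts, sum_single_eq_iff] at h1
    obtain ⟨τ, hτ⟩ := h1
    exact ⟨τ, fun i => ⟨congrFun (hτ i) ⟨x, hsub (by simp)⟩, congrFun (hτ i) ⟨y, hsub (by simp)⟩⟩⟩
  · intro h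
    funext ⟨F, hF⟩
    change margin (fun _ => 2) F (toInt (counts Finset.univ r)) =
        margin (fun _ => 2) F (toInt (counts Finset.univ s))
    rw [margin_counts, margin_counts, sum_single_eq_iff]
    obtain ⟨hcard, hclique⟩ := mem_of_mem_facets hF
    have hpair : ∃ τ : Equiv.Perm ι, ∀ i, ∀ v ∈ F, r i v = s (τ i) v := by
      have : F.card = 0 ∨ F.card = 1 ∨ F.card = 2 := by omega
      rcases this with h0 | h1 | h2
      · rw [Finset.card_eq_zero] at h0
        exact ⟨1, by simp [h0]⟩
      · obtain ⟨x, rfl⟩ := Finset.card_eq_one.1 h1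
        obtain ⟨τ, hτ⟩ := h x x (Or.inl rfl)
        exact ⟨τ, fun i v hv => by rw [Finset.mem_singleton.1 hv]; exact (hτ i).1⟩
      · obtain ⟨x, y, hxy, rfl⟩ := Finset.card_eq_two.1 h2
        obtain ⟨τ, hτ⟩ := h x y (Or.inr (hclique (by simp) (by simp) hxy))
        refine ⟨τ, fun i v hv => ?_⟩
        rcases Finset.mem_insert.1 hv with rfl | hv
        · exact (hτ i).1
        · rw [Finset.mem_singleton.1 hv]; exact (hτ i).2
    obtain ⟨τ, hτ⟩ := hpair
    exact ⟨τ, fun i => funext fun v => hτ i v.1 v.2⟩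

end Fibers

/-! ### Chains of moves and the Markov basis -/

section Chains

variable {ι : Type*} [Fintype ι] [DecidableEq ι] {V : Type*}

/-- A small move that is constant on `{b, t}`, or a two-row move. -/
def Link (G : SimpleGraph V) (b t : V) (r s : ι → V → Fin 2) : Prop :=
  SameFiber G r s ∧ ((ColEq r s b t ∧ SmallMove r s) ∨ ∃ i j, i ≠ j ∧ ∀ k, k ≠ i → k ≠ j → r k = s k)

theorem Conn.link {G : SimpleGraph V} {b t : V} {r s : ι → V → Fin 2} (h : Conn G b t r s) :
    Relation.ReflTransGen (Link G b t) r s := by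
  induction h with
  | refl => exact Relation.ReflTransGen.refl
  | tail _ h ih => exact ih.tail ⟨h.1, Or.inl h.2⟩

theorem Link.symm {G : SimpleGraph V} {b t : V} {r s : ι → V → Fin 2} (h : Link G b t r s) :
    Link G b t s r := by
  refine ⟨h.1.symm, h.2.imp (fun h => ⟨h.1.symm, h.2.symm⟩) ?_⟩
  rintro ⟨i, j, hij, h⟩
  exact ⟨i, j, hij, fun k h1 h2 => (h k h1 h2).symm⟩

/-- Climb one level at a time with the two-row moves from `up`, travelling inside each level with
`conn`. -/
theorem WellConnected.link {G : SimpleGraph V} {b t : V} (h : WellConnected ι G b t)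
    {r s : ι → V → Fin 2} (hrs : SameFiber G r s) : Relation.ReflTransGen (Link G b t) r s := by
  have key : ∀ n : ℕ, ∀ r s : ι → V → Fin 2, SameFiber G r s → level s b t = level r b t + n →
      Relation.ReflTransGen (Link G b t) r s := by
    intro n
    induction n with
    | zero =>
      intro r s hrs hl
      exact (h.conn r s hrs (hrs.colEq_of_level (by simpa using hl.symm))).link
    | succ n ih =>
      intro r s hrs hl
      push_cast at hl
      obtain ⟨r', s', h1, h2, h3, h4, h5⟩ := h.up r s hrs (by omega)
      have c1 := (h.conn r r' h1 (h1.colEq_of_level h3.symm)).link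
      exact (c1.tail ⟨h1.symm.trans h2, Or.inr h5⟩).trans
        (ih s' s (h2.symm.trans hrs) (by omega))
  rcases le_total (level r b t) (level s b t) with hle | hle
  · exact key (level s b t - level r b t).toNat r s hrs (by omega)
  · have := key (level r b t - level s b t).toNat s r hrs.symm (by omega)
    clear hle hrs
    induction this with
    | refl => exact Relation.ReflTransGen.refl
    | tail _ h ih => exact Relation.ReflTransGen.head h.symm ih

end Chains

/-! ### The Markov basis of quadratic and quartic moves -/

section Moves

open HierModel

variable {V : Type*} [Finite V] [DecidableEq V]

/-- All moves of degree two, and all moves of degree four that are constant on `{b, t}`. -/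
def moves (G : SimpleGraph V) (t b : V) : Set (States (fun _ : V => 2) →₀ ℤ) :=
  {f | f ∈ LinearMap.ker (designMap (graphComplex G) fun _ => 2) ∧
    ((HasDegree f 4 ∧ IsConstantOn {b, t} f) ∨ HasDegree f 2)}

theorem moves_finite (G : SimpleGraph V) (t b : V) : (moves G t b).Finite := by
  classical
  have : Fintype V := Fintype.ofFinite V
  -- Both parts of a move in the set have degree at most four, so every coordinate is at most four.
  let c : States (fun _ : V => 2) →₀ ℕ := Finsupp.equivFunOnFinite.symm fun _ => 4
  have hle : ∀ u : States (fun _ : V => 2) →₀ ℕ, u.degree ≤ 4 → u ≤ c := by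
    intro u hu x
    exact (Finsupp.le_degree x u).trans hu
  refine ((Set.finite_Iic c).prod (Set.finite_Iic c)).image
    (fun p => toInt p.1 - toInt p.2) |>.subset ?_
  rintro f ⟨-, hf⟩
  refine ⟨(posExp f, negExp f), ⟨hle _ ?_, hle _ ?_⟩, toInt_posExp_sub_toInt_negExp f⟩
  · rcases hf with hf | hf
    · exact hf.1.1.le
    · rw [hf.1]; norm_num
  · rcases hf with hf | hf
    · exact hf.1.2.le
    · rw [hf.2]; norm_num

theorem counts_split {ι : Type*} [Fintype ι] [DecidableEq ι] {J : Finset ι} {r s : ι → V → Fin 2}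
    (h : ∀ i ∉ J, r i = s i) :
    toInt (counts Finset.univ r) - toInt (counts Finset.univ s) =
      toInt (counts J r) - toInt (counts J s) := by
  have hsplit : ∀ r : ι → V → Fin 2, counts Finset.univ r = counts J r + counts Jᶜ r :=
    fun r => (Finset.sum_add_sum_compl J _).symm
  have hc : counts Jᶜ r = counts Jᶜ s :=
    Finset.sum_congr rfl fun i hi => by rw [h i (by simpa using hi)]
  rw [hsplit r, hsplit s, toInt_add, toInt_add, hc]
  abel

theorem hasDegree_sub_of_disjoint_rows {ι : Type*} [Fintype ι] [DecidableEq ι] {J : Finset ι}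
    {r s : ι → V → Fin 2} (h : ∀ i ∉ J, r i = s i) (hd : ∀ i ∈ J, ∀ j ∈ J, r i ≠ s j) :
    HasDegree (toInt (counts Finset.univ r) - toInt (counts Finset.univ s)) J.card := by
  rw [counts_split h]
  refine hasDegree_of_disjoint (fun x => ?_) (counts_degree J r) (counts_degree J s)
  by_contra hcon
  push Not at hcon
  obtain ⟨i, hi, hix⟩ := counts_ne_zero hcon.1
  obtain ⟨j, hj, hjx⟩ := counts_ne_zero hcon.2
  exact hd i hi j hj (hix.trans hjx.symm)

/-- If one row is common to the two pairs, the column sums force the remaining rows to coincide as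
well. So cancellation is total or absent. -/
theorem counts_eq_or_hasDegree_two {G : SimpleGraph V} {ι : Type*} [Fintype ι] [DecidableEq ι]
    {r s : ι → V → Fin 2} (hrs : SameFiber G r s) {i j : ι} (hij : i ≠ j)
    (h : ∀ k, k ≠ i → k ≠ j → r k = s k) :
    counts Finset.univ r = counts Finset.univ s ∨
      HasDegree (toInt (counts Finset.univ r) - toInt (counts Finset.univ s)) 2 := by
  have hsum : ∀ v, bit (r i v) + bit (r j v) = bit (s i v) + bit (s j v) := by
    intro v
    have h1 := sum_eq_off_pair hij h (fun w => bit (w v))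
    have h2 := hrs.colSum_eq v
    simp only [colSum] at h2
    linarith
  have hoff : ∀ k ∉ ({i, j} : Finset ι), r k = s k := by
    intro k hk
    simp only [Finset.mem_insert, Finset.mem_singleton, not_or] at hk
    exact h k hk.1 hk.2
  by_cases hd : ∀ k ∈ ({i, j} : Finset ι), ∀ l ∈ ({i, j} : Finset ι), r k ≠ s l
  · right
    have := hasDegree_sub_of_disjoint_rows hoff hd
    rwa [Finset.card_pair hij] at this
  · left
    have hcount : ∀ r : ι → V → Fin 2, counts ({i, j} : Finset ι) r =
        Finsupp.single (r i) 1 + Finsupp.single (r j) 1 := fun r => Finset.sum_pair hij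
    have key : counts ({i, j} : Finset ι) r = counts ({i, j} : Finset ι) s := by
      rw [hcount, hcount]
      have hor : (r i = s i ∧ r j = s j) ∨ (r i = s j ∧ r j = s i) := by
        push Not at hd
        obtain ⟨k, hk, l, hl, hkl⟩ := hd
        simp only [Finset.mem_insert, Finset.mem_singleton] at hk hl
        rcases hk with rfl | rfl <;> rcases hl with rfl | rfl
        · exact Or.inl ⟨hkl, funext fun v => bit_injective (by have := hsum v; rw [hkl] at this; linarith)⟩
        · exact Or.inr ⟨hkl, funext fun v => bit_injective (by have := hsum v; rw [hkl] at this; linarith)⟩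
        · exact Or.inr ⟨funext fun v => bit_injective (by have := hsum v; rw [hkl] at this; linarith), hkl⟩
        · exact Or.inl ⟨funext fun v => bit_injective (by have := hsum v; rw [hkl] at this; linarith), hkl⟩
      rcases hor with ⟨h1, h2⟩ | ⟨h1, h2⟩
      · rw [h1, h2]
      · rw [h1, h2, add_comm]
    have h0 := counts_split hoff
    rw [key, sub_self, sub_eq_zero] at h0
    exact toInt_injective h0

theorem counts_eq_or_mem_moves {G : SimpleGraph V} {t b : V} {ι : Type*} [Fintype ι] [DecidableEq ι]
    {r s : ι → V → Fin 2} (h : Link G t b r s) :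
    counts Finset.univ r = counts Finset.univ s ∨
      toInt (counts Finset.univ r) - toInt (counts Finset.univ s) ∈ moves G t b := by
  obtain ⟨hfib, hmove⟩ := h
  have hker : toInt (counts Finset.univ r) - toInt (counts Finset.univ s) ∈
      LinearMap.ker (designMap (graphComplex G) fun _ : V => 2) := by
    rw [LinearMap.mem_ker, map_sub, sub_eq_zero]
    exact (designMap_counts_eq_iff G r s).2 hfib
  have two : ∀ i j : ι, i ≠ j → (∀ k, k ≠ i → k ≠ j → r k = s k) → _ := fun i j hij hoff =>
    (counts_eq_or_hasDegree_two hfib hij hoff).imp_right fun h =>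
      (⟨hker, Or.inr h⟩ : toInt (counts Finset.univ r) - toInt (counts Finset.univ s) ∈ moves G t b)
  rcases hmove with ⟨hcol, ⟨τ, hτ⟩ | ⟨J, hJ, hoff⟩ | ⟨J, hJ, hoff, hne⟩⟩ | ⟨i, j, hij, hoff⟩
  · left
    rw [show s = fun i => r (τ i) from funext hτ, counts_univ_comp_perm]
  · obtain ⟨i, j, hij, rfl⟩ := Finset.card_eq_two.1 hJ
    exact two i j hij fun k h1 h2 => hoff k (by simp [h1, h2])
  · right
    refine ⟨hker, Or.inl ⟨?_, ?_⟩⟩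
    · rw [← hJ]
      exact hasDegree_sub_of_disjoint_rows hoff hne
    · rw [IsConstantOn, map_sub, sub_eq_zero, margin_counts, margin_counts, sum_single_eq_iff]
      obtain ⟨τ, hτ⟩ := hcol
      refine ⟨τ, fun i => funext fun v => ?_⟩
      have hv := v.2
      simp only [Finset.mem_insert, Finset.mem_singleton] at hv
      change r i v.1 = s (τ i) v.1
      rcases hv with h | h
      · rw [h]; exact (hτ i).2
      · rw [h]; exact (hτ i).1
  · exact two i j hij hoff

theorem isMarkovBasis_moves {G : SimpleGraph V} {t b : V}
    (h : ∀ n : ℕ, WellConnected (Fin n) G t b) :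
    IsMarkovBasis (designMap (graphComplex G) fun _ => 2) (moves G t b) := by
  refine ⟨moves_finite G t b, fun f hf => hf.1, fun u => ?_⟩
  have : Nonempty {v : States (fun _ : V => 2) →₀ ℕ //
      designMap (graphComplex G) (fun _ => 2) (toInt v) =
        designMap (graphComplex G) (fun _ => 2) (toInt u)} := ⟨⟨u, rfl⟩⟩
  refine ⟨fun x y => ?_⟩
  obtain ⟨v, hv⟩ := x
  obtain ⟨w, hw⟩ := y
  have hdeg : w.degree = v.degree :=
    degree_eq_of_designMap_eq (empty_mem_graphComplex G) (hw.trans hv.symm)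
  obtain ⟨n, hn⟩ : ∃ n, v.degree = n := ⟨_, rfl⟩
  obtain ⟨r, rfl⟩ := exists_counts_eq n v hn
  obtain ⟨s, rfl⟩ := exists_counts_eq n w (hdeg.trans hn)
  have hlink := (h _).link ((designMap_counts_eq_iff G r s).1 (hv.trans hw.symm))
  suffices ∀ s' : Fin n → V → Fin 2,
      Relation.ReflTransGen (Link G t b) r s' → ∀ hs',
      (fiberGraph (designMap (graphComplex G) fun _ => 2) (moves G t b)
        (designMap (graphComplex G) (fun _ => 2) (toInt u))).Reachable
        ⟨counts Finset.univ r, hv⟩ ⟨counts Finset.univ s', hs'⟩ from this s hlink hw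
  intro s' hs'
  induction hs' with
  | refl => exact fun _ => SimpleGraph.Reachable.refl _
  | @tail m k _ hstep ih =>
    intro hk
    have hm := ((designMap_counts_eq_iff G m k).2 hstep.1).trans hk
    refine (ih hm).trans ?_
    rcases counts_eq_or_mem_moves hstep with heq | hmem
    · have : (⟨counts Finset.univ m, hm⟩ : {v : States (fun _ : V => 2) →₀ ℕ //
          designMap (graphComplex G) (fun _ => 2) (toInt v) =
          designMap (graphComplex G) (fun _ => 2) (toInt u)}) = ⟨counts Finset.univ k, hk⟩ :=
        Subtype.ext heq
      rw [this]
    · by_cases heq : counts Finset.univ m = counts Finset.univ k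
      · have : (⟨counts Finset.univ m, hm⟩ : {v : States (fun _ : V => 2) →₀ ℕ //
            designMap (graphComplex G) (fun _ => 2) (toInt v) =
            designMap (graphComplex G) (fun _ => 2) (toInt u)}) = ⟨counts Finset.univ k, hk⟩ :=
          Subtype.ext heq
        rw [this]
      · refine SimpleGraph.Adj.reachable ?_
        rw [fiberGraph, SimpleGraph.fromRel_adj]
        exact ⟨fun h => heq (congrArg Subtype.val h), Or.inl hmem⟩

end Moves

end BinaryTable

/-! ### The kernel on a pair of vertices -/

namespace BinaryTable

set_option linter.unusedSectionVars false

open MarkovBasis HierModel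

section PairKernel

variable {V : Type*} [Finite V]

/-- A face lies in a facet, so any projection that depends only on the face factors through a facet
margin. -/
theorem mapDomain_restrict_eq_zero {Γ : LowerSet (Finset V)} {d : V → ℕ} {f : States d →₀ ℤ}
    (hf : f ∈ LinearMap.ker (designMap Γ d)) {F : Finset V} (hF : F ∈ Γ) {τ : Type*}
    (φ : States (fun v : F => d v) → τ) : Finsupp.mapDomain (fun i => φ (F.restrict i)) f = 0 := by
  obtain ⟨F', hF', hsub⟩ := exists_facet_of_mem hF
  have h1 : Finsupp.mapDomain F'.restrict f = 0 := congrFun (LinearMap.mem_ker.1 hf) ⟨F', hF'⟩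
  have h2 := congrArg
    (Finsupp.mapDomain fun j : States (fun v : F' => d v) => φ fun v : F => j ⟨v.1, hsub v.2⟩) h1
  rw [← Finsupp.mapDomain_comp, Finsupp.mapDomain_zero] at h2
  exact h2

theorem margin_mem_ker_inducedComplex {Γ : LowerSet (Finset V)} {d : V → ℕ} {f : States d →₀ ℤ}
    (hf : f ∈ LinearMap.ker (designMap Γ d)) (S : Finset V) :
    margin d S f ∈ LinearMap.ker (designMap (inducedComplex Γ S) fun v : S => d v) := by
  rw [LinearMap.mem_ker]
  funext ⟨F, hF⟩
  change Finsupp.mapDomain F.restrict (Finsupp.mapDomain S.restrict f) = 0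
  rw [← Finsupp.mapDomain_comp]
  have hmem : F.map (Function.Embedding.subtype _) ∈ Γ :=
    mem_of_mem_facets (Γ := inducedComplex Γ S) hF
  exact mapDomain_restrict_eq_zero hf hmem fun j => fun v : F =>
    j ⟨v.1.1, Finset.mem_map_of_mem (Function.Embedding.subtype _) v.2⟩

theorem ker_designMap_inducedComplex_of_mem {Γ : LowerSet (Finset V)} {d : V → ℕ} {S : Finset V}
    (hS : S ∈ Γ) : LinearMap.ker (designMap (inducedComplex Γ S) fun v : S => d v) = ⊥ := by
  classical
  rw [eq_bot_iff]
  intro g hg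
  have huniv : (Finset.univ : Finset S) ∈ inducedComplex Γ S := by
    change Finset.univ.map (Function.Embedding.subtype _) ∈ Γ
    convert hS
    ext x
    simp
  have := mapDomain_restrict_eq_zero hg huniv
    (fun j => fun v : S => j ⟨v, Finset.mem_univ v⟩)
  exact (Submodule.mem_bot ℤ).2 (Finsupp.mapDomain_id.symm.trans this)

variable [DecidableEq V]

/-- The state of the pair `{b, t}` with value `p` at `b` and `q` at `t`. -/
def pairState (b t : V) (p q : Fin 2) : States (fun _ : ({b, t} : Finset V) => 2) :=
  fun v => if v.1 = b then p else q

/-- The generator `e₀₀ + e₁₁ - e₀₁ - e₁₀` of the kernel of two isolated vertices. -/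
noncomputable def pairMove (b t : V) : States (fun _ : ({b, t} : Finset V) => 2) →₀ ℤ :=
  Finsupp.single (pairState b t 0 0) 1 + Finsupp.single (pairState b t 1 1) 1 -
    Finsupp.single (pairState b t 0 1) 1 - Finsupp.single (pairState b t 1 0) 1

theorem eq_pairState {b t : V} (j : States (fun _ : ({b, t} : Finset V) => 2)) :
    j = pairState b t (j ⟨b, by simp⟩) (j ⟨t, by simp⟩) := by
  funext ⟨v, hv⟩
  rw [pairState]
  split_ifs with h
  · change v = b at h
    subst h; rfl
  · change ¬ v = b at h
    have : v = t := by simpa [h] using hv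
    subst this; rfl

theorem pairState_inj {b t : V} (hbt : b ≠ t) {p q p' q' : Fin 2} :
    pairState b t p q = pairState b t p' q' ↔ p = p' ∧ q = q' := by
  constructor
  · intro h
    have h1 := congrFun h ⟨b, by simp⟩
    have h2 := congrFun h ⟨t, by simp⟩
    simp only [pairState, if_true, if_neg hbt.symm] at h1 h2
    exact ⟨h1, h2⟩
  · rintro ⟨rfl, rfl⟩; rfl

/-- Without the edge the kernel is cut out by the two vertex margins, which determine the four
entries from the one at 00. Conversely, a face misses one of the two vertices, and the four terms of
`pairMove` then cancel in pairs. -/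
theorem generatesKernelOn_pairMove {G : SimpleGraph V} {b t : V} (hbt : b ≠ t)
    (hadj : ¬ G.Adj b t) :
    GeneratesKernelOn (graphComplex G) (fun _ => 2) {b, t} (pairMove b t) := by
  apply le_antisymm
  · intro g hg
    have hsingle : ∀ v : ({b, t} : Finset V),
        Finsupp.mapDomain (fun j : States (fun _ : ({b, t} : Finset V) => 2) => j v) g = 0 := by
      intro v
      have hv : ({v} : Finset ({b, t} : Finset V)) ∈ inducedComplex (graphComplex G) {b, t} := by
        change Finset.map _ {v} ∈ graphComplex G
        rw [Finset.map_singleton]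
        exact ⟨by simp, by simp⟩
      exact mapDomain_restrict_eq_zero hg hv fun j => j ⟨v, by simp⟩
    have hdecomp : g = Finsupp.single (pairState b t 0 0) (g (pairState b t 0 0)) +
        Finsupp.single (pairState b t 0 1) (g (pairState b t 0 1)) +
        Finsupp.single (pairState b t 1 0) (g (pairState b t 1 0)) +
        Finsupp.single (pairState b t 1 1) (g (pairState b t 1 1)) := by
      ext j
      rw [eq_pairState j]
      generalize j ⟨b, by simp⟩ = p
      generalize j ⟨t, by simp⟩ = q
      fin_cases p <;> fin_cases q <;> simp [pairState_inj hbt]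
    have hb := hsingle ⟨b, by simp⟩
    have ht := hsingle ⟨t, by simp⟩
    rw [hdecomp] at hb ht
    have eb : ∀ p q, pairState b t p q ⟨b, by simp⟩ = p := fun p q => by simp [pairState]
    have et : ∀ p q, pairState b t p q ⟨t, by simp⟩ = q := fun p q => by
      simp [pairState, hbt.symm]
    simp only [Finsupp.mapDomain_add, Finsupp.mapDomain_single, eb, et] at hb ht
    have b0 := DFunLike.congr_fun hb 0
    have t0 := DFunLike.congr_fun ht 0
    have t1 := DFunLike.congr_fun ht 1
    simp at b0 t0 t1
    rw [Submodule.mem_span_singleton]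
    refine ⟨g (pairState b t 0 0), ?_⟩
    ext j
    rw [eq_pairState j]
    generalize j ⟨b, by simp⟩ = p
    generalize j ⟨t, by simp⟩ = q
    fin_cases p <;> fin_cases q <;>
      simp [pairMove, pairState_inj hbt] <;> omega
  · rw [Submodule.span_singleton_le_iff_mem, LinearMap.mem_ker]
    funext ⟨F, hF⟩
    change Finsupp.mapDomain F.restrict (pairMove b t) = 0
    have hmem : F.map (Function.Embedding.subtype _) ∈ graphComplex G :=
      mem_of_mem_facets (Γ := inducedComplex (graphComplex G) {b, t}) hF
    have hcase : (⟨b, by simp⟩ : ({b, t} : Finset V)) ∉ F ∨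
        (⟨t, by simp⟩ : ({b, t} : Finset V)) ∉ F := by
      by_contra hcon
      push Not at hcon
      refine hadj (hmem.2 ?_ ?_ hbt)
      · exact Finset.mem_coe.2 (Finset.mem_map_of_mem (Function.Embedding.subtype _) hcon.1)
      · exact Finset.mem_coe.2 (Finset.mem_map_of_mem (Function.Embedding.subtype _) hcon.2)
    simp only [pairMove, sub_eq_add_neg, ← Finsupp.single_neg, Finsupp.mapDomain_add,
      Finsupp.mapDomain_single]
    rcases hcase with hc | hc
    · have : ∀ p p' q, F.restrict (pairState b t p q) = F.restrict (pairState b t p' q) := by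
        intro p p' q
        funext ⟨v, hv⟩
        have hvb : v.1 ≠ b := fun h => hc (by convert hv; exact h.symm)
        simp [Finset.restrict, pairState, hvb]
      rw [this 1 0 1, this 1 0 0]
      simp only [Finsupp.single_neg]
      abel
    · have : ∀ p q q', F.restrict (pairState b t p q) = F.restrict (pairState b t p q') := by
        intro p q q'
        funext ⟨v, hv⟩
        have hvt : v.1 ≠ t := fun h => hc (by convert hv; exact h.symm)
        have hvb : v.1 = b := by
          have := v.2
          simp only [Finset.mem_insert, Finset.mem_singleton] at this
          exact this.resolve_right hvt
        simp [Finset.restrict, pairState, hvb]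
      rw [this 1 1 0, this 0 1 0]
      simp only [Finsupp.single_neg]
      abel

theorem margin_apply_add_apply_le {u : States (fun _ : V => 2) →₀ ℕ} (hu : u.degree = 2)
    {S : Finset V} {x y : States (fun _ : S => 2)} (hxy : x ≠ y) :
    0 ≤ margin (fun _ => 2) S (toInt u) x + margin (fun _ => 2) S (toInt u) y ∧
      margin (fun _ => 2) S (toInt u) x + margin (fun _ => 2) S (toInt u) y ≤ 2 := by
  obtain ⟨r, rfl⟩ := exists_counts_eq 2 u hu
  rw [margin_counts]
  simp only [Fin.sum_univ_two, Finsupp.coe_add, Pi.add_apply, Finsupp.single_apply]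
  constructor
  · positivity
  · split_ifs <;> first | omega | (exfalso; simp_all)

/-- If `bt` is an edge the margin vanishes. If not, it is `k` times `pairMove`, whose entries at 00
and 11 add up to 2; for a move of degree two the corresponding sum lies between -2 and 2, whence |k|
≤ 1. -/
theorem exists_kernel_generator (G : SimpleGraph V) {b t : V} (hbt : b ≠ t) :
    ∃ h, GeneratesKernelOn (graphComplex G) (fun _ => 2) {b, t} h ∧
      ∀ f ∈ LinearMap.ker (designMap (graphComplex G) fun _ => 2), HasDegree f 2 →
        IsSlowVaryingOn {b, t} h f := by
  by_cases hadj : G.Adj b t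
  · have hker := ker_designMap_inducedComplex_of_mem (d := fun _ => 2)
      (pair_mem_graphComplex (Or.inr hadj))
    refine ⟨0, ?_, fun f hf _ => Or.inl ?_⟩
    · rw [GeneratesKernelOn, hker]; simp
    · have := margin_mem_ker_inducedComplex hf {b, t}
      rw [hker] at this
      exact (Submodule.mem_bot ℤ).1 this
  · refine ⟨pairMove b t, generatesKernelOn_pairMove hbt hadj, fun f hf hdeg => ?_⟩
    have hmem := margin_mem_ker_inducedComplex hf {b, t}
    rw [generatesKernelOn_pairMove hbt hadj, Submodule.mem_span_singleton] at hmem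
    obtain ⟨k, hk⟩ := hmem
    have hne : pairState b t 0 0 ≠ pairState b t 1 1 := fun h => by
      simpa using ((pairState_inj hbt).1 h).1
    have hp := margin_apply_add_apply_le hdeg.1 hne
    have hn := margin_apply_add_apply_le hdeg.2 hne
    have h0 : ∀ x, margin (fun _ => 2) {b, t} (toInt (posExp f)) x -
        margin (fun _ => 2) {b, t} (toInt (negExp f)) x = k * pairMove b t x := by
      intro x
      rw [← Finsupp.sub_apply, ← map_sub, toInt_posExp_sub_toInt_negExp, ← hk]
      rfl
    have h00 := h0 (pairState b t 0 0)
    have h11 := h0 (pairState b t 1 1)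
    have e0 : pairMove b t (pairState b t 0 0) = 1 := by
      simp [pairMove, pairState_inj hbt]
    have e1 : pairMove b t (pairState b t 1 1) = 1 := by
      simp [pairMove, pairState_inj hbt]
    rw [e0] at h00
    rw [e1] at h11
    have : k = 0 ∨ k = 1 ∨ k = -1 := by omega
    rw [IsSlowVaryingOn, ← hk]
    rcases this with rfl | rfl | rfl <;> simp

end PairKernel

end BinaryTable

/-! ### Kernels of monomial maps -/

namespace MonomialMap

open MvPolynomial

variable {σ τ K : Type*} [Field K] {φ : MvPolynomial σ K →ₐ[K] MvPolynomial τ K}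
  {e : (σ →₀ ℕ) → (τ →₀ ℕ)}

/-- Choosing one representative monomial in each fiber gives a linear map `ψ` for which every `f` is
congruent to `ψ (φ f)` modulo `J`. On the kernel the latter is zero. -/
theorem ker_le_of_binomial_mem (hφ : ∀ u c, φ (monomial u c) = monomial (e u) c)
    {J : Ideal (MvPolynomial σ K)}
    (hJ : ∀ u v, e u = e v → (monomial u 1 - monomial v 1 : MvPolynomial σ K) ∈ J) :
    RingHom.ker φ ≤ J := by
  let g := Function.invFun e
  have hg : ∀ u, e (g (e u)) = e u := fun u => Function.invFun_eq ⟨u, rfl⟩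
  let ψ := (basisMonomials τ K).constr K fun m => (monomial (g m) 1 : MvPolynomial σ K)
  have hψ : ∀ m c, ψ (monomial m c) = monomial (g m) c := by
    intro m c
    have h1 : (monomial m c : MvPolynomial τ K) = c • basisMonomials τ K m := by
      rw [coe_basisMonomials, smul_monomial, smul_eq_mul, mul_one]
    rw [h1, map_smul, Module.Basis.constr_basis, smul_monomial, smul_eq_mul, mul_one]
  have key : ∀ f, f - ψ (φ f) ∈ J := by
    intro f
    induction f using MvPolynomial.induction_on' with
    | monomial u a =>
      rw [hφ, hψ]
      have : (monomial u a - monomial (g (e u)) a : MvPolynomial σ K) =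
          C a * (monomial u 1 - monomial (g (e u)) 1) := by
        rw [mul_sub, C_mul_monomial, C_mul_monomial, mul_one]
      rw [this]
      exact J.mul_mem_left _ (hJ _ _ (hg u).symm)
    | add p q hp hq =>
      have := J.add_mem hp hq
      rw [map_add, map_add]
      convert this using 1
      ring
  intro f hf
  have := key f
  rwa [RingHom.mem_ker.1 hf, map_zero, sub_zero] at this

/-- For a monomial alone in its fiber, its coefficient in `f` is the coefficient of its image in `φ
f`. -/
theorem coeff_eq_zero_of_mem_ker (hφ : ∀ u c, φ (monomial u c) = monomial (e u) c)
    {w : σ →₀ ℕ} (hw : ∀ w', e w' = e w → w' = w) {f : MvPolynomial σ K}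
    (hf : f ∈ RingHom.ker φ) : coeff w f = 0 := by
  classical
  have key : ∀ f, coeff (e w) (φ f) = coeff w f := by
    intro f
    induction f using MvPolynomial.induction_on' with
    | monomial u a =>
      rw [hφ, coeff_monomial, coeff_monomial]
      by_cases h : u = w
      · rw [if_pos h, if_pos (by rw [h])]
      · rw [if_neg h, if_neg fun h' => h (hw u h')]
    | add p q hp hq => rw [map_add, coeff_add, coeff_add, hp, hq]
  rw [← key, RingHom.mem_ker.1 hf, coeff_zero]

/-- If all generators had degree below that of `u`, no multiple of one could contain the monomial
`u`: a proper divisor of `u` is alone in its fiber and does not occur in the kernel, and `u` itself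
is too large to occur in a generator. The binomial of `u` and `v` contradicts this. -/
theorem exists_totalDegree_ge (hφ : ∀ u c, φ (monomial u c) = monomial (e u) c)
    {u v : σ →₀ ℕ} (huv : u ≠ v) (he : e u = e v)
    (hsub : ∀ m w, m ≠ 0 → m + w = u → ∀ w', e w' = e w → w' = w)
    {S : Set (MvPolynomial σ K)} (hS : Ideal.span S = RingHom.ker φ) :
    ∃ f ∈ S, u.degree ≤ f.totalDegree := by
  classical
  by_contra hcon
  push Not at hcon
  have key : ∀ x ∈ Ideal.span S, ∀ a, coeff u (a * x) = 0 := by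
    intro x hx
    induction hx using Submodule.span_induction with
    | mem s hs =>
      intro a
      rw [coeff_mul]
      refine Finset.sum_eq_zero fun p hp => ?_
      rw [Finset.HasAntidiagonal.mem_antidiagonal] at hp
      by_cases hm : p.1 = 0
      · have : p.2 = u := by rw [← hp, hm, zero_add]
        have hlt := hcon s hs
        rw [Finsupp.degree_apply] at hlt
        rw [this, coeff_eq_zero_of_totalDegree_lt hlt, mul_zero]
      · rw [coeff_eq_zero_of_mem_ker hφ (hsub _ _ hm hp) (hS ▸ Ideal.subset_span hs), mul_zero]
    | zero => simp
    | add x y _ _ hx hy => intro a; rw [mul_add, coeff_add, hx, hy, add_zero]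
    | smul b x _ hx => intro a; rw [smul_eq_mul, ← mul_assoc]; exact hx _
  have hmem : (monomial u 1 - monomial v 1 : MvPolynomial σ K) ∈ Ideal.span S := by
    rw [hS, RingHom.mem_ker, map_sub, hφ, hφ, he, sub_self]
  have := key _ hmem 1
  rw [one_mul, coeff_sub, coeff_monomial, coeff_monomial, if_pos rfl, if_neg huv.symm] at this
  simp at this

end MonomialMap

/-! ### Degrees of minimal generators -/

section GeneratorDegree

open MvPolynomial

variable {σ K : Type*} [Field K]

/-- In a combination of homogeneous generators, the part of degree `d` only involves generators of
degree at most `d`. The multiplier `a` in the proof carries the induction through scalar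
multiplication. -/
theorem homogeneousComponent_mem_span {S : Set (MvPolynomial σ K)}
    (hS : ∀ f ∈ S, ∃ n, f.IsHomogeneous n) (n : ℕ) {x : MvPolynomial σ K}
    (hx : x ∈ Ideal.span S) : ∀ d ≤ n,
      homogeneousComponent d x ∈ Ideal.span {f ∈ S | f.totalDegree ≤ n} := by
  suffices ∀ a, ∀ d ≤ n, homogeneousComponent d (a * x) ∈ Ideal.span {f ∈ S | f.totalDegree ≤ n} by
    simpa using this 1
  induction hx using Submodule.span_induction with
  | mem s hs =>
    intro a d hd
    obtain ⟨k, hk⟩ := hS s hs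
    rw [← sum_homogeneousComponent a, Finset.sum_mul, map_sum]
    refine Ideal.sum_mem _ fun i _ => ?_
    rw [homogeneousComponent_of_mem ((homogeneousComponent_isHomogeneous i a).mul hk)]
    split_ifs with h
    · refine Ideal.mul_mem_left _ _ (Ideal.subset_span ⟨hs, ?_⟩)
      exact hk.totalDegree_le.trans (by omega)
    · exact Ideal.zero_mem _
  | zero => simp
  | add x y _ _ hx hy =>
    intro a d hd
    rw [mul_add, map_add]
    exact Ideal.add_mem _ (hx a d hd) (hy a d hd)
  | smul b x _ hx => intro a d hd; rw [smul_eq_mul, ← mul_assoc]; exact hx _ d hd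

/-- If the ideal is generated in degrees at most `n`, the members of `S` of degree at most `n`
already generate it. A larger member would contradict minimality. -/
theorem IsMinimalHomogeneousGenerators.totalDegree_le {I : Ideal (MvPolynomial σ K)}
    {S B : Set (MvPolynomial σ K)} (hS : IsMinimalHomogeneousGenerators I S) {n : ℕ}
    (hB : ∀ f ∈ B, ∃ d ≤ n, f.IsHomogeneous d) (hI : Ideal.span B = I) {f : MvPolynomial σ K}
    (hf : f ∈ S) : f.totalDegree ≤ n := by
  obtain ⟨hhom, hspan, hmin⟩ := hS
  by_contra hcon
  refine hmin {f ∈ S | f.totalDegree ≤ n} ⟨fun f hf => hf.1, fun h => hcon (h hf).2⟩ ?_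
  apply le_antisymm
  · rw [← hspan]
    exact Ideal.span_mono fun f hf => hf.1
  · rw [← hI, Ideal.span_le]
    intro g hg
    obtain ⟨d, hd, hgd⟩ := hB g hg
    have hgS : g ∈ Ideal.span S := by rw [hspan, ← hI]; exact Ideal.subset_span hg
    have := homogeneousComponent_mem_span hhom n hgS d hd
    rwa [homogeneousComponent_of_mem hgd, if_pos rfl] at this

theorem maxGeneratorDegree_le {I : Ideal (MvPolynomial σ K)} {B : Set (MvPolynomial σ K)} {n : ℕ}
    (hB : ∀ f ∈ B, ∃ d ≤ n, f.IsHomogeneous d) (hI : Ideal.span B = I) :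
    maxGeneratorDegree I ≤ n := by
  refine sSup_le ?_
  rintro _ ⟨S, hS, f, hf, rfl⟩
  exact_mod_cast hS.totalDegree_le hB hI hf

theorem exists_isMinimalHomogeneousGenerators {I : Ideal (MvPolynomial σ K)}
    {B : Set (MvPolynomial σ K)} (hfin : B.Finite) (hB : ∀ f ∈ B, ∃ d, f.IsHomogeneous d)
    (hI : Ideal.span B = I) : ∃ S, IsMinimalHomogeneousGenerators I S := by
  have hfin' : {T | T ⊆ B ∧ Ideal.span T = I}.Finite :=
    hfin.finite_subsets.subset fun T hT => hT.1
  obtain ⟨T, -, hT⟩ := hfin'.exists_le_minimal (a := B) ⟨subset_rfl, hI⟩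
  refine ⟨T, fun f hf => hB f (hT.prop.1 hf), hT.prop.2, fun T' hT' hspan => ?_⟩
  exact hT'.2 (hT.2 ⟨hT'.1.trans hT.prop.1, hspan⟩ hT'.1)

/-- A lower bound for the supremum needs some minimal generating set to exist; one is extracted from
the finite set `B`. -/
theorem le_maxGeneratorDegree {I : Ideal (MvPolynomial σ K)} {B : Set (MvPolynomial σ K)} {n : ℕ}
    (hfin : B.Finite) (hB : ∀ f ∈ B, ∃ d, f.IsHomogeneous d) (hI : Ideal.span B = I)
    (h : ∀ S : Set (MvPolynomial σ K), Ideal.span S = I → ∃ f ∈ S, n ≤ f.totalDegree) :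
    (n : ℕ∞) ≤ maxGeneratorDegree I := by
  obtain ⟨S, hS⟩ := exists_isMinimalHomogeneousGenerators hfin hB hI
  obtain ⟨f, hf, hn⟩ := h S hS.2.1
  exact (Nat.cast_le.2 hn).trans (le_sSup ⟨S, hS, f, hf, rfl⟩)

end GeneratorDegree

/-! ### The toric ideal and Markov bases -/

namespace HierModel

open MvPolynomial MarkovBasis

variable {V : Type*} [Finite V] {Γ : LowerSet (Finset V)} {d : V → ℕ}

/-- The exponent of the image of the monomial `p^u` under the parametrization. -/
noncomputable def paramExp (Γ : LowerSet (Finset V)) (d : V → ℕ) (u : States d →₀ ℕ) :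
    Params Γ d →₀ ℕ :=
  u.sum fun i n => n • ∑ F : facets Γ, Finsupp.single ⟨F, F.1.restrict i⟩ 1

theorem parametrization_monomial (K : Type*) [Field K] (u : States d →₀ ℕ) (c : K) :
    parametrization K Γ d (monomial u c) = monomial (paramExp Γ d u) c := by
  rw [parametrization, aeval_monomial, paramExp, Finsupp.sum, monomial_sum_index,
    Finsupp.prod, MvPolynomial.algebraMap_eq]
  congr 1
  refine Finset.prod_congr rfl fun i _ => ?_
  have hpow : ∀ (n : ℕ) (w : Params Γ d →₀ ℕ),
      (monomial (n • w) 1 : MvPolynomial _ K) = monomial w 1 ^ n := fun n w => by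
    rw [monomial_pow, one_pow]
  rw [hpow, monomial_sum_one]
  rfl

theorem paramExp_apply (u : States d →₀ ℕ) (F : facets Γ) (j : States fun v : F.1 => d v) :
    (paramExp Γ d u ⟨F, j⟩ : ℤ) = designMap Γ d (toInt u) F j := by
  classical
  induction u using Finsupp.induction_linear with
  | zero => simp [paramExp, toInt]
  | add u v hu hv =>
    rw [toInt_add, map_add, Pi.add_apply, Finsupp.add_apply, ← hu, ← hv, paramExp,
      Finsupp.sum_add_index' (by simp) (by simp [add_smul])]
    rfl
  | single i n =>
    have : toInt (Finsupp.single i n) = Finsupp.single i (n : ℤ) := by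
      simp [toInt]
    rw [this, paramExp, Finsupp.sum_single_index (by simp)]
    change _ = (Finsupp.mapDomain F.1.restrict (Finsupp.single i (n : ℤ))) j
    rw [Finsupp.mapDomain_single, Finsupp.smul_apply, Finsupp.finsetSum_apply,
      Finset.sum_eq_single F]
    · by_cases h : F.1.restrict i = j
      · subst h; simp
      · rw [Finsupp.single_eq_of_ne (Ne.symm h), Finsupp.single_eq_of_ne]
        · simp
        · intro h'
          exact h (by simpa using h'.symm)
    · intro F' _ hF'
      rw [Finsupp.single_eq_of_ne]
      intro h'
      exact hF' (congrArg Sigma.fst h').symm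
    · simp

theorem paramExp_eq_iff (u v : States d →₀ ℕ) :
    paramExp Γ d u = paramExp Γ d v ↔ designMap Γ d (toInt u) = designMap Γ d (toInt v) := by
  constructor
  · intro h
    funext F
    ext j
    rw [← paramExp_apply, ← paramExp_apply, h]
  · intro h
    ext ⟨F, j⟩
    have : (paramExp Γ d u ⟨F, j⟩ : ℤ) = paramExp Γ d v ⟨F, j⟩ := by
      rw [paramExp_apply, paramExp_apply, h]
    exact_mod_cast this

/-- The binomial `p^{f⁺} - p^{f⁻}` of a move. -/
noncomputable def binomial (K : Type*) [Field K] {σ : Type*} (f : σ →₀ ℤ) : MvPolynomial σ K :=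
  monomial (posExp f) 1 - monomial (negExp f) 1

theorem monomial_sub_monomial_eq (K : Type*) [Field K] {σ : Type*} (u v : σ →₀ ℕ) :
    (monomial u 1 - monomial v 1 : MvPolynomial σ K) =
      monomial (u ⊓ v) 1 * binomial K (toInt u - toInt v) := by
  have h1 : u ⊓ v + posExp (toInt u - toInt v) = u := by
    ext x
    simp only [Finsupp.add_apply, Finsupp.inf_apply, posExp_apply, Finsupp.sub_apply, toInt_apply]
    omega
  have h2 : u ⊓ v + negExp (toInt u - toInt v) = v := by
    ext x
    simp only [negExp, neg_sub, Finsupp.add_apply, Finsupp.inf_apply, posExp_apply,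
      Finsupp.sub_apply, toInt_apply]
    omega
  rw [binomial, mul_sub, monomial_mul, monomial_mul, h1, h2, one_mul]

theorem sub_mem_span_binomial_of_reachable (K : Type*) [Field K] {σ W : Type*} [AddCommGroup W]
    {A : (σ →₀ ℤ) →ₗ[ℤ] W} {M : Set (σ →₀ ℤ)} {w : W} {x y : {u : σ →₀ ℕ // A (toInt u) = w}}
    (h : (fiberGraph A M w).Reachable x y) :
    (monomial x.1 1 - monomial y.1 1 : MvPolynomial σ K) ∈ Ideal.span (binomial K '' M) := by
  obtain ⟨p⟩ := h
  induction p with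
  | nil => simp
  | @cons x y z h _ ih =>
    rw [← sub_add_sub_cancel _ (monomial y.1 1) _]
    refine Ideal.add_mem _ ?_ ih
    rw [fiberGraph, SimpleGraph.fromRel_adj] at h
    rcases h.2 with h | h
    · rw [monomial_sub_monomial_eq]
      exact Ideal.mul_mem_left _ _ (Ideal.subset_span ⟨_, h, rfl⟩)
    · rw [← neg_sub, monomial_sub_monomial_eq]
      exact neg_mem (Ideal.mul_mem_left _ _ (Ideal.subset_span ⟨_, h, rfl⟩))

/-- The kernel of a monomial map is spanned by differences of monomials in one fiber, and such a
difference telescopes along a path of moves, each step being a monomial times a binomial of the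
basis. -/
theorem span_binomial_eq_toricIdeal (K : Type*) [Field K] {M : Set (States d →₀ ℤ)}
    (hM : IsMarkovBasis (designMap Γ d) M) :
    Ideal.span (binomial K '' M) = toricIdeal K Γ d := by
  apply le_antisymm
  · rw [Ideal.span_le]
    rintro _ ⟨f, hf, rfl⟩
    rw [SetLike.mem_coe, toricIdeal, RingHom.mem_ker, binomial, map_sub, parametrization_monomial,
      parametrization_monomial, sub_eq_zero]
    congr 2
    rw [paramExp_eq_iff, ← sub_eq_zero, ← map_sub, toInt_posExp_sub_toInt_negExp]
    exact hM.2.1 f hf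
  · refine MonomialMap.ker_le_of_binomial_mem (parametrization_monomial K) fun u v huv => ?_
    rw [paramExp_eq_iff] at huv
    have hreach := (hM.2.2 v).preconnected ⟨u, huv⟩ ⟨v, rfl⟩
    have hmem := sub_mem_span_binomial_of_reachable K hreach
    exact hmem

theorem isHomogeneous_binomial (K : Type*) [Field K] {σ : Type*} {f : σ →₀ ℤ} {n : ℕ}
    (h : HasDegree f n) : (binomial K f).IsHomogeneous n :=
  (isHomogeneous_monomial _ h.1).sub (isHomogeneous_monomial _ h.2)

theorem posExp_ne_negExp {σ : Type*} {f : σ →₀ ℤ} {n : ℕ} (h : HasDegree f n) (hn : n ≠ 0) :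
    posExp f ≠ negExp f := by
  intro heq
  have h0 := toInt_posExp_sub_toInt_negExp f
  rw [heq, sub_self] at h0
  apply hn
  rw [← h.1, ← h0]
  simp [posExp]

theorem isGeneratedByBinomialsOfDegrees (K : Type*) [Field K] {M : Set (States d →₀ ℤ)}
    (hM : IsMarkovBasis (designMap Γ d) M) {D : Set ℕ} (hD : 0 ∉ D)
    (hdeg : ∀ f ∈ M, ∃ n ∈ D, HasDegree f n) :
    IsGeneratedByBinomialsOfDegrees (toricIdeal K Γ d) D := by
  refine ⟨_, span_binomial_eq_toricIdeal K hM, ?_⟩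
  rintro _ ⟨f, hf, rfl⟩
  obtain ⟨n, hn, h⟩ := hdeg f hf
  exact ⟨n, hn, _, _, posExp_ne_negExp h fun h0 => hD (h0 ▸ hn), h.1, h.2, rfl⟩

end HierModel

/-! ### A spanning triangle minor in a graph with a cycle -/

section Triangle

variable {V : Type*} {G : SimpleGraph V}

/-- `a` and `c` are joined by a walk inside `X`. -/
def WalkIn (G : SimpleGraph V) (X : Set V) : V → V → Prop :=
  Relation.ReflTransGen fun a c => G.Adj a c ∧ a ∈ X ∧ c ∈ X

theorem WalkIn.symm {X : Set V} {a c : V} (h : WalkIn G X a c) : WalkIn G X c a := by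
  induction h with
  | refl => exact Relation.ReflTransGen.refl
  | tail _ h ih => exact Relation.ReflTransGen.head ⟨h.1.symm, h.2.2, h.2.1⟩ ih

/-- Removing a component of `X \ {x}` from a connected set `X` leaves a connected set. -/
theorem walkIn_split {X : Set V} {x z : V} (hX : ∀ w ∈ X, WalkIn G X x w)
    (hz : z ∈ X) (hzx : z ≠ x) :
    ∃ D ⊆ X, x ∉ D ∧ (∀ w, WalkIn G (X \ {x}) z w → w ∈ D) ∧ (∀ w ∈ D, WalkIn G D z w) ∧
      (∀ w ∈ X \ D, WalkIn G (X \ D) x w) ∧ ∃ w ∈ D, G.Adj x w := by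
  have hstep : ∀ m k, WalkIn G (X \ {x}) z m → G.Adj m k → m ∈ X → k ∈ X → m ≠ x → k ≠ x →
      WalkIn G (X \ {x}) z k := fun m k hm h h1 h2 h3 h4 => hm.tail ⟨h, ⟨h1, h3⟩, ⟨h2, h4⟩⟩
  have hsub : ∀ w, WalkIn G (X \ {x}) z w → w ∈ X ∧ w ≠ x := by
    intro w hw
    induction hw with
    | refl => exact ⟨hz, hzx⟩
    | tail _ h _ => exact h.2.2
  refine ⟨{w | WalkIn G (X \ {x}) z w}, fun w hw => (hsub w hw).1, fun h => (hsub x h).2 rfl,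
    fun w hw => hw, fun w hw => ?_, fun w hw => ?_, ?_⟩
  · change WalkIn G (X \ {x}) z w at hw
    induction hw with
    | refl => exact Relation.ReflTransGen.refl
    | tail h1 h2 ih => exact ih.tail ⟨h2.1, h1, h1.tail h2⟩
  · have key : ∀ k, WalkIn G X x k → WalkIn G (X \ {x}) z k ∨
        WalkIn G (X \ {w | WalkIn G (X \ {x}) z w}) x k := by
      intro k hk
      induction hk with
      | refl => exact Or.inr Relation.ReflTransGen.refl
      | @tail m k _ h ih =>
        by_cases hkx : k = x
        · subst hkx; exact Or.inr Relation.ReflTransGen.refl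
        by_cases hkD : WalkIn G (X \ {x}) z k
        · exact Or.inl hkD
        right
        by_cases hmD : WalkIn G (X \ {x}) z m
        · exact absurd (hstep m k hmD h.1 h.2.1 h.2.2 (hsub m hmD).2 hkx) hkD
        · exact (ih.resolve_left hmD).tail ⟨h.1, ⟨h.2.1, hmD⟩, ⟨h.2.2, hkD⟩⟩
    exact (key w (hX w hw.1)).resolve_left hw.2
  · have key : ∀ k, WalkIn G X x k → WalkIn G (X \ {x}) z k →
        ∃ w, WalkIn G (X \ {x}) z w ∧ G.Adj x w := by
      intro k hk
      induction hk with
      | refl => exact fun h => absurd rfl (hsub x h).2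
      | @tail m k _ h ih =>
        intro hkD
        by_cases hmx : m = x
        · subst hmx; exact ⟨k, hkD, h.1⟩
        · exact ih (hstep k m hkD h.1.symm h.2.2 h.2.1 (hsub k hkD).2 hmx)
    exact key z (hX z hz) Relation.ReflTransGen.refl

/-- A connected graph with a cycle contracts to a triangle. -/
theorem exists_triangle_contraction (hconn : G.Connected) (hcyc : ¬ G.IsAcyclic) :
    ∃ φ : V → Fin 3,
      (∀ x y, φ x = φ y → Relation.ReflTransGen (fun a c => G.Adj a c ∧ φ a = φ c) x y) ∧
      ∀ i j, i ≠ j → ∃ x y, G.Adj x y ∧ φ x = i ∧ φ y = j := by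
  classical
  rw [SimpleGraph.isAcyclic_iff_forall_isBridge] at hcyc
  push Not at hcyc
  obtain ⟨e, he, hbr⟩ := hcyc
  induction e using Sym2.ind with
  | _ x y =>
  have hxy : G.Adj x y := he
  rw [SimpleGraph.isBridge_iff] at hbr
  have hreach : (G.deleteEdges {s(x, y)}).Reachable y x := by
    by_contra hcon
    exact hbr fun h => hcon h.symm
  have huniv : ∀ w ∈ (Set.univ : Set V), WalkIn G Set.univ x w := by
    rintro w -
    have := (SimpleGraph.reachable_iff_reflTransGen x w).1 (hconn.preconnected x w)
    induction this with
    | refl => exact Relation.ReflTransGen.refl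
    | tail _ h ih => exact ih.tail ⟨h, trivial, trivial⟩
  obtain ⟨C, -, hxC, hC, hCconn, hCc, -⟩ := walkIn_split huniv (Set.mem_univ y) hxy.ne'
  -- The edge `xy` is not a bridge. A walk from `y` to `x` avoiding it first reaches `x` from a
  -- neighbour other than `y`, and up to then it stays in the component `C` of `y`.
  obtain ⟨z, hz, hzy, hzC⟩ : ∃ z, G.Adj x z ∧ z ≠ y ∧ z ∈ C := by
    have key : ∀ k, Relation.ReflTransGen (G.deleteEdges {s(x, y)}).Adj y k →
        (k ≠ x ∧ WalkIn G (Set.univ \ {x}) y k) ∨ ∃ z, G.Adj x z ∧ z ≠ y ∧ z ∈ C := by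
      intro k hk
      induction hk with
      | refl => exact Or.inl ⟨hxy.ne', Relation.ReflTransGen.refl⟩
      | @tail m k _ h ih =>
        rw [SimpleGraph.deleteEdges_adj] at h
        rcases ih with ⟨hmx, hm⟩ | ih
        · by_cases hkx : k = x
          · subst hkx
            right
            refine ⟨m, h.1.symm, fun hmy => h.2 ?_, hC m hm⟩
            rw [hmy, Set.mem_singleton_iff, Sym2.eq_swap]
          · exact Or.inl ⟨hkx, hm.tail ⟨h.1, ⟨trivial, hmx⟩, ⟨trivial, hkx⟩⟩⟩
        · exact Or.inr ih
    exact (key x ((SimpleGraph.reachable_iff_reflTransGen y x).1 hreach)).resolve_left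
      fun h => h.1 rfl
  obtain ⟨D, hDC, hyD, hD, hDconn, hDc, w, hwD, hyw⟩ := walkIn_split hCconn hzC hzy
  have hyC : y ∈ C := hC y Relation.ReflTransGen.refl
  have hzD : z ∈ D := hD z Relation.ReflTransGen.refl
  -- The classes are the complement of `C`, the set `C \ D` and `D`. Each is connected by
  -- `walkIn_split`, and the edges `xy`, `xz`, `yw` join them pairwise.
  let φ : V → Fin 3 := fun v => if v ∈ C then if v ∈ D then 2 else 1 else 0
  have φ0 : ∀ v, φ v = 0 ↔ v ∈ Set.univ \ C := by
    intro v; by_cases h : v ∈ C <;> by_cases h' : v ∈ D <;> simp [φ, h, h']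
  have φ1 : ∀ v, φ v = 1 ↔ v ∈ C \ D := by
    intro v; by_cases h : v ∈ C <;> by_cases h' : v ∈ D <;> simp [φ, h, h']
  have φ2 : ∀ v, φ v = 2 ↔ v ∈ D := by
    intro v
    by_cases h' : v ∈ D
    · simp [φ, h', hDC h']
    · by_cases h : v ∈ C <;> simp [φ, h, h']
  have lift : ∀ (X : Set V) (i : Fin 3), (∀ v, φ v = i ↔ v ∈ X) → ∀ c a d,
      WalkIn G X c a → WalkIn G X c d →
      Relation.ReflTransGen (fun a c => G.Adj a c ∧ φ a = φ c) a d := by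
    intro X i hi c a d h1 h2
    have := h1.symm.trans h2
    clear h1 h2
    induction this with
    | refl => exact Relation.ReflTransGen.refl
    | tail _ h ih =>
      exact ih.tail ⟨h.1, ((hi _).2 h.2.1).trans ((hi _).2 h.2.2).symm⟩
  refine ⟨φ, fun a d had => ?_, ?_⟩
  · have hcases : φ a = 0 ∨ φ a = 1 ∨ φ a = 2 := by
      generalize φ a = i
      fin_cases i <;> simp
    rcases hcases with h | h | h <;> rw [h] at had
    · exact lift _ 0 φ0 x a d (hCc a ((φ0 a).1 h)) (hCc d ((φ0 d).1 had.symm))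
    · exact lift _ 1 φ1 y a d (hDc a ((φ1 a).1 h)) (hDc d ((φ1 d).1 had.symm))
    · exact lift _ 2 φ2 z a d (hDconn a ((φ2 a).1 h)) (hDconn d ((φ2 d).1 had.symm))
  · have e0 : φ x = 0 := (φ0 x).2 ⟨trivial, hxC⟩
    have e1 : φ y = 1 := (φ1 y).2 ⟨hyC, hyD⟩
    have e2 : φ z = 2 := (φ2 z).2 hzD
    have e2' : φ w = 2 := (φ2 w).2 hwD
    intro i j hij
    fin_cases i <;> fin_cases j
    · exact absurd rfl hij
    · exact ⟨x, y, hxy, e0, e1⟩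
    · exact ⟨x, z, hz, e0, e2⟩
    · exact ⟨y, x, hxy.symm, e1, e0⟩
    · exact absurd rfl hij
    · exact ⟨y, w, hyw, e1, e2'⟩
    · exact ⟨z, x, hz.symm, e2, e0⟩
    · exact ⟨w, y, hyw.symm, e2', e1⟩
    · exact absurd rfl hij

end Triangle

theorem IsSeriesParallel.reachable {V : Type u} {G : SimpleGraph V} {t b : V}
    (h : IsSeriesParallel G t b) : ∀ v, G.Reachable b v := by
  induction h with
  | edge G t b hV hG =>
    intro v
    rcases hV v with rfl | rfl
    · exact hG.symm.reachable
    · exact SimpleGraph.Reachable.refl _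
  | @series V₁ V₂ V G₁ G₂ t₁ b₁ t₂ b₂ f₁ f₂ _ _ hcover hglue ih₁ ih₂ =>
    have m₁ : ∀ x y, G₁.Reachable x y → (G₁.map f₁ ⊔ G₂.map f₂).Reachable (f₁ x) (f₁ y) :=
      fun x y h => (h.map (SimpleGraph.Embedding.map f₁ G₁).toHom).mono le_sup_left
    have m₂ : ∀ x y, G₂.Reachable x y → (G₁.map f₁ ⊔ G₂.map f₂).Reachable (f₂ x) (f₂ y) :=
      fun x y h => (h.map (SimpleGraph.Embedding.map f₂ G₂).toHom).mono le_sup_right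
    have hg : f₁ t₁ = f₂ b₂ := (hglue _ _).2 ⟨rfl, rfl⟩
    intro v
    have hv : v ∈ Set.range f₁ ∪ Set.range f₂ := by rw [hcover]; trivial
    rcases hv with ⟨x, rfl⟩ | ⟨x, rfl⟩
    · exact m₁ _ _ (ih₁ x)
    · exact (hg ▸ m₁ _ _ (ih₁ t₁)).trans (m₂ _ _ (ih₂ x))
  | @parallel V₁ V₂ V G₁ G₂ t₁ b₁ t₂ b₂ f₁ f₂ _ _ hcover hglue ih₁ ih₂ =>
    have m₁ : ∀ x y, G₁.Reachable x y → (G₁.map f₁ ⊔ G₂.map f₂).Reachable (f₁ x) (f₁ y) :=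
      fun x y h => (h.map (SimpleGraph.Embedding.map f₁ G₁).toHom).mono le_sup_left
    have m₂ : ∀ x y, G₂.Reachable x y → (G₁.map f₁ ⊔ G₂.map f₂).Reachable (f₂ x) (f₂ y) :=
      fun x y h => (h.map (SimpleGraph.Embedding.map f₂ G₂).toHom).mono le_sup_right
    have hg : f₁ b₁ = f₂ b₂ := (hglue _ _).2 (Or.inr ⟨rfl, rfl⟩)
    intro v
    have hv : v ∈ Set.range f₁ ∪ Set.range f₂ := by rw [hcover]; trivial
    rcases hv with ⟨x, rfl⟩ | ⟨x, rfl⟩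
    · exact m₁ _ _ (ih₁ x)
    · exact hg ▸ m₂ _ _ (ih₂ x)

theorem IsSeriesParallel.connected {V : Type u} {G : SimpleGraph V} {t b : V}
    (h : IsSeriesParallel G t b) : G.Connected :=
  SimpleGraph.connected_iff_exists_forall_reachable G |>.2 ⟨b, h.reachable⟩

/-! ### The quartic move of a cycle -/

namespace BinaryTable

set_option linter.unusedSectionVars false

open MarkovBasis HierModel

section Patterns

variable {ι : Type*} [Fintype ι]

/-- The four states of a triangle with an even number of ones. -/
def evenPattern : Fin 4 → Fin 3 → Fin 2 := ![![0, 0, 0], ![0, 1, 1], ![1, 0, 1], ![1, 1, 0]]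

/-- The four states of a triangle with an odd number of ones. -/
def oddPattern : Fin 4 → Fin 3 → Fin 2 := ![![1, 1, 1], ![1, 0, 0], ![0, 1, 0], ![0, 0, 1]]

theorem evenPattern_injective : Function.Injective evenPattern := by decide

theorem evenPattern_ne_oddPattern : ∀ l l', evenPattern l ≠ oddPattern l' := by decide

theorem card_pair_eq_add (p : ι → Fin 3 → Fin 2) (a c : Fin 2) :
    (Finset.univ.filter fun k => p k 0 = a ∧ p k 1 = c).card =
      (Finset.univ.filter fun k => p k = ![a, c, 0]).card +
        (Finset.univ.filter fun k => p k = ![a, c, 1]).card ∧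
    (Finset.univ.filter fun k => p k 0 = a ∧ p k 2 = c).card =
      (Finset.univ.filter fun k => p k = ![a, 0, c]).card +
        (Finset.univ.filter fun k => p k = ![a, 1, c]).card ∧
    (Finset.univ.filter fun k => p k 1 = a ∧ p k 2 = c).card =
      (Finset.univ.filter fun k => p k = ![0, a, c]).card +
        (Finset.univ.filter fun k => p k = ![1, a, c]).card := by
  classical
  simp only [Finset.card_filter, ← Finset.sum_add_distrib]
  refine ⟨Finset.sum_congr rfl fun k _ => ?_, Finset.sum_congr rfl fun k _ => ?_,
    Finset.sum_congr rfl fun k _ => ?_⟩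
  all_goals
    generalize p k = x
    revert x a c
    decide

/-- Tables of three columns with equal pair margins differ by a multiple of even cells minus odd
cells. Since `p` has no odd cells and lacks one even cell, nonnegativity of the counts of `q`
excludes either sign of the multiple. -/
theorem exists_perm_of_pair_margins {p q : ι → Fin 3 → Fin 2}
    (hpq : ∀ i j, i ≠ j → ∃ τ : Equiv.Perm ι, ∀ k, p k i = q (τ k) i ∧ p k j = q (τ k) j)
    (heven : ∀ k, ∃ l, p k = evenPattern l) (hmiss : ∃ l, ∀ k, p k ≠ evenPattern l) :
    ∃ τ : Equiv.Perm ι, ∀ k, q k = p (τ k) := by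
  classical
  have hcard : ∀ i j, i ≠ j → ∀ a c, (Finset.univ.filter fun k => p k i = a ∧ p k j = c).card =
      (Finset.univ.filter fun k => q k i = a ∧ q k j = c).card := by
    intro i j hij a c
    obtain ⟨τ, hτ⟩ := hpq i j hij
    refine Finset.card_bij (fun k _ => τ k) (fun k hk => ?_) (fun _ _ _ _ h => τ.injective h)
      fun k hk => ⟨τ.symm k, ?_, by simp⟩
    · have := hτ k
      simp_all
    · have := hτ (τ.symm k)
      simp_all
  have hodd : ∀ l, (Finset.univ.filter fun k => p k = oddPattern l).card = 0 := by
    intro l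
    rw [Finset.card_eq_zero, Finset.filter_eq_empty_iff]
    intro k _ h
    obtain ⟨l', hl'⟩ := heven k
    exact evenPattern_ne_oddPattern l' l (hl'.symm.trans h)
  obtain ⟨l, hl⟩ := hmiss
  have hl0 : (Finset.univ.filter fun k => p k = evenPattern l).card = 0 := by
    rw [Finset.card_eq_zero, Finset.filter_eq_empty_iff]
    exact fun k _ => hl k
  have h01 := hcard 0 1 (by decide)
  have h02 := hcard 0 2 (by decide)
  have h12 := hcard 1 2 (by decide)
  simp only [fun a c => (card_pair_eq_add p a c).1, fun a c => (card_pair_eq_add q a c).1] at h01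
  simp only [fun a c => (card_pair_eq_add p a c).2.1,
    fun a c => (card_pair_eq_add q a c).2.1] at h02
  simp only [fun a c => (card_pair_eq_add p a c).2.2,
    fun a c => (card_pair_eq_add q a c).2.2] at h12
  have o0 : (Finset.univ.filter fun k => p k = ![1, 1, 1]).card = 0 := hodd 0
  have o1 : (Finset.univ.filter fun k => p k = ![1, 0, 0]).card = 0 := hodd 1
  have o2 : (Finset.univ.filter fun k => p k = ![0, 1, 0]).card = 0 := hodd 2
  have o3 : (Finset.univ.filter fun k => p k = ![0, 0, 1]).card = 0 := hodd 3
  have hm : (Finset.univ.filter fun k => p k = ![0, 0, 0]).card = 0 ∨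
      (Finset.univ.filter fun k => p k = ![0, 1, 1]).card = 0 ∨
      (Finset.univ.filter fun k => p k = ![1, 0, 1]).card = 0 ∨
      (Finset.univ.filter fun k => p k = ![1, 1, 0]).card = 0 := by
    fin_cases l
    · exact Or.inl hl0
    · exact Or.inr (Or.inl hl0)
    · exact Or.inr (Or.inr (Or.inl hl0))
    · exact Or.inr (Or.inr (Or.inr hl0))
  have a00 := h01 0 0
  have a01 := h01 0 1
  have a10 := h01 1 0
  have a11 := h01 1 1
  have b00 := h02 0 0
  have b01 := h02 0 1
  have b10 := h02 1 0
  have b11 := h02 1 1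
  have c00 := h12 0 0
  have c01 := h12 0 1
  have c10 := h12 1 0
  have c11 := h12 1 1
  refine exists_perm_of_count_eq q p fun x => ?_
  rw [Finset.sum_boole, Finset.sum_boole]
  congr 1
  have hx : x = ![x 0, x 1, x 2] := by
    funext i; fin_cases i <;> rfl
  rw [hx]
  generalize x 0 = a
  generalize x 1 = c
  generalize x 2 = d
  fin_cases a <;> fin_cases c <;> fin_cases d <;>
    simp only [Fin.zero_eta, Fin.mk_one, Fin.isValue] at * <;> omega

end Patterns

/-! ### Generators of degree at least four -/

section LowerBound

variable {V : Type*} [Finite V] {G : SimpleGraph V} {φ : V → Fin 3}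

theorem exists_eq_comp_of_const (hφ : Function.Surjective φ)
    (hclass : ∀ x y, φ x = φ y → Relation.ReflTransGen (fun a c => G.Adj a c ∧ φ a = φ c) x y)
    {s : V → Fin 2} (hs : ∀ x y, G.Adj x y → φ x = φ y → s x = s y) :
    ∃ q : Fin 3 → Fin 2, s = q ∘ φ := by
  refine ⟨fun i => s (Function.surjInv hφ i), funext fun x => ?_⟩
  have := hclass x (Function.surjInv hφ (φ x)) (Function.surjInv_eq hφ (φ x)).symm
  change s x = s (Function.surjInv hφ (φ x))
  generalize Function.surjInv hφ (φ x) = y at this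
  induction this with
  | refl => rfl
  | tail _ h ih => exact ih.trans (hs _ _ h.1 h.2)

theorem counts_apply_self {ι σ : Type*} {J : Finset ι} (r : ι → σ) {i : ι} (hi : i ∈ J) :
    counts J r (r i) ≠ 0 := by
  classical
  rw [counts, Finsupp.finsetSum_apply]
  intro h
  have := (Finset.sum_eq_zero_iff.1 h) i hi
  simp at this

theorem counts_apply_le_one {ι σ : Type*} {J : Finset ι} {r : ι → σ} (hr : Function.Injective r)
    (x : σ) : counts J r x ≤ 1 := by
  classical
  rw [counts, Finsupp.finsetSum_apply]
  simp only [Finsupp.single_apply]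
  rw [Finset.sum_boole, Nat.cast_id, Finset.card_le_one]
  intro a ha c hc
  rw [Finset.mem_filter] at ha hc
  exact hr (ha.2.trans hc.2.symm)

theorem four_le_totalDegree (K : Type*) [Field K]
    (hclass : ∀ x y, φ x = φ y → Relation.ReflTransGen (fun a c => G.Adj a c ∧ φ a = φ c) x y)
    (hedge : ∀ i j, i ≠ j → ∃ x y, G.Adj x y ∧ φ x = i ∧ φ y = j)
    {S : Set (MvPolynomial (States fun _ : V => 2) K)}
    (hS : Ideal.span S = toricIdeal K (graphComplex G) fun _ => 2) :
    ∃ f ∈ S, 4 ≤ f.totalDegree := by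
  classical
  have hφ : Function.Surjective φ := by
    intro i
    obtain ⟨x, y, -, hx, -⟩ := hedge i (i + 1) (by revert i; decide)
    exact ⟨x, hx⟩
  let E : Fin 4 → V → Fin 2 := fun l => evenPattern l ∘ φ
  let O : Fin 4 → V → Fin 2 := fun l => oddPattern l ∘ φ
  have hE : Function.Injective E := by
    intro l l' h
    exact evenPattern_injective (hφ.injective_comp_right h)
  have hEO : ∀ l l', E l ≠ O l' := by
    intro l l' h
    exact evenPattern_ne_oddPattern l l' (hφ.injective_comp_right h)
  -- The even and the odd states of the triangle agree on every pair of coordinates, so their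
  -- pullbacks agree on every pair of columns, adjacent or not.
  have hfib : SameFiber G E O := by
    intro x y _
    change ∃ τ : Equiv.Perm (Fin 4), ∀ k, evenPattern k (φ x) = oddPattern (τ k) (φ x) ∧
      evenPattern k (φ y) = oddPattern (τ k) (φ y)
    generalize φ x = i
    generalize φ y = j
    revert i j
    decide
  have hne : counts Finset.univ E ≠ counts Finset.univ O := by
    intro h
    have h0 := counts_apply_self E (Finset.mem_univ 0)
    rw [h] at h0
    obtain ⟨l, -, hl⟩ := counts_ne_zero h0
    exact hEO 0 l hl.symm
  have hdeg : (counts Finset.univ E).degree = 4 := by rw [counts_degree]; rfl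
  rw [← hdeg]
  refine MonomialMap.exists_totalDegree_ge (parametrization_monomial K) hne
    ((paramExp_eq_iff _ _).2 ((designMap_counts_eq_iff G E O).2 hfib)) ?_ hS
  intro m w hm hmw w' hw'
  rw [paramExp_eq_iff] at hw'
  obtain ⟨n, hn⟩ : ∃ n, w.degree = n := ⟨_, rfl⟩
  obtain ⟨r, rfl⟩ := exists_counts_eq n w hn
  obtain ⟨s, rfl⟩ := exists_counts_eq n w'
    ((degree_eq_of_designMap_eq (empty_mem_graphComplex G) hw').trans hn)
  have hsr : SameFiber G r s := (designMap_counts_eq_iff G r s).1 hw'.symm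
  have hr : ∀ k, ∃ l, E l = r k := by
    intro k
    have h1 := counts_apply_self r (Finset.mem_univ k)
    have h2 := DFunLike.congr_fun hmw (r k)
    rw [Finsupp.add_apply] at h2
    obtain ⟨l, -, hl⟩ := counts_ne_zero (J := Finset.univ) (r := E) (x := r k) (by omega)
    exact ⟨l, hl⟩
  choose l hl using hr
  -- The four even rows occur once each, so a proper divisor of their monomial omits one of them.
  have hmiss : ∃ l', ∀ k, l k ≠ l' := by
    obtain ⟨x, hx⟩ : ∃ x, m x ≠ 0 := by
      by_contra hcon
      push Not at hcon
      exact hm (Finsupp.ext hcon)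
    have h2 := DFunLike.congr_fun hmw x
    rw [Finsupp.add_apply] at h2
    have h3 := counts_apply_le_one (J := Finset.univ) hE x
    obtain ⟨l', -, rfl⟩ := counts_ne_zero (J := Finset.univ) (r := E) (x := x) (by omega)
    refine ⟨l', fun k hk => ?_⟩
    have h4 := counts_apply_self r (Finset.mem_univ k)
    rw [← hl k, hk] at h4
    omega
  -- Edges inside a class force each row of `s` to be constant on it, since this holds for `r`. So
  -- `s` comes from a table of the triangle, whose pair margins are read off along edges between
  -- classes.
  have hs : ∀ k, ∃ q : Fin 3 → Fin 2, s k = q ∘ φ := by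
    intro k
    refine exists_eq_comp_of_const hφ hclass fun x y hxy h => ?_
    obtain ⟨τ, hτ⟩ := hsr x y (Or.inr hxy)
    have h1 := hτ (τ.symm k)
    rw [Equiv.apply_symm_apply] at h1
    rw [← h1.1, ← h1.2, ← hl]
    change evenPattern _ (φ x) = evenPattern _ (φ y)
    rw [h]
  choose q hq using hs
  obtain ⟨τ, hτ⟩ := exists_perm_of_pair_margins (p := fun k => evenPattern (l k)) (q := q)
    (fun i j hij => by
      obtain ⟨x, y, hxy, rfl, rfl⟩ := hedge i j hij
      obtain ⟨τ, hτ⟩ := hsr x y (Or.inr hxy)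
      refine ⟨τ, fun k => ?_⟩
      have := hτ k
      rw [← hl, hq] at this
      exact this)
    (fun k => ⟨l k, rfl⟩)
    (by
      obtain ⟨l', hl'⟩ := hmiss
      refine ⟨l', fun k hk => hl' k (hE ?_)⟩
      change evenPattern _ ∘ φ = evenPattern _ ∘ φ
      rw [hk])
  have : s = fun k => r (τ k) := by
    funext k
    rw [hq k, ← hl, hτ k]
  rw [this, counts_univ_comp_perm]

end LowerBound

/-- The whole vertex set is a face, so the design map is injective and every fiber is a single
point. -/
theorem isMarkovBasis_empty_of_subsingleton {V : Type*} [Finite V] [Subsingleton V]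
    (G : SimpleGraph V) : IsMarkovBasis (designMap (graphComplex G) fun _ => 2) ∅ := by
  classical
  have : Fintype V := Fintype.ofFinite V
  refine ⟨Set.finite_empty, by simp, fun u => ?_⟩
  have hmem : (Finset.univ : Finset V) ∈ graphComplex G := by
    refine ⟨?_, fun x _ y _ hxy => absurd (Subsingleton.elim x y) hxy⟩
    have := Fintype.card_le_one_iff_subsingleton.2 ‹Subsingleton V›
    rw [Finset.card_univ]
    omega
  have hker : ∀ f ∈ LinearMap.ker (designMap (graphComplex G) fun _ => 2), f = 0 := fun f hf =>
    Finsupp.mapDomain_id.symm.trans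
      (mapDomain_restrict_eq_zero hf hmem fun j => fun v : V => j ⟨v, Finset.mem_univ v⟩)
  have : Nonempty {v : States (fun _ : V => 2) →₀ ℕ //
      designMap (graphComplex G) (fun _ => 2) (toInt v) =
        designMap (graphComplex G) (fun _ => 2) (toInt u)} := ⟨⟨u, rfl⟩⟩
  refine ⟨fun x y => ?_⟩
  have hxy : x = y := by
    refine Subtype.ext (toInt_injective (sub_eq_zero.1 (hker _ ?_)))
    rw [LinearMap.mem_ker, map_sub, x.2, y.2, sub_self]
  rw [hxy]

theorem isGeneratedByBinomialsOfDegrees_moves (K : Type*) [Field K] {V : Type*} [Finite V]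
    [DecidableEq V] {G : SimpleGraph V} {t b : V} (h : ∀ n : ℕ, WellConnected (Fin n) G t b) :
    IsGeneratedByBinomialsOfDegrees (toricIdeal K (graphComplex G) fun _ => 2) {2, 4} := by
  refine isGeneratedByBinomialsOfDegrees K (isMarkovBasis_moves h) (by simp) ?_
  rintro f ⟨-, hf | hf⟩
  · exact ⟨4, by simp, hf.1⟩
  · exact ⟨2, by simp, hf⟩

theorem isHomogeneous_binomial_of_mem_moves (K : Type*) [Field K] {V : Type*} [Finite V]
    [DecidableEq V] {G : SimpleGraph V} {t b : V} :
    ∀ f ∈ binomial K '' moves G t b, ∃ d ≤ 4, f.IsHomogeneous d := by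
  rintro _ ⟨f, ⟨-, hf | hf⟩, rfl⟩
  · exact ⟨4, le_rfl, isHomogeneous_binomial K hf.1⟩
  · exact ⟨2, by norm_num, isHomogeneous_binomial K hf⟩

end BinaryTable

theorem mainTheorem7 (K : Type*) [Field K] {V : Type u} [Finite V] [DecidableEq V]
    (G : SimpleGraph V) :
    (∀ t b : V, IsSeriesParallel G t b →
      markovWidth K G ≤ 4 ∧
      (¬ G.IsAcyclic → markovWidth K G = 4) ∧
      ∃ (M : Set (HierModel.States (fun _ : V => 2) →₀ ℤ))
        (h : HierModel.States (fun _ : ({b, t} : Finset V) => 2) →₀ ℤ),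
        MarkovBasis.IsMarkovBasis
          (HierModel.designMap (HierModel.graphComplex G) fun _ => 2) M ∧
        GeneratesKernelOn (HierModel.graphComplex G) (fun _ => 2) {b, t} h ∧
        ∀ f ∈ M,
          (MarkovBasis.HasDegree f 4 ∧ IsConstantOn {b, t} f) ∨
          (MarkovBasis.HasDegree f 2 ∧ IsSlowVaryingOn {b, t} h f)) ∧
    (¬ IsMinorOf (⊤ : SimpleGraph (Fin 4)) G →
      IsGeneratedByBinomialsOfDegrees
        (HierModel.toricIdeal K (HierModel.graphComplex G) fun _ => 2) {2, 4}) := by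
  constructor
  · intro t b hsp
    have hM := BinaryTable.isMarkovBasis_moves fun n => BinaryTable.wellConnected_of_le_seriesParallel (Fin n) hsp G le_rfl
    have hspan :=
      HierModel.span_binomial_eq_toricIdeal K hM
    have hhom := BinaryTable.isHomogeneous_binomial_of_mem_moves K (G := G) (t := t) (b := b)
    have hle : markovWidth K G ≤ 4 := maxGeneratorDegree_le hhom hspan
    obtain ⟨h, hh, hslow⟩ := BinaryTable.exists_kernel_generator G (BinaryTable.top_ne_bottom hsp).symm
    refine ⟨hle, fun hcyc => le_antisymm hle ?_, BinaryTable.moves G t b, h, hM, hh, fun f hf => ?_⟩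
    · obtain ⟨φ, hclass, hedge⟩ := exists_triangle_contraction hsp.connected hcyc
      exact le_maxGeneratorDegree (n := 4) ((BinaryTable.moves_finite G t b).image _)
        (fun f hf => (hhom f hf).imp fun _ h => h.2) hspan
        fun S hS => BinaryTable.four_le_totalDegree K hclass hedge hS
    · exact hf.2.imp_right fun h2 => ⟨h2, hslow f hf.1 h2⟩
  · intro hminor
    -- Series-parallel graphs have at least two vertices, so smaller graphs are treated apart; their
    -- toric ideal is zero.
    rcases subsingleton_or_nontrivial V with hV | hV
    · exact HierModel.isGeneratedByBinomialsOfDegrees K (BinaryTable.isMarkovBasis_empty_of_subsingleton G)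
        (by simp) (by simp)
    · have hcard : 1 < Nat.card V := Finite.one_lt_card
      obtain ⟨H, t, b, hGH, hsp⟩ := exists_seriesParallel_of_not_isMinorOf (Nat.card V - 2)
        (by omega) G hminor
      exact BinaryTable.isGeneratedByBinomialsOfDegrees_moves K fun n =>
        BinaryTable.wellConnected_of_le_seriesParallel (Fin n) hsp G hGH
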